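/- There is a deterministic random access machine program which, given a finite simple undirected graph $G$ on $n\ge 1$ vertices (by its adjacency matrix), computes the treewidth of $G$ in time $O^*(4^k)$, where $k$ is the minimum size of a vertex cover of $G$. That is, there are constants $c,d\in\mathbb N$ such that on every such $G$ the program halts after time at most $c\cdot 4^k\cdot n^d$ (the machine has registers and a memory with computed addresses, holding natural numbers, and the operations addition, truncated subtraction, multiplication and integer division; time is logarithmic cost, i.e. each operation is charged the bit lengths of the numbers and addresses it handles) and outputs the treewidth of $G$. Here the treewidth of $G=(V,E)$ is the minimum, over all tree decompositions $(T,(X_i)_{i\in I})$ of $G$, of the width $\max_{i\in I}|X_i|-1$; a tree decomposition consists of a finite tree $T$ with node set $I$ and bags $X_i\subseteq V$ such that $V=\bigcup_{i\in I} X_i$, both ends of every edge of $G$ lie together in some bag, and for every $v\in V$ the nodes $i$ with $v\in X_i$ induce a connected subtree of $T$. -/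

import Mathlib

/-! ## Tree decompositions and treewidth -/

/-- A tree decomposition of `G`, with the nodes of its tree taken from `ι`. -/
structure TreeDecomposition {V : Type*} (G : SimpleGraph V) (ι : Type*) where
  /-- the tree whose nodes carry the bags -/
  tree : SimpleGraph ι
  isTree : tree.IsTree
  /-- the bag of a node -/
  bag : ι → Finset V
  cover : ∀ v : V, ∃ i, v ∈ bag i
  edge : ∀ u v : V, G.Adj u v → ∃ i, u ∈ bag i ∧ v ∈ bag i
  subtree : ∀ v : V, (tree.induce {i | v ∈ bag i}).Connected

namespace TreeDecomposition

/-- The width of a tree decomposition with finitely many nodes: the maximum size of a bag,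
minus one. (If `V` is nonempty then some bag is nonempty, so the subtraction is not truncated.) -/
def width {V : Type*} {G : SimpleGraph V} {ι : Type*} [Fintype ι]
    (D : TreeDecomposition G ι) : ℕ :=
  (Finset.univ.sup fun i => (D.bag i).card) - 1

end TreeDecomposition

/-- The treewidth of a finite nonempty graph: the minimum width over all its (finite) tree
decompositions. -/
noncomputable def treewidth {V : Type*} (G : SimpleGraph V) : ℕ :=
  sInf {w : ℕ | ∃ (ι : Type) (_ : Fintype ι) (D : TreeDecomposition G ι), D.width = w}

/-! ## Random access machines with logarithmic cost

The machine has registers (a program can name only finitely many of them) and a memory of cells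
with addresses `0, 1, 2, …`, which are accessed through computed addresses. Registers and cells
hold natural numbers. Programs are in structured form (sequence, conditional, while loop).
The time of a run is its logarithmic cost: each operation is charged the bit lengths of
the numbers, memory addresses included, on which it operates. -/

namespace RAM

/-- The contents of the registers and of the memory. -/
structure State where
  reg : ℕ → ℕ
  mem : ℕ → ℕ

/-- Arithmetic expressions; `cell e` reads the memory cell whose address is the value of `e`. -/
inductive Term where
  | const (c : ℕ)
  | reg (r : ℕ)
  | cell (e : Term)
  | add (e f : Term)
  | sub (e f : Term)
  | mul (e f : Term)
  | div (e f : Term)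

/-- The value of an expression. Subtraction is truncated at `0`; division rounds down, and
division by `0` gives `0`. -/
def Term.eval (s : State) : Term → ℕ
  | .const c => c
  | .reg r => s.reg r
  | .cell e => s.mem (e.eval s)
  | .add e f => e.eval s + f.eval s
  | .sub e f => e.eval s - f.eval s
  | .mul e f => e.eval s * f.eval s
  | .div e f => e.eval s / f.eval s

/-- The charge for handling the number `x`: its number of binary digits, plus one. -/
def len (x : ℕ) : ℕ := Nat.size x + 1

/-- The logarithmic cost of evaluating an expression. -/
def Term.cost (s : State) : Term → ℕ
  | .const c => len c
  | .reg r => len (s.reg r)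
  | .cell e => e.cost s + len (e.eval s) + len (s.mem (e.eval s))
  | .add e f => e.cost s + f.cost s + len (e.eval s) + len (f.eval s)
  | .sub e f => e.cost s + f.cost s + len (e.eval s) + len (f.eval s)
  | .mul e f => e.cost s + f.cost s + len (e.eval s) + len (f.eval s)
  | .div e f => e.cost s + f.cost s + len (e.eval s) + len (f.eval s)

/-- Programs. `assign r e` puts the value of `e` into register `r`; `store a e` puts the value of
`e` into the memory cell whose address is the value of `a`. A test succeeds if its value is
not `0`. -/
inductive Program where
  | skip
  | assign (r : ℕ) (e : Term)
  | store (a e : Term)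
  | seq (p q : Program)
  | cond (e : Term) (p q : Program)
  | loop (e : Term) (p : Program)

/-- `Exec p s s' t`: the program `p`, started in state `s`, halts in state `s'` after time `t`. -/
inductive Exec : Program → State → State → ℕ → Prop where
  | skip (s : State) : Exec .skip s s 1
  | assign (r : ℕ) (e : Term) (s : State) :
      Exec (.assign r e) s { s with reg := Function.update s.reg r (e.eval s) }
        (e.cost s + len (e.eval s))
  | store (a e : Term) (s : State) :
      Exec (.store a e) s { s with mem := Function.update s.mem (a.eval s) (e.eval s) }
        (a.cost s + e.cost s + len (a.eval s) + len (e.eval s))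
  | seq {p q : Program} {s s' s'' : State} {t t' : ℕ} :
      Exec p s s' t → Exec q s' s'' t' → Exec (.seq p q) s s'' (t + t')
  | cond_true {e : Term} {p q : Program} {s s' : State} {t : ℕ} :
      e.eval s ≠ 0 → Exec p s s' t → Exec (.cond e p q) s s' (e.cost s + t)
  | cond_false {e : Term} {p q : Program} {s s' : State} {t : ℕ} :
      e.eval s = 0 → Exec q s s' t → Exec (.cond e p q) s s' (e.cost s + t)
  | loop_true {e : Term} {p : Program} {s s' s'' : State} {t t' : ℕ} :
      e.eval s ≠ 0 → Exec p s s' t → Exec (.loop e p) s' s'' t' →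
        Exec (.loop e p) s s'' (e.cost s + t + t')
  | loop_false {e : Term} {p : Program} {s : State} :
      e.eval s = 0 → Exec (.loop e p) s s (e.cost s)

/-- The initial state for an input graph on the vertices `0, …, n - 1`: register `0` holds `n`,
the memory holds the adjacency matrix of the graph row by row, and everything else is `0`. -/
def graphInput {n : ℕ} (G : SimpleGraph (Fin n)) [DecidableRel G.Adj] : State where
  reg r := if r = 0 then n else 0
  mem a := if ∃ i j : Fin n, a = (i : ℕ) * n + (j : ℕ) ∧ G.Adj i j then 1 else 0

end RAM

/-! ## Rooted tree decompositions built up from single-vertex steps -/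

/-! Tree decompositions are replaced by a calculus that introduces vertices into a root bag, forgets
them and joins two decompositions with the same root bag. The treewidth is at most `w` iff this
calculus, with bags of size at most `w + 1`, can forget all vertices and end with the empty bag
(`RootedDec.treewidth_le_iff`).

Let `C` be a vertex cover with `k` elements. The vertices outside of `C` are independent, so it
suffices to remember what happens on `C`: the set `L` of forgotten cover vertices and the set `A` of
cover vertices in the root bag. A vertex outside of `C` with a neighbor in `L` and another one
outside of `L ∪ A` must be in the root bag (`crossing`). If it has a neighbor in `L` and all
neighbors in `L ∪ A`, then it can be taken as forgotten (`enclosed`). If it has no neighbor in `L`,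
it can wait. One more condition is needed: a vertex whose neighbors are all together in a bag needs
a bag for itself and these neighbors, so its degree must be at most `w`. With this,
`CoverDec.of_rootedDec` and `CoverDec.rootedDec` translate between decompositions and their traces,
which gives `CoverDec.treewidth_le_iff`.

A join involves three disjoint subsets `L`, `L'`, `A` of `C`, that is, a word of length `k` over
four letters. Hence a single number below `4 ^ k`, together with a vertex, describes an instance of
any rule, and one pass over these pairs applies all rules. The rank `2 * L.card + A.card` grows with
every useful rule (`CoverDec.produced`), so `2 * n` passes complete the table. This is done for all
`w < n`, and the treewidth is the number of the `w` for which the table gives a negative answer.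

The cover itself comes from the usual branching: go through all pairs of vertices, and for each
uncovered edge let the next bit of a number tell which end to take. For `m = 0, 1, …` all `2 ^ m`
bit strings are tried, until a cover of size at most `m` appears; by `exists_pick` this happens for
some `m ≤ k`.

The algorithm is written in a small language whose statements are compiled to the machine. The
triples `RAM.Tri` count its elementary steps. All numbers stay below `2 ^ Y` with `Y = 4 * n`, so by
`RAM.Expr.exists_costs` a step costs only a polynomial in `n`. -/

/-- `RootedDec G w X K`: there is a rooted tree decomposition of width at most `w` of the part of
`G` induced by `X ∪ K`, with root bag `X`, such that no neighbor of `K` is outside of `X ∪ K`. -/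
inductive RootedDec {V : Type*} [DecidableEq V] (G : SimpleGraph V) (w : ℕ) :
    Finset V → Finset V → Prop
  | empty : RootedDec G w ∅ ∅
  | intro {X K : Finset V} {v : V} : RootedDec G w X K → v ∉ X → v ∉ K → X.card ≤ w →
      RootedDec G w (insert v X) K
  | forget {X K : Finset V} {v : V} : RootedDec G w (insert v X) K → v ∉ X →
      (∀ u, G.Adj v u → u ∈ X ∪ K) → RootedDec G w X (insert v K)
  | join {X K K' : Finset V} : RootedDec G w X K → RootedDec G w X K' → Disjoint K K' →
      RootedDec G w X (K ∪ K')

namespace RootedDec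

variable {V : Type*} [DecidableEq V] {G : SimpleGraph V} {w : ℕ} {X K : Finset V}

theorem card_le (h : RootedDec G w X K) : X.card ≤ w + 1 := by
  induction h with
  | empty => simp
  | intro h hX hK hc ih => rw [Finset.card_insert_of_notMem hX]; omega
  | forget h hX hN ih => rw [Finset.card_insert_of_notMem hX] at ih; omega
  | join h h' hd ih ih' => exact ih

theorem disjoint (h : RootedDec G w X K) : Disjoint X K := by
  induction h with
  | empty => simp
  | intro h hX hK hc ih => simp [ih, hK]
  | forget h hX hN ih => simp_all
  | join h h' hd ih ih' => simp [ih, ih']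

theorem adj_mem (h : RootedDec G w X K) {u v : V} (hv : v ∈ K) (ha : G.Adj v u) :
    u ∈ X ∪ K := by
  induction h with
  | empty => simp at hv
  | intro h hX hK hc ih => have := ih hv; grind
  | forget h hX hN ih => 
    rcases Finset.mem_insert.1 hv with rfl | hv
    · have := hN u ha; grind
    · have := ih hv; grind
  | join h h' hd ih ih' =>
    rcases Finset.mem_union.1 hv with hv | hv
    · have := ih hv; grind
    · have := ih' hv; grind

/-- When `x` is forgotten, each neighbor is in the bag or already forgotten. As no neighbor is ever
forgotten, all of them are in the bag, next to `x`. -/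
theorem card_neighbors_le (h : RootedDec G w X K) {x : V} (hx : x ∈ K) {N : Finset V}
    (hN : ∀ u, u ∈ N ↔ G.Adj x u) (hd : Disjoint N K) : N.card ≤ w := by
  induction h with
  | empty => simp at hx
  | intro h hX hK hc ih => exact ih hx hd
  | @forget X K v h hX hN' ih =>
    rcases Finset.mem_insert.1 hx with rfl | hx
    · have h1 : N ⊆ X := by
        intro u hu
        have h2 := hN' u ((hN u).1 hu)
        have h3 := Finset.disjoint_left.1 hd hu
        grind
      have := h.card_le
      rw [Finset.card_insert_of_notMem hX] at this
      exact (Finset.card_le_card h1).trans (by omega)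
    · exact ih hx (hd.mono_right (Finset.subset_insert _ _))
  | join h h' hd' ih ih' =>
    rcases Finset.mem_union.1 hx with hx | hx
    · exact ih hx (hd.mono_right Finset.subset_union_left)
    · exact ih' hx (hd.mono_right Finset.subset_union_right)

theorem forget_all (F : Finset V) (h : RootedDec G w (X ∪ F) K) (hF : Disjoint X F)
    (hN : ∀ v ∈ F, ∀ u, G.Adj v u → u ∈ X ∪ F ∪ K) : RootedDec G w X (K ∪ F) := by
  induction F using Finset.induction_on generalizing K with
  | empty => simpa using h
  | insert v F hv ih =>
    have h1 : RootedDec G w (X ∪ F) (insert v K) := by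
      refine .forget (by rwa [← Finset.union_insert]) (by simp_all) fun u ha => ?_
      have := hN v (by simp) u ha
      have := ha.ne
      grind
    have := ih h1 (by simp_all) fun x hx u ha => by
      have := hN x (by simp [hx]) u ha
      grind
    convert this using 1
    grind

theorem intro_all (F : Finset V) (h : RootedDec G w X K) (hF : Disjoint F K)
    (hc : (X ∪ F).card ≤ w + 1) : RootedDec G w (X ∪ F) K := by
  induction F using Finset.induction_on with
  | empty => simpa using h
  | insert v F hv ih =>
    have h1 := ih (by simp_all) ((Finset.card_le_card (by grind)).trans hc)
    by_cases hvX : v ∈ X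
    · rwa [Finset.union_insert, Finset.insert_eq_of_mem (by simp [hvX])]
    · rw [Finset.union_insert] at hc ⊢
      have hv' : v ∉ X ∪ F := by simp [hv, hvX]
      rw [Finset.card_insert_of_notMem hv'] at hc
      exact .intro h1 hv' (by simp_all) (by omega)

theorem of_card_le (hc : X.card ≤ w + 1) : RootedDec G w X ∅ := by
  simpa using intro_all X (empty (G := G) (w := w)) (by simp) (by simpa)

/-- Put a new root with bag `X'` on top of the root with bag `X`. -/
theorem change {X' : Finset V} (h : RootedDec G w X K) (hc : X'.card ≤ w + 1)
    (hd : Disjoint X' K) (hN : ∀ v ∈ X \ X', ∀ u, G.Adj v u → u ∈ X ∪ K) :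
    RootedDec G w X' (K ∪ (X \ X')) := by
  -- On the way from `X` to `X'`, all forgetting is done before all introducing, so that no
  -- intermediate bag is larger than both ends.
  have h1 : RootedDec G w (X ∩ X') (K ∪ (X \ X')) := by
    refine forget_all _ (by rwa [Finset.union_comm, Finset.sdiff_union_inter]) ?_ fun v hv u ha => ?_
    · rw [Finset.disjoint_left]; grind
    · have := hN v hv u ha; grind
  have h2 := intro_all X' h1 (by
      rw [Finset.disjoint_union_right]; exact ⟨hd, Finset.disjoint_sdiff⟩)
    (by rwa [Finset.union_eq_right.2 Finset.inter_subset_right])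
  rwa [Finset.union_eq_right.2 Finset.inter_subset_right] at h2

theorem join_all {ι : Type*} (S : Finset ι) (L : ι → Finset V) (h : RootedDec G w X K)
    (hL : ∀ i ∈ S, RootedDec G w X (L i)) (hd : ∀ i ∈ S, Disjoint K (L i))
    (hp : ∀ i ∈ S, ∀ j ∈ S, i ≠ j → Disjoint (L i) (L j)) :
    RootedDec G w X (K ∪ S.biUnion L) := by
  classical
  induction S using Finset.induction_on with
  | empty => simpa using h
  | insert i S hi ih =>
    have h1 := ih (fun j hj => hL j (by simp [hj])) (fun j hj => hd j (by simp [hj]))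
      (fun j hj l hl => hp j (by simp [hj]) l (by simp [hl]))
    have := h1.join (hL i (by simp)) (by
      rw [Finset.disjoint_union_left, Finset.disjoint_biUnion_left]
      exact ⟨hd i (by simp), fun j hj => hp j (by simp [hj]) i (by simp) (by grind)⟩)
    convert this using 1
    rw [Finset.biUnion_insert]; grind

end RootedDec

/-! ### From rooted decompositions to tree decompositions -/

/-- The tree `T` with a new leaf `none` attached at `i`. -/
def SimpleGraph.attachLeaf {ι : Type*} (T : SimpleGraph ι) (i : ι) : SimpleGraph (Option ι) :=
  T.map (Function.Embedding.some) ⊔ SimpleGraph.edge none (some i)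

namespace SimpleGraph

variable {ι : Type*} (T : SimpleGraph ι) (i : ι)

theorem attachLeaf_adj_some (a b : ι) : (T.attachLeaf i).Adj (some a) (some b) ↔ T.Adj a b := by
  have := SimpleGraph.map_adj_apply (G := T) (f := Function.Embedding.some) (a := a) (b := b)
  simpa [attachLeaf, SimpleGraph.edge_adj] using this

theorem attachLeaf_adj_none : (T.attachLeaf i).Adj none (some i) := by
  simp [attachLeaf, SimpleGraph.edge_adj]

variable {T} in
theorem connected_induce_image_some {S : Set ι} (h : (T.induce S).Connected) :
    ((T.attachLeaf i).induce (some '' S)).Connected := by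
  have hS := h.nonempty
  have : Nonempty (some '' S) := by
    obtain ⟨a⟩ := hS
    exact ⟨⟨some a, ⟨a, a.2, rfl⟩⟩⟩
  let f : T.induce S →g (T.attachLeaf i).induce (some '' S) :=
    ⟨fun a => ⟨some a, ⟨a, a.2, rfl⟩⟩, fun {a b} hab => by
      simpa [attachLeaf_adj_some] using hab⟩
  refine ⟨?_⟩
  rintro ⟨_, ⟨a, ha, rfl⟩⟩ ⟨_, ⟨b, hb, rfl⟩⟩
  exact (h.preconnected ⟨a, ha⟩ ⟨b, hb⟩).map f

variable {T i} in
theorem connected_induce_insert_none {S : Set ι} (h : (T.induce S).Connected) (hi : i ∈ S) :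
    ((T.attachLeaf i).induce (insert none (some '' S))).Connected := by
  rw [Set.insert_eq]
  refine connected_induce_union (v := none) (w := some i) ?_
    (connected_induce_image_some i h).preconnected (by simp) ⟨i, hi, rfl⟩
    (attachLeaf_adj_none T i)
  exact Preconnected.of_subsingleton

-- A connected graph is a tree iff it has one edge less than vertices. The new graph is connected,
-- and it has at most one edge more than `T`.
variable {T} in
theorem IsTree.attachLeaf [Finite ι] (h : T.IsTree) : (T.attachLeaf i).IsTree := by
  have hc : (T.attachLeaf i).Connected := by
    have h1 : (T.induce Set.univ).Connected := (induceUnivIso T).symm.connected_iff.1 h.connected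
    have h2 := connected_induce_insert_none (i := i) h1 (by simp)
    have : insert none (some '' (Set.univ : Set ι)) = Set.univ := by
      ext x; cases x <;> simp
    rw [this] at h2
    exact (induceUnivIso _).connected_iff.1 h2
  have hle := hc.card_vert_le_card_edgeSet_add_one
  have h1 := (isTree_iff_connected_and_card.1 h).2
  refine isTree_iff_connected_and_card.2 ⟨hc, le_antisymm ?_ hle⟩
  have h2 : (T.attachLeaf i).edgeSet ⊆
      (Function.Embedding.some.sym2Map '' T.edgeSet) ∪ {s(none, some i)} := by
    rw [SimpleGraph.attachLeaf, edgeSet_sup, edgeSet_map]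
    exact Set.union_subset_union_right _ edgeSet_edge_subset
  have h3 := Set.ncard_le_ncard h2 (Set.toFinite _)
  have h4 := Set.ncard_union_le (Function.Embedding.some.sym2Map '' T.edgeSet) {s(none, some i)}
  rw [Set.ncard_image_of_injective _ (Function.Embedding.injective _), Set.ncard_singleton] at h4
  rw [Finite.card_option, ← h1]
  simp only [Nat.card_coe_set_eq] at *
  omega

end SimpleGraph

/-- A tree decomposition of the subgraph of `G` induced by `W`, of width at most `w`. -/
structure PartialDecomposition {V : Type*} (G : SimpleGraph V) (w : ℕ) (W : Finset V)
    (ι : Type) where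
  tree : SimpleGraph ι
  isTree : tree.IsTree
  bag : ι → Finset V
  bag_subset : ∀ i, bag i ⊆ W
  card_le : ∀ i, (bag i).card ≤ w + 1
  edge : ∀ u ∈ W, ∀ v ∈ W, G.Adj u v → ∃ i, u ∈ bag i ∧ v ∈ bag i
  subtree : ∀ v ∈ W, (tree.induce {i | v ∈ bag i}).Connected

namespace PartialDecomposition

variable {V : Type*} [DecidableEq V] {G : SimpleGraph V} {w : ℕ} {W X : Finset V} {ι : Type}

/-- Attach a leaf with bag `insert v X` to the node `i`. -/
def attach [Finite ι] (D : PartialDecomposition G w W ι) (i : ι) (v : V) (hv : v ∉ W)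
    (hX : X ⊆ D.bag i) (hc : (insert v X).card ≤ w + 1)
    (hN : ∀ u ∈ W, G.Adj v u → u ∈ X) : PartialDecomposition G w (insert v W) (Option ι) where
  tree := D.tree.attachLeaf i
  isTree := D.isTree.attachLeaf i
  bag j := j.elim (insert v X) D.bag
  bag_subset j := by
    cases j with
    | none => exact Finset.insert_subset_insert _ (hX.trans (D.bag_subset i))
    | some j => exact (D.bag_subset j).trans (Finset.subset_insert _ _)
  card_le j := by
    cases j with
    | none => exact hc
    | some j => exact D.card_le j
  edge a ha b hb hab := by
    rcases Finset.mem_insert.1 ha with rfl | ha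
    · rcases Finset.mem_insert.1 hb with rfl | hb
      · exact (hab.ne rfl).elim
      · exact ⟨none, by simp, by simp [hN b hb hab]⟩
    · rcases Finset.mem_insert.1 hb with rfl | hb
      · exact ⟨none, by simp [hN a ‹a ∈ W› hab.symm], by simp⟩
      · obtain ⟨j, hj⟩ := D.edge a ha b hb hab
        exact ⟨some j, hj⟩
  subtree a ha := by
    have hvb : ∀ j, v ∉ D.bag j := fun j hj => hv (D.bag_subset j hj)
    rcases eq_or_ne a v with rfl | hne
    · have : {j : Option ι | a ∈ j.elim (insert a X) D.bag} = {none} := by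
        ext j; cases j <;> simp [hvb]
      rw [this]
      exact SimpleGraph.Connected.of_subsingleton
    · have haW := (Finset.mem_insert.1 ha).resolve_left hne
      by_cases haX : a ∈ X
      · have : {j : Option ι | a ∈ j.elim (insert v X) D.bag} =
            insert none (some '' {j | a ∈ D.bag j}) := by
          ext j; cases j <;> simp [haX]
        rw [this]
        exact SimpleGraph.connected_induce_insert_none (D.subtree a haW) (hX haX)
      · have : {j : Option ι | a ∈ j.elim (insert v X) D.bag} = some '' {j | a ∈ D.bag j} := by
          ext j; cases j <;> simp [haX, hne]
        rw [this]
        exact SimpleGraph.connected_induce_image_some i (D.subtree a haW)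

end PartialDecomposition

namespace RootedDec

variable {V : Type*} [DecidableEq V] {G : SimpleGraph V} {w : ℕ} {X K : Finset V}

/-- A partial tree decomposition with a bag that contains the root bag of a rooted decomposition
can be extended by the latter. -/
theorem extend (h : RootedDec G w X K) {W W' : Finset V} (hW' : W' = W ∪ K) (hW : Disjoint W K)
    {ι : Type} [Finite ι] (D : PartialDecomposition G w W ι) (i : ι) (hi : X ⊆ D.bag i) :
    ∃ (κ : Type) (_ : Finite κ) (D' : PartialDecomposition G w W' κ),
      ∀ i, ∃ j, D.bag i ⊆ D'.bag j := by
  induction h generalizing W W' ι with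
  | empty => 
    rw [Finset.union_empty] at hW'
    subst hW'
    exact ⟨ι, ‹_›, D, fun i => ⟨i, Finset.Subset.refl _⟩⟩
  -- The extension runs downwards from the root. Here the smaller bag is still contained in the bag
  -- of `i`, so no new node is needed.
  | intro h hX hK hc ih =>
    exact ih hW' hW D i ((Finset.subset_insert _ _).trans hi)
  -- Seen from the root, `v` appears here for the first time: a leaf with bag `insert v X` is
  -- attached, and its neighbors that are already present lie in `X`.
  | @forget X K v h hX hN ih =>
    have hv : v ∉ W := fun hv => Finset.disjoint_left.1 hW hv (by simp)
    have hWK : Disjoint W K := hW.mono_right (Finset.subset_insert _ _)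
    have hvK : v ∉ K := fun hk => Finset.disjoint_left.1 h.disjoint (by simp) hk
    obtain ⟨κ, hκ, D', hD'⟩ := ih (W := insert v W) (W' := W') (by rw [hW']; simp)
      (by simp [hvK, hWK]) (D.attach i v hv hi h.card_le fun u hu ha =>
      (Finset.mem_union.1 (hN u ha)).resolve_right fun hk => Finset.disjoint_left.1 hWK hu hk)
      none (Finset.Subset.refl _)
    exact ⟨κ, hκ, D', fun l => hD' (some l)⟩
  | @join X K K' h h' hd ih ih' =>
    rw [Finset.disjoint_union_right] at hW
    -- The first branch may change the nodes, but old bags remain contained in new ones, so that the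
    -- second branch still finds a node for `X`.
    obtain ⟨κ, _, D₁, h₁⟩ := ih rfl hW.1 D i hi
    obtain ⟨j, hj⟩ := h₁ i
    obtain ⟨κ', _, D₂, h₂⟩ := ih' (W' := W') (by rw [hW', Finset.union_assoc])
      (by rw [Finset.disjoint_union_left]; exact ⟨hW.2, hd⟩) D₁ j (hi.trans hj)
    refine ⟨κ', ‹_›, D₂, fun l => ?_⟩
    obtain ⟨a, ha⟩ := h₁ l
    obtain ⟨b, hb⟩ := h₂ a
    exact ⟨b, ha.trans hb⟩

theorem exists_treeDecomposition [Fintype V] (h : RootedDec G w ∅ Finset.univ) :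
    ∃ (ι : Type) (_ : Fintype ι) (D : TreeDecomposition G ι), D.width ≤ w := by
  let D₀ : PartialDecomposition G w ∅ Unit :=
    { tree := ⊥
      isTree := .of_subsingleton
      bag := fun _ => ∅
      bag_subset := by simp
      card_le := by simp
      edge := by simp
      subtree := by simp }
  obtain ⟨κ, hκ, D, -⟩ := h.extend (W' := Finset.univ) (by simp) (by simp) D₀ () (by simp)
  have := Fintype.ofFinite κ
  refine ⟨κ, this, ⟨D.tree, D.isTree, D.bag, fun v => ?_,
    fun u v ha => D.edge u (by simp) v (by simp) ha, fun v => D.subtree v (by simp)⟩, ?_⟩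
  · obtain ⟨⟨i, hi⟩⟩ := (D.subtree v (by simp)).nonempty
    exact ⟨i, hi⟩
  · rw [TreeDecomposition.width, Nat.sub_le_iff_le_add]
    exact Finset.sup_le fun i _ => D.card_le i

/-! ### From tree decompositions to rooted decompositions -/

/-- If every node `i` of a tree decomposition carries in addition a rooted decomposition with root
bag `bag i`, then these can be put together. -/
theorem of_tree [Fintype V] (m : ℕ) {ι : Type} [Fintype ι] (hm : Fintype.card ι = m)
    {T : SimpleGraph ι} (hT : T.IsTree) (bag K : ι → Finset V)
    (hD : ∀ i, RootedDec G w (bag i) (K i)) (hK : ∀ i j, i ≠ j → Disjoint (K i) (K j))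
    (hKb : ∀ i j, Disjoint (K i) (bag j)) (hcov : ∀ v, ∃ i, v ∈ bag i ∪ K i)
    (hadj : ∀ u v, G.Adj u v → (∃ i, u ∈ K i ∨ v ∈ K i) ∨ ∃ i, u ∈ bag i ∧ v ∈ bag i)
    (hpath : ∀ i j (p : T.Walk i j), p.IsPath → ∀ v, v ∈ bag i → v ∈ bag j →
      ∀ l ∈ p.support, v ∈ bag l) :
    RootedDec G w ∅ Finset.univ := by
  classical
  induction m generalizing ι with
  | zero =>
    have := hT.connected.nonempty
    exact (Fintype.card_ne_zero hm).elim
  | succ m ih =>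
  rcases subsingleton_or_nontrivial ι with hs | hs
  · obtain ⟨i⟩ := hT.connected.nonempty
    have h1 : ∀ v, v ∈ bag i ∪ K i := fun v => by
      obtain ⟨j, hj⟩ := hcov v
      rwa [Subsingleton.elim i j]
    have := (hD i).change (X' := ∅) (by simp) (by simp) (fun v _ u _ => h1 u)
    convert this using 1
    ext v
    have := h1 v
    simp at this ⊢
    tauto
  -- A leaf `l` is cut off. What hangs at `l`, together with the vertices of its bag that do not
  -- reach the neighbor `p`, is moved into the decomposition carried by `p`.
  · obtain ⟨l, hl⟩ := hT.exists_vert_degree_one_of_nontrivial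
    obtain ⟨p, hlp, hp⟩ := SimpleGraph.degree_eq_one_iff_existsUnique_adj.1 hl
    -- a vertex in the bag of `l` and in another bag is in the bag of `p`
    have hbag : ∀ j, j ≠ l → ∀ v, v ∈ bag l → v ∈ bag j → v ∈ bag p := by
      intro j hj v hvl hvj
      obtain ⟨q, hq⟩ := hT.connected.exists_isPath l j
      have hn : ¬ q.Nil := SimpleGraph.Walk.not_nil_of_ne hj.symm
      have h1 := hp _ (q.adj_snd hn)
      exact h1 ▸ hpath l j q hq v hvl hvj _ (q.getVert_mem_support 1)
    have hpl : p ≠ l := hlp.ne'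
    have hstep : RootedDec G w (bag p) (K l ∪ (bag l \ bag p)) := by
      -- A vertex of `bag l \ bag p` is in no bag but that of `l`, so all its neighbors are in `bag
      -- l` or in `K l`.
      refine (hD l).change (hD p).card_le (hKb l p).symm fun v hv u huv => ?_
      rw [Finset.mem_sdiff] at hv
      rcases hadj v u huv with ⟨i, hi | hi⟩ | ⟨i, hi⟩
      · exact (Finset.disjoint_left.1 (hKb i l) hi hv.1).elim
      · rcases eq_or_ne i l with rfl | hne
        · simp [hi]
        · have h1 := (hD i).adj_mem hi huv.symm
          rcases Finset.mem_union.1 h1 with h1 | h1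
          · exact (hv.2 (hbag i hne v hv.1 h1)).elim
          · exact (Finset.disjoint_left.1 (hKb i l) h1 hv.1).elim
      · rcases eq_or_ne i l with rfl | hne
        · simp [hi.2]
        · exact (hv.2 (hbag i hne v hv.1 hi.1)).elim
    let K' : {i // i ∈ ({l}ᶜ : Set ι)} → Finset V := fun i =>
      if i.1 = p then K p ∪ (K l ∪ (bag l \ bag p)) else K i
    have hdl : ∀ i, i ≠ l → Disjoint (K i) (K l ∪ (bag l \ bag p)) := fun i hi => by
      rw [Finset.disjoint_union_right]
      exact ⟨hK _ _ hi, (hKb i l).mono_right Finset.sdiff_subset⟩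
    have hKl : ∀ j, j ≠ l → Disjoint (K l ∪ (bag l \ bag p)) (bag j) := fun j hj => by
      rw [Finset.disjoint_union_left]
      refine ⟨hKb _ _, Finset.disjoint_left.2 fun v hv hvj => ?_⟩
      rw [Finset.mem_sdiff] at hv
      exact hv.2 (hbag j hj v hv.1 hvj)
    have hKK' : ∀ i (hi : i ∈ ({l}ᶜ : Set ι)), K i ⊆ K' ⟨i, hi⟩ := by
      intro i hi
      simp only [K']
      split_ifs with h
      · subst h; exact Finset.subset_union_left
      · exact Finset.Subset.refl _
    have hpK' : K l ∪ (bag l \ bag p) ⊆ K' ⟨p, hpl⟩ := by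
      simp only [K', if_true]; exact Finset.subset_union_right
    have htree : (T.induce {l}ᶜ).IsTree :=
      ⟨hT.connected.induce_compl_singleton_of_degree_eq_one hl, hT.isAcyclic.induce _⟩
    refine ih (ι := {i // i ∈ ({l}ᶜ : Set ι)}) ?_ htree (fun i => bag i) K' ?_ ?_ ?_ ?_ ?_ ?_
    · have := Fintype.card_subtype_compl (fun i => i = l)
      simp only [Fintype.card_subtype_eq, hm] at this
      simpa using this
    · rintro ⟨i, hi⟩
      simp only [K']
      split_ifs with h
      · subst h
        exact (hD i).join hstep (hdl i hpl)
      · exact hD i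
    · rintro ⟨i, hi⟩ ⟨j, hj⟩ hij
      have hij' : i ≠ j := fun h => hij (Subtype.ext h)
      simp only [K']
      split_ifs with h h' h'
      · exact (hij' (h.trans h'.symm)).elim
      · subst h
        rw [Finset.disjoint_union_left]
        exact ⟨hK _ _ hij', (hdl j hj).symm⟩
      · subst h'
        rw [Finset.disjoint_union_right]
        exact ⟨hK _ _ hij', hdl i hi⟩
      · exact hK _ _ hij'
    · rintro ⟨i, hi⟩ ⟨j, hj⟩
      simp only [K']
      split_ifs with h
      · rw [Finset.disjoint_union_left]
        exact ⟨hKb _ _, hKl j hj⟩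
      · exact hKb _ _
    · intro v
      obtain ⟨i, hi⟩ := hcov v
      rcases eq_or_ne i l with rfl | hne
      · refine ⟨⟨p, hpl⟩, ?_⟩
        by_cases hvp : v ∈ bag p
        · exact Finset.mem_union_left _ hvp
        · refine Finset.mem_union_right _ (hpK' ?_)
          rw [Finset.mem_union] at hi ⊢
          rw [Finset.mem_sdiff]
          tauto
      · exact ⟨⟨i, hne⟩, Finset.union_subset_union_right (hKK' i hne) hi⟩
    · intro u v huv
      have hlift : ∀ x i, x ∈ K i → ∃ j : {i // i ∈ ({l}ᶜ : Set ι)}, x ∈ K' j := by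
        intro x i hx
        rcases eq_or_ne i l with rfl | hne
        · exact ⟨⟨p, hpl⟩, hpK' (Finset.mem_union_left _ hx)⟩
        · exact ⟨⟨i, hne⟩, hKK' i hne hx⟩
      rcases hadj u v huv with ⟨i, hi | hi⟩ | ⟨i, hi⟩
      · obtain ⟨j, hj⟩ := hlift u i hi
        exact .inl ⟨j, .inl hj⟩
      · obtain ⟨j, hj⟩ := hlift v i hi
        exact .inl ⟨j, .inr hj⟩
      · rcases eq_or_ne i l with rfl | hne
        · by_cases hup : u ∈ bag p
          · by_cases hvp : v ∈ bag p
            · exact .inr ⟨⟨p, hpl⟩, hup, hvp⟩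
            · exact .inl ⟨⟨p, hpl⟩, .inr (hpK' (by simp [hi.2, hvp]))⟩
          · exact .inl ⟨⟨p, hpl⟩, .inl (hpK' (by simp [hi.1, hup]))⟩
        · exact .inr ⟨⟨i, hne⟩, hi⟩
    · intro i j q hq v hvi hvj k hk
      let f : T.induce ({l}ᶜ : Set ι) ↪g T := SimpleGraph.Embedding.induce _
      have hk' : f.toHom k ∈ (q.map f.toHom).support := by
        rw [SimpleGraph.Walk.support_map]
        exact List.mem_map_of_mem hk
      exact hpath (f.toHom i) (f.toHom j) (q.map f.toHom) (hq.map f.injective) v hvi hvj _ hk'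

/-- `of_tree` with nothing hanging at the nodes. Its path condition holds because a path inside the
connected subtree of a vertex is the only path of the tree between its ends. -/
theorem of_treeDecomposition [Fintype V] {ι : Type} [Fintype ι] (D : TreeDecomposition G ι)
    (hD : D.width ≤ w) : RootedDec G w ∅ Finset.univ := by
  refine of_tree _ rfl D.isTree D.bag (fun _ => ∅) (fun i => of_card_le ?_) (by simp) (by simp)
    (by simpa using D.cover) (fun u v h => .inr (D.edge u v h)) ?_
  · have := Finset.le_sup (f := fun i => (D.bag i).card) (Finset.mem_univ i)
    rw [TreeDecomposition.width] at hD
    omega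
  · intro i j p hp v hi hj l hl
    obtain ⟨q, hq⟩ := (D.subtree v).exists_isPath ⟨i, hi⟩ ⟨j, hj⟩
    let f : D.tree.induce {i | v ∈ D.bag i} ↪g D.tree := SimpleGraph.Embedding.induce _
    have h1 := SimpleGraph.Walk.IsPath.map (f := f.toHom) f.injective hq
    have h2 : p = q.map f.toHom := (D.isTree.existsUnique_path i j).unique hp h1
    rw [h2] at hl
    have hs := SimpleGraph.Walk.support_map f.toHom q
    have hl' : l ∈ q.support.map f.toHom := hs ▸ hl
    obtain ⟨x, -, rfl⟩ := List.mem_map.1 hl'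
    exact x.2

theorem univ_of_card_le [Fintype V] (h : Fintype.card V ≤ w + 1) :
    RootedDec G w ∅ Finset.univ := by
  have := (of_card_le (G := G) (X := Finset.univ) h).change (X' := ∅) (by simp) (by simp) (by simp)
  simpa using this

theorem treewidth_le_iff [Fintype V] : treewidth G ≤ w ↔ RootedDec G w ∅ Finset.univ := by
  constructor
  · intro h
    -- The infimum of an empty set would be `0`, so some tree decomposition must be exhibited before
    -- the minimum is known to be attained.
    have hne : {w : ℕ | ∃ (ι : Type) (_ : Fintype ι) (D : TreeDecomposition G ι),
        D.width = w}.Nonempty := by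
      obtain ⟨ι, hι, D, -⟩ := (univ_of_card_le (G := G)
        (Nat.le_succ (Fintype.card V))).exists_treeDecomposition
      exact ⟨_, ι, hι, D, rfl⟩
    obtain ⟨ι, hι, D, hD⟩ := Nat.sInf_mem hne
    exact of_treeDecomposition D (hD.trans_le h)
  · intro h
    obtain ⟨ι, hι, D, hD⟩ := h.exists_treeDecomposition
    exact le_trans (Nat.sInf_le ⟨ι, hι, D, rfl⟩) hD

end RootedDec


/-! ## Dynamic programming over a vertex cover -/

section CoverDec

open Classical

variable {V : Type*} [Fintype V] [DecidableEq V]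

/-- The vertices outside of `C` with a neighbor in `L` and a neighbor outside of `L ∪ A`. -/
noncomputable def crossing (G : SimpleGraph V) (C L A : Finset V) : Finset V :=
  {x | x ∉ C ∧ (∃ y ∈ L, G.Adj x y) ∧ ∃ y, G.Adj x y ∧ y ∉ L ∪ A}

/-- The set `L`, with the vertices outside of `C` that have a neighbor in `L` and all of their
neighbors in `L ∪ A`. -/
noncomputable def enclosed (G : SimpleGraph V) (C L A : Finset V) : Finset V :=
  L ∪ ({x | x ∉ C ∧ (∃ y ∈ L, G.Adj x y) ∧ ∀ y, G.Adj x y → y ∈ L ∪ A} : Finset V)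

/-- The traces on the vertex cover `C` of the rooted decompositions of width at most `w`: the set
`A` is the trace of the root bag, and `L` consists of the vertices of `C` already forgotten. -/
inductive CoverDec (G : SimpleGraph V) (w : ℕ) (C : Finset V) : Finset V → Finset V → Prop
  | empty : CoverDec G w C ∅ ∅
  | intro {L A : Finset V} {v : V} : CoverDec G w C L A → v ∈ C → v ∉ L → v ∉ A →
      -- The crossing set is that before the introduction: a vertex whose last open neighbor is `v`
      -- must meet `v` in this bag before it can leave.
      A.card + (crossing G C L A).card ≤ w → CoverDec G w C L (insert v A)
  | forget {L A : Finset V} {v : V} : CoverDec G w C L (insert v A) → v ∈ C → v ∉ L → v ∉ A →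
      -- The vertices that become crossing by the removal of `v` must already be in the bag together
      -- with `v`.
      A.card + (crossing G C (insert v L) A).card ≤ w →
      (∀ u ∈ C, G.Adj v u → u ∈ insert v L ∪ A) →
      -- Such an `x` is finished here without ever having been crossing, so its size requirement is
      -- seen by no other condition: `x` and its neighbors have to fit into a bag.
      (∀ x ∉ C, G.Adj x v → (∀ y, G.Adj x y → y ∈ insert v A) → G.degree x ≤ w) →
      CoverDec G w C (insert v L) A
  | join {L L' A : Finset V} : CoverDec G w C L A → CoverDec G w C L' A → Disjoint L L' →
      A.card + (crossing G C L A ∪ crossing G C L' A).card ≤ w + 1 →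
      CoverDec G w C (L ∪ L') A

namespace CoverDec

variable {G : SimpleGraph V} {w : ℕ} {C L A : Finset V}

theorem mem_crossing {x : V} : x ∈ crossing G C L A ↔
    x ∉ C ∧ (∃ y ∈ L, G.Adj x y) ∧ ∃ y, G.Adj x y ∧ y ∉ L ∪ A := by simp [crossing]

theorem mem_enclosed {x : V} : x ∈ enclosed G C L A ↔
    x ∈ L ∨ x ∉ C ∧ (∃ y ∈ L, G.Adj x y) ∧ ∀ y, G.Adj x y → y ∈ L ∪ A := by
  simp [enclosed]

theorem subset (h : CoverDec G w C L A) : L ⊆ C ∧ A ⊆ C ∧ Disjoint L A := by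
  induction h with
  | empty => simp
  | intro h hC hL hA hc ih => exact ⟨ih.1, Finset.insert_subset hC ih.2.1, by simp [hL, ih.2.2]⟩
  | forget h hC hL hA hc hN hI ih =>
    refine ⟨Finset.insert_subset hC ih.1, (Finset.subset_insert _ _).trans ih.2.1, ?_⟩
    have := ih.2.2
    simp_all
  | join h h' hd hc ih ih' =>
    exact ⟨Finset.union_subset ih.1 ih'.1, ih.2.1, by simp [ih.2.2, ih'.2.2]⟩

/-- The trace of a rooted decomposition. -/
theorem of_rootedDec (hC : ∀ u v, G.Adj u v → u ∈ C ∨ v ∈ C) {X K : Finset V}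
    (h : RootedDec G w X K) : CoverDec G w C (K ∩ C) (X ∩ C) := by
  -- A crossing vertex has a forgotten neighbor, hence is in the bag or forgotten. If it were
  -- forgotten, then its neighbor outside of `L ∪ A` would have to be in the bag or forgotten too.
  have hcross : ∀ {X K : Finset V}, RootedDec G w X K →
      X ∩ C ∪ crossing G C (K ∩ C) (X ∩ C) ⊆ X := by
    intro X K h x hx
    rcases Finset.mem_union.1 hx with hx | hx
    · exact (Finset.mem_inter.1 hx).1
    · obtain ⟨hxC, ⟨y, hy, hxy⟩, z, hxz, hz⟩ := mem_crossing.1 hx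
      have h1 := h.adj_mem (Finset.mem_inter.1 hy).1 hxy.symm
      refine (Finset.mem_union.1 h1).resolve_right fun hk => hz ?_
      have h2 := h.adj_mem hk hxz
      have h3 := (hC x z hxz).resolve_left hxC
      grind
  have hdisj : ∀ L A : Finset V, A ⊆ C → Disjoint A (crossing G C L A) := by
    intro L A hA
    exact Finset.disjoint_left.2 fun x hx hx' => (mem_crossing.1 hx').1 (hA hx)
  induction h with
  | empty => simpa using CoverDec.empty
  | @intro X K v h hX hK hc ih =>
    by_cases hv : v ∈ C
    · rw [Finset.insert_inter_of_mem hv]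
      refine .intro ih hv (by simp [hK]) (by simp [hX]) ?_
      rw [← Finset.card_union_of_disjoint (hdisj _ _ Finset.inter_subset_right)]
      exact (Finset.card_le_card (hcross h)).trans hc
    · rwa [Finset.insert_inter_of_notMem hv]
  | @forget X K v h hX hN ih =>
    have hvK : v ∉ K := fun hk => Finset.disjoint_left.1 h.disjoint (by simp) hk
    by_cases hv : v ∈ C
    · rw [Finset.insert_inter_of_mem hv] at ih ⊢
      have h' := RootedDec.forget h hX hN
      have hc := h.card_le
      rw [Finset.card_insert_of_notMem hX] at hc
      refine .forget ih hv (by simp [hvK]) (by simp [hX]) ?_ ?_ ?_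
      · rw [← Finset.card_union_of_disjoint (hdisj _ _ Finset.inter_subset_right),
          ← Finset.insert_inter_of_mem hv]
        exact (Finset.card_le_card (hcross h')).trans (by omega)
      · intro u hu ha
        have := hN u ha
        grind
      · intro x hx ha hxA
        have hsub : G.neighborFinset x ⊆ insert v X := by
          intro y hy
          have := hxA y (by simpa using hy)
          grind
        -- Either `x` is in the bag together with `v` and all its neighbors, or `x` was forgotten
        -- earlier while all its neighbors were in the bag.
        rcases Finset.mem_union.1 (hN x ha.symm) with hxX | hxK
        · have h1 : insert x (G.neighborFinset x) ⊆ insert v X :=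
            Finset.insert_subset (by simp [hxX]) hsub
          have h2 := (Finset.card_le_card h1).trans h.card_le
          rw [Finset.card_insert_of_notMem (by simp), G.card_neighborFinset_eq_degree] at h2
          omega
        · rw [← G.card_neighborFinset_eq_degree]
          exact h.card_neighbors_le hxK (by simp) (h.disjoint.mono_left hsub)
    · rwa [Finset.insert_inter_of_notMem hv] at ih ⊢
  | @join X K K' h h' hd ih ih' =>
    rw [Finset.union_inter_distrib_right]
    refine .join ih ih' (hd.mono Finset.inter_subset_left Finset.inter_subset_left) ?_
    rw [← Finset.card_union_of_disjoint (by
      rw [Finset.disjoint_union_right]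
      exact ⟨hdisj _ _ Finset.inter_subset_right, hdisj _ _ Finset.inter_subset_right⟩)]
    refine (Finset.card_le_card ?_).trans h.card_le
    have := hcross h
    have := hcross h'
    grind

theorem disjoint_enclosed {Y : Finset V} (hA : A ⊆ C) (hd : Disjoint L A) (hL : L ⊆ C)
    (hY : ∀ x ∈ Y, x ∉ C ∧ ((∀ y ∈ L, ¬ G.Adj x y) ∨ ∃ y, G.Adj x y ∧ y ∉ L ∪ A)) :
    Disjoint (A ∪ Y) (enclosed G C L A) := by
  rw [Finset.disjoint_left]
  intro x hx hx'
  rw [mem_enclosed] at hx'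
  rcases Finset.mem_union.1 hx with hx | hx
  · rcases hx' with hx' | hx'
    · exact Finset.disjoint_left.1 hd hx' hx
    · exact hx'.1 (hA hx)
  · obtain ⟨h1, h2⟩ := hY x hx
    rcases hx' with hx' | ⟨-, ⟨y, hy, hxy⟩, h3⟩
    · exact h1 (hL hx')
    · rcases h2 with h2 | ⟨z, hz, hz'⟩
      · exact h2 y hy hxy
      · exact hz' (h3 z hz)

/-- A rooted decomposition with a given trace. -/
theorem rootedDec (h : CoverDec G w C L A) :
    RootedDec G w (A ∪ crossing G C L A) (enclosed G C L A) := by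
  have hdisj : ∀ (L A : Finset V) {Y}, A ⊆ C → (∀ x ∈ Y, x ∉ C) → Disjoint A Y := by
    intro L A Y hA hY
    exact Finset.disjoint_left.2 fun x hx hx' => hY x hx' (hA hx)
  induction h with
  | empty =>
    have h1 : crossing G C ∅ ∅ = ∅ := by ext; simp [mem_crossing]
    have h2 : enclosed G C ∅ ∅ = ∅ := by ext; simp [mem_enclosed]
    simpa [h1, h2] using RootedDec.empty
  | @intro L A v h hv hvL hvA hc ih =>
    obtain ⟨hLC, hAC, hLA⟩ := h.subset
    have hvE : v ∉ enclosed G C L A := by simp [mem_enclosed, hv, hvL]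
    have hvX : v ∉ A ∪ crossing G C L A := by simp [mem_crossing, hv, hvA]
    have h1 := ih.intro hvX hvE ((Finset.card_union_le _ _).trans hc)
    have hsub : insert v A ∪ crossing G C L (insert v A) ⊆
        insert v (A ∪ crossing G C L A) := by
      intro x
      simp only [Finset.mem_union, Finset.mem_insert, mem_crossing]
      grind
    -- After `v` has come in, the vertices whose only open neighbor was `v` are no longer crossing
    -- and get forgotten.
    have h2 := h1.change (X' := insert v A ∪ crossing G C L (insert v A))
      ((Finset.card_le_card hsub).trans h1.card_le) (h1.disjoint.mono_left hsub) ?_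
    · convert h2 using 1
      ext x
      have := @hLC x
      have := @hAC x
      simp only [mem_enclosed, Finset.mem_union, Finset.mem_sdiff, Finset.mem_insert,
        mem_crossing]
      grind
    · intro x hx y hxy
      simp only [Finset.mem_union, Finset.mem_sdiff, Finset.mem_insert, mem_crossing,
        mem_enclosed] at hx ⊢
      grind
  | @forget L A v h hv hvL hvA hc hN hI ih =>
    obtain ⟨hLC, hAC, hLA⟩ := h.subset
    have hAC' := (Finset.subset_insert _ _).trans hAC
    set Y := crossing G C (insert v L) A with hYdef
    have hYmem : ∀ x, x ∈ Y ↔ _ := fun x => mem_crossing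
    have hcard : (insert v A ∪ Y).card ≤ w + 1 := by
      refine (Finset.card_union_le _ _).trans ?_
      rw [Finset.card_insert_of_notMem hvA]
      omega
    have hYd : Disjoint (insert v A ∪ Y) (enclosed G C L (insert v A)) := by
      refine disjoint_enclosed hAC hLA hLC fun x hx => ?_
      obtain ⟨h1, h2, z, h3, h4⟩ := (hYmem x).1 hx
      exact ⟨h1, .inr ⟨z, h3, by grind⟩⟩
    have hsub : insert v A ∪ crossing G C L (insert v A) ∪ Y = insert v A ∪ Y := by
      ext x
      simp only [Finset.mem_union, Finset.mem_insert, mem_crossing, hYmem]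
      grind
    -- The vertices that will be crossing after the removal of `v` are brought into the bag first.
    have h1 := ih.intro_all Y (by rw [Finset.disjoint_union_left] at hYd; exact hYd.2)
      (by rwa [hsub])
    rw [hsub] at h1
    -- the vertices all of whose neighbors are in the bag
    let S : Finset V := {x | x ∉ C ∧ G.Adj x v ∧ ∀ y, G.Adj x y → y ∈ insert v A}
    have hSmem : ∀ x, x ∈ S ↔ x ∉ C ∧ G.Adj x v ∧ ∀ y, G.Adj x y → y ∈ insert v A := by
      simp [S]
    have hS : ∀ x ∈ S, RootedDec G w (insert v A ∪ Y) {x} := by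
      intro x hx
      have hx' := (hSmem x).1 hx
      have hxX : x ∉ insert v A ∪ Y := by
        have := @hAC x
        simp only [Finset.mem_union, Finset.mem_insert, hYmem] at this ⊢
        grind
      -- A separate branch whose bag consists of `x` and its neighbors; this is where the degree
      -- condition is used.
      have h2 : RootedDec G w (insert x (G.neighborFinset x)) ∅ := by
        refine RootedDec.of_card_le ?_
        rw [Finset.card_insert_of_notMem (by simp), G.card_neighborFinset_eq_degree]
        have := hI x hx'.1 hx'.2.1 hx'.2.2
        omega
      have h3 : insert x (G.neighborFinset x) \ (insert v A ∪ Y) = {x} := by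
        ext y
        have := hx'.2.2 y
        simp only [Finset.mem_sdiff, Finset.mem_insert, Finset.mem_singleton, Finset.mem_union,
          SimpleGraph.mem_neighborFinset] at this hxX ⊢
        grind
      have h4 := h2.change hcard (by simp) (X' := insert v A ∪ Y) (by
        intro y hy u hu
        rw [h3, Finset.mem_singleton] at hy
        subst hy
        simp [hu])
      rwa [h3, Finset.empty_union] at h4
    have h5 := RootedDec.join_all S (fun x => {x}) h1 hS (by
        intro x hx
        have hx' := (hSmem x).1 hx
        have := @hLC x
        rw [Finset.disjoint_singleton_right, mem_enclosed]
        rintro (h | ⟨-, ⟨y, hy, hxy⟩, -⟩)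
        · exact hx'.1 (hLC h)
        · exact Finset.disjoint_left.1 hLA hy (hx'.2.2 y hxy)) (by simp)
    rw [Finset.biUnion_singleton_eq_self, Finset.insert_union] at h5
    have h6 := h5.forget (by simp [hvA, hYmem, hv]) (fun u hu => by
      simp only [Finset.mem_union, hYmem, hSmem, mem_enclosed]
      by_cases huC : u ∈ C
      · have h7 := hN u huC hu
        have h8 := hu.ne'
        simp only [Finset.mem_union, Finset.mem_insert] at h7
        tauto
      · have := hu.symm
        grind)
    convert h6 using 1
    ext x
    have := @hLC x
    simp only [mem_enclosed, Finset.mem_union, Finset.mem_insert, hSmem]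
    constructor
    · rintro ((rfl | hx) | ⟨hxC, ⟨y, hy, hxy⟩, hall⟩)
      · exact .inl rfl
      · exact .inr (.inl (.inl hx))
      · by_cases hz : ∃ z ∈ L, G.Adj x z
        · exact .inr (.inl (.inr ⟨hxC, hz, fun z hxz => by have := hall z hxz; tauto⟩))
        · push Not at hz
          have hyv : y = v := hy.resolve_right fun h => hz y h hxy
          subst hyv
          refine .inr (.inr ⟨hxC, hxy, fun z hxz => ?_⟩)
          have := hall z hxz
          have := hz z
          tauto
    · rintro (rfl | (hx | ⟨hxC, ⟨y, hy, hxy⟩, hall⟩) | ⟨hxC, hxv, hall⟩)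
      · exact .inl (.inl rfl)
      · exact .inl (.inr hx)
      · exact .inr ⟨hxC, ⟨y, .inr hy, hxy⟩, fun z hxz => by have := hall z hxz; tauto⟩
      · exact .inr ⟨hxC, ⟨v, .inl rfl, hxv⟩, fun z hxz => by have := hall z hxz; tauto⟩
  | @join L L' A h h' hd hc ih ih' =>
    obtain ⟨hLC, hAC, hLA⟩ := h.subset
    obtain ⟨hLC', -, hLA'⟩ := h'.subset
    set Y := crossing G C L A with hYdef
    set Y' := crossing G C L' A with hYdef'
    have hYmem : ∀ x, x ∈ Y ↔ _ := fun x => mem_crossing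
    have hYmem' : ∀ x, x ∈ Y' ↔ _ := fun x => mem_crossing
    have hcard : (A ∪ (Y ∪ Y')).card ≤ w + 1 := (Finset.card_union_le _ _).trans hc
    have hY : Disjoint (A ∪ Y') (enclosed G C L A) := by
      refine disjoint_enclosed hAC hLA hLC fun x hx => ?_
      obtain ⟨h1, ⟨y, hy, hxy⟩, -⟩ := (hYmem' x).1 hx
      have := Finset.disjoint_left.1 hd
      have := Finset.disjoint_left.1 hLA'
      exact ⟨h1, .inr ⟨y, hxy, by grind⟩⟩
    have hY' : Disjoint (A ∪ Y) (enclosed G C L' A) := by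
      refine disjoint_enclosed hAC hLA' hLC' fun x hx => ?_
      obtain ⟨h1, ⟨y, hy, hxy⟩, -⟩ := (hYmem x).1 hx
      have := Finset.disjoint_left.1 hd
      have := Finset.disjoint_left.1 hLA
      exact ⟨h1, .inr ⟨y, hxy, by grind⟩⟩
    rw [Finset.disjoint_union_left] at hY hY'
    -- Both root bags are enlarged to `A ∪ Y ∪ Y'` so that they can be joined. Afterwards the
    -- vertices that are no longer crossing are forgotten.
    have h1 := ih.intro_all Y' hY.2 (by rwa [Finset.union_assoc])
    have h2 := ih'.intro_all Y hY'.2 (by rwa [Finset.union_assoc, Finset.union_comm Y' Y])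
    rw [Finset.union_assoc] at h1
    rw [Finset.union_assoc, Finset.union_comm Y' Y] at h2
    have h3 := h1.join h2 (by
      rw [Finset.disjoint_left]
      intro x hx hx'
      have hd1 := Finset.disjoint_left.1 hd
      have hd2 := Finset.disjoint_left.1 hLA
      have := @hLC x
      have := @hLC' x
      rw [mem_enclosed] at hx hx'
      grind)
    have hsub : A ∪ crossing G C (L ∪ L') A ⊆ A ∪ (Y ∪ Y') := by
      intro x
      simp only [Finset.mem_union, mem_crossing, hYmem, hYmem']
      grind
    have h4 := h3.change ((Finset.card_le_card hsub).trans hcard)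
      (h3.disjoint.mono_left hsub) (by
      intro x hx y hxy
      simp only [Finset.mem_union, Finset.mem_sdiff, mem_crossing, hYmem, hYmem',
        mem_enclosed] at hx ⊢
      grind)
    convert h4 using 1
    ext x
    have := @hAC x
    simp only [mem_enclosed, Finset.mem_union, Finset.mem_sdiff, mem_crossing, hYmem, hYmem']
    grind

/-- The treewidth is at most `w` iff there is a complete trace. -/
theorem treewidth_le_iff (hC : ∀ u v, G.Adj u v → u ∈ C ∨ v ∈ C) :
    treewidth G ≤ w ↔ CoverDec G w C C ∅ := by
  rw [RootedDec.treewidth_le_iff]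
  constructor
  · intro h
    simpa using of_rootedDec hC h
  · intro h
    have h1 := h.rootedDec
    have h2 : crossing G C C ∅ = ∅ := by
      ext x
      simp only [mem_crossing, Finset.notMem_empty, iff_false]
      rintro ⟨h1, -, y, h2, h3⟩
      have := hC x y h2
      simp_all
    rw [h2, Finset.empty_union] at h1
    -- The vertices left over are isolated, and each gets a branch of its own.
    have h3 := RootedDec.join_all (({x | x ∉ enclosed G C C ∅} : Finset V)) (fun x => {x}) h1
      (fun x hx => by
        have h3 : RootedDec G w {x} ∅ := RootedDec.of_card_le (by simp)
        have h4 := h3.change (X' := ∅) (by simp) (by simp) (fun y hy u hu => by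
          simp only [Finset.sdiff_empty, Finset.mem_singleton] at hy
          subst hy
          simp only [Finset.mem_filter, Finset.mem_univ, true_and, mem_enclosed, not_or] at hx
          exfalso
          have h5 : ∀ z, G.Adj y z → z ∈ C := fun z hz => (hC y z hz).resolve_left hx.1
          exact hx.2 ⟨hx.1, ⟨u, h5 u hu, hu⟩, by simpa using h5⟩)
        simpa using h4) (by simp) (by simp)
    rw [Finset.biUnion_singleton_eq_self] at h3
    convert h3 using 1
    ext x
    simp only [Finset.mem_univ, Finset.mem_union, Finset.mem_filter, true_and, true_iff]
    exact Classical.em _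

end CoverDec

end CoverDec


/-! ## A small programming language on top of the machine -/

namespace RAM

/-- The four operations of the machine. -/
inductive BinOp where
  | add | sub | mul | div

/-- The operation on numbers. -/
def BinOp.apply : BinOp → ℕ → ℕ → ℕ
  | .add, x, y => x + y
  | .sub, x, y => x - y
  | .mul, x, y => x * y
  | .div, x, y => x / y

/-- The operation on terms. -/
def BinOp.toTerm : BinOp → Term → Term → Term
  | .add => .add
  | .sub => .sub
  | .mul => .mul
  | .div => .div

/-- Registers with a smaller number are variables, the other ones hold intermediate results. -/
abbrev numVars : ℕ := 32

/-- Put `x` into register `r`. -/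
def State.set (s : State) (r x : ℕ) : State := { s with reg := Function.update s.reg r x }

@[simp] theorem State.set_mem (s : State) (r x : ℕ) : (s.set r x).mem = s.mem := rfl

theorem State.set_reg (s : State) (r x r' : ℕ) :
    (s.set r x).reg r' = if r' = r then x else s.reg r' := by
  simp [State.set, Function.update_apply]

/-- Put `x` into the memory cell `a`. -/
def State.put (s : State) (a x : ℕ) : State := { s with mem := Function.update s.mem a x }

@[simp] theorem State.put_reg (s : State) (a x : ℕ) : (s.put a x).reg = s.reg := rfl

theorem State.put_mem (s : State) (a x a' : ℕ) :
    (s.put a x).mem a' = if a' = a then x else s.mem a' := by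
  simp [State.put, Function.update_apply]

/-- Expressions with sums: `sum r e` is the sum of the values of `e` where register `r`
runs through the numbers below the content of register `0`. -/
inductive Expr where
  | const (c : ℕ)
  | var (r : ℕ)
  | cell (e : Expr)
  | bin (o : BinOp) (e f : Expr)
  | sum (r : ℕ) (e : Expr)

namespace Expr

/-- The value of an expression. -/
def eval : Expr → State → ℕ
  | const c, _ => c
  | var r, s => s.reg r
  | cell e, s => s.mem (e.eval s)
  | bin o e f, s => o.apply (e.eval s) (f.eval s)
  | sum r e, s => ∑ i ∈ Finset.range (s.reg 0), e.eval (s.set r i)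

/-- All registers that occur are variables, and sums do not bind register `0`. -/
def WF : Expr → Prop
  | const _ => True
  | var r => r < numVars
  | cell e => e.WF
  | bin _ e f => e.WF ∧ f.WF
  | sum r e => 0 < r ∧ r < numVars ∧ e.WF

/-- A program that puts the value of the expression into register `d`, using registers from `d`
on for intermediate results. -/
def compile : Expr → ℕ → Program
  | const c, d => .assign d (.const c)
  | var r, d => .assign d (.reg r)
  | cell e, d => .seq (e.compile d) (.assign d (.cell (.reg d)))
  | bin o e f, d => .seq (e.compile d) (.seq (f.compile (d + 1))
      (.assign d (o.toTerm (.reg d) (.reg (d + 1)))))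
  -- Register `d` saves the content of `r`, to be restored at the end, and register `d + 1`
  -- accumulates the sum.
  | sum r e, d => .seq (.assign d (.reg r)) (.seq (.assign (d + 1) (.const 0))
      (.seq (.assign r (.const 0)) (.seq
        (.loop (.sub (.reg 0) (.reg r)) (.seq (e.compile (d + 2))
          (.seq (.assign (d + 1) (.add (.reg (d + 1)) (.reg (d + 2))))
            (.assign r (.add (.reg r) (.const 1))))))
        (.seq (.assign r (.reg d)) (.assign d (.reg (d + 1)))))))

end Expr

/-- The states have the same memory and the same variables. -/
def Agree (s s' : State) : Prop := s.mem = s'.mem ∧ ∀ r < numVars, s.reg r = s'.reg r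

theorem Agree.refl (s : State) : Agree s s := ⟨rfl, fun _ _ => rfl⟩

theorem Agree.symm {s s' : State} (h : Agree s s') : Agree s' s :=
  ⟨h.1.symm, fun r hr => (h.2 r hr).symm⟩

theorem Agree.set {s s' : State} (h : Agree s s') (r x : ℕ) : Agree (s.set r x) (s'.set r x) :=
  ⟨h.1, fun r' hr' => by simp [State.set_reg, h.2 r' hr']⟩

theorem Agree.put {s s' : State} (h : Agree s s') (a x : ℕ) : Agree (s.put a x) (s'.put a x) :=
  ⟨by simp [State.put, h.1], fun r' hr' => by simp [h.2 r' hr']⟩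

theorem Expr.eval_congr {e : Expr} (he : e.WF) {s s' : State} (h : Agree s s') :
    e.eval s = e.eval s' := by
  induction e generalizing s s' with
  | const c => rfl
  | var r => exact h.2 r he
  | cell e ih => simp only [eval, ih he h, h.1]
  | bin o e f ihe ihf => simp only [eval, ihe he.1 h, ihf he.2 h]
  | sum r e ih =>
    simp only [eval, h.2 0 (by decide)]
    exact Finset.sum_congr rfl fun i _ => ih he.2.2 (h.set r i)

/-- The variables and the memory cells are less than `2 ^ Y`, and register `0` is at
most `Y`. -/
structure Bounded (Y : ℕ) (s : State) : Prop where
  reg : ∀ r < numVars, s.reg r < 2 ^ Y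
  mem : ∀ a, s.mem a < 2 ^ Y
  zero : s.reg 0 ≤ Y

theorem Bounded.agree {Y : ℕ} {s s' : State} (h : Bounded Y s) (hs : Agree s s') :
    Bounded Y s' :=
  ⟨fun r hr => hs.2 r hr ▸ h.reg r hr, fun a => hs.1 ▸ h.mem a, hs.2 0 (by decide) ▸ h.zero⟩

theorem Bounded.set {Y : ℕ} {s : State} (h : Bounded Y s) {r x : ℕ} (hr : r ≠ 0)
    (hx : x < 2 ^ Y) : Bounded Y (s.set r x) :=
  ⟨fun r' hr' => by rw [State.set_reg]; split_ifs; exacts [hx, h.reg r' hr'], h.mem,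
    by rw [State.set_reg, if_neg hr.symm]; exact h.zero⟩

theorem Bounded.put {Y : ℕ} {s : State} (h : Bounded Y s) {a x : ℕ}
    (hx : x < 2 ^ Y) : Bounded Y (s.put a x) :=
  ⟨h.reg, fun a' => by rw [State.put_mem]; split_ifs; exacts [hx, h.mem a'], h.zero⟩

theorem len_le_of_lt {x k : ℕ} (h : x < 2 ^ k) : len x ≤ k + 1 := by
  rw [len, add_le_add_iff_right, Nat.size_le]; exact h

theorem BinOp.apply_lt (o : BinOp) {x y k : ℕ} (hx : x < 2 ^ k) (hy : y < 2 ^ k) :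
    o.apply x y < 2 ^ (k + k + 1) := by
  have h1 : (0 : ℕ) < 2 ^ k := by positivity
  have h2 : 2 ^ k ≤ 2 ^ (k + k + 1) := Nat.pow_le_pow_right (by norm_num) (by omega)
  have h3 : 2 ^ (k + k + 1) = 2 * (2 ^ k * 2 ^ k) := by ring
  cases o with
  | add => simp only [apply]; nlinarith
  | sub => simp only [apply]; omega
  | mul => simp only [apply]; nlinarith
  | div => simp only [apply]; exact (Nat.div_le_self _ _).trans_lt (by omega)

theorem BinOp.eval_toTerm (o : BinOp) (e f : Term) (s : State) :
    (o.toTerm e f).eval s = o.apply (e.eval s) (f.eval s) := by cases o <;> rfl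

theorem BinOp.cost_toTerm (o : BinOp) (e f : Term) (s : State) :
    (o.toTerm e f).cost s = e.cost s + f.cost s + len (e.eval s) + len (f.eval s) := by
  cases o <;> rfl

/-- The constant `c` bounds the values and the time of the compiled expression. -/
def Expr.Costs (e : Expr) (c : ℕ) : Prop :=
  ∀ d ≥ numVars, ∀ Y ≥ 1, ∀ s, Bounded Y s → e.eval s < 2 ^ (c * Y) ∧
    ∃ s' t, Exec (e.compile d) s s' t ∧ t ≤ c * Y ^ c ∧ s'.mem = s.mem ∧
      (∀ r < d, s'.reg r = s.reg r) ∧ s'.reg d = e.eval s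

theorem Expr.Costs.mono {e : Expr} {c c' : ℕ} (h : e.Costs c) (hc : c ≤ c') : e.Costs c' := by
  intro d hd Y hY s hs
  obtain ⟨h1, s', t, h2, h3, h4⟩ := h d hd Y hY s hs
  refine ⟨h1.trans_le (Nat.pow_le_pow_right (by norm_num) (Nat.mul_le_mul_right _ hc)), s', t, h2,
    h3.trans ?_, h4⟩
  exact Nat.mul_le_mul hc (Nat.pow_le_pow_right hY hc)

theorem exec_assign (s : State) (r : ℕ) (e : Term) :
    Exec (.assign r e) s (s.set r (e.eval s)) (e.cost s + len (e.eval s)) := .assign r e s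

/-- An operation at most doubles the bit length, up to a constant. A sum has at most `Y` terms,
since register `0` is at most `Y`, so it adds at most `Y` bits and one power of `Y` to the time. As
the expression is fixed, this yields a polynomial in `Y`; the numerical constants are generous. -/
theorem Expr.exists_costs {e : Expr} (he : e.WF) : ∃ c, e.Costs c := by
  induction e with
  | const c =>
    refine ⟨2 * (c + 1), fun d hd Y hY s hs =>
      ⟨?_, _, _, exec_assign s d (.const c), ?_, rfl, ?_, ?_⟩⟩
    · have h1 : c < 2 ^ c := Nat.lt_two_pow_self
      refine h1.trans_le (Nat.pow_le_pow_right (by norm_num) ?_)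
      nlinarith
    · simp only [Term.cost, Term.eval]
      have h2 := len_le_of_lt (Nat.lt_two_pow_self (n := c))
      have h1 : 1 ≤ Y ^ (2 * (c + 1)) := Nat.one_le_pow _ _ hY
      nlinarith
    · intro r hr; rw [State.set_reg, if_neg hr.ne]
    · rw [State.set_reg, if_pos rfl]; rfl
  | var r =>
    refine ⟨4, fun d hd Y hY s hs => ⟨?_, _, _, exec_assign s d (.reg r), ?_, rfl, ?_, ?_⟩⟩
    · exact (hs.reg r he).trans_le (Nat.pow_le_pow_right (by norm_num) (by omega))
    · simp only [Term.cost, Term.eval]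
      have h2 := len_le_of_lt (hs.reg r he)
      have h1 : Y ^ 1 ≤ Y ^ 4 := Nat.pow_le_pow_right hY (by norm_num)
      rw [pow_one] at h1
      omega
    · intro r hr; rw [State.set_reg, if_neg hr.ne]
    · rw [State.set_reg, if_pos rfl]; rfl
  | cell e ih =>
    obtain ⟨c, hc⟩ := ih he
    refine ⟨3 * c + 8, fun d hd Y hY s hs => ?_⟩
    obtain ⟨h1, s', t, h2, h3, h4, h5, h6⟩ := hc d hd Y hY s hs
    refine ⟨?_, _, _, .seq h2 (exec_assign s' d (.cell (.reg d))), ?_, h4, ?_, ?_⟩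
    · exact (hs.mem _).trans_le (Nat.pow_le_pow_right (by norm_num) (by nlinarith))
    · simp only [Term.cost, Term.eval, h4, h6]
      have h7 := len_le_of_lt (hs.mem (e.eval s))
      have h8 := len_le_of_lt h1
      have h9 : Y ^ c ≤ Y ^ (3 * c + 8) := Nat.pow_le_pow_right hY (by omega)
      have h10 : Y ^ 1 ≤ Y ^ (3 * c + 8) := Nat.pow_le_pow_right hY (by omega)
      rw [pow_one] at h10
      have := Nat.mul_le_mul_left c h9
      have := Nat.mul_le_mul_left c h10
      have e : (3 * c + 8) * Y ^ (3 * c + 8) = 3 * (c * Y ^ (3 * c + 8)) + 8 * Y ^ (3 * c + 8) := by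
        ring
      omega
    · intro r hr; rw [State.set_reg, if_neg hr.ne, h5 r hr]
    · rw [State.set_reg, if_pos rfl]; simp [Term.eval, eval, h6, h4]
  | bin o e f ihe ihf =>
    obtain ⟨c₁, hc₁⟩ := ihe he.1
    obtain ⟨c₂, hc₂⟩ := ihf he.2
    obtain ⟨c, hc, hc'⟩ : ∃ c, e.Costs c ∧ f.Costs c :=
      ⟨max c₁ c₂, hc₁.mono (le_max_left _ _), hc₂.mono (le_max_right _ _)⟩
    refine ⟨8 * c + 8, fun d hd Y hY s hs => ?_⟩
    obtain ⟨h1, s', t, h2, h3, h4, h5, h6⟩ := hc d hd Y hY s hs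
    have hag : Agree s s' := ⟨h4.symm, fun r hr => (h5 r (by omega)).symm⟩
    obtain ⟨h1', s'', t', h2', h3', h4', h5', h6'⟩ :=
      hc' (d + 1) (by omega) Y hY s' (hs.agree hag)
    rw [Expr.eval_congr he.2 hag.symm] at h1' h6'
    have h7 := o.apply_lt h1 h1'
    refine ⟨?_, _, _, .seq h2 (.seq h2' (exec_assign s'' d _)), ?_, h4'.trans h4, ?_, ?_⟩
    · exact h7.trans_le (Nat.pow_le_pow_right (by norm_num) (by nlinarith))
    · simp only [BinOp.cost_toTerm, BinOp.eval_toTerm, Term.cost, Term.eval, h6',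
        h5' d (by omega), h6]
      have h8 := len_le_of_lt h7
      have h9 := len_le_of_lt h1
      have h10 := len_le_of_lt h1'
      have h11 : Y ^ c ≤ Y ^ (8 * c + 8) := Nat.pow_le_pow_right hY (by omega)
      have h12 : Y ^ 1 ≤ Y ^ (8 * c + 8) := Nat.pow_le_pow_right hY (by omega)
      rw [pow_one] at h12
      have := Nat.mul_le_mul_left c h11
      have := Nat.mul_le_mul_left c h12
      linarith
    · intro r hr; rw [State.set_reg, if_neg hr.ne, h5' r (by omega), h5 r hr]
    · rw [State.set_reg, if_pos rfl]
      simp [BinOp.eval_toTerm, Term.eval, eval, h6, h6', h5' d (by omega)]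
  | sum r e ih =>
    obtain ⟨hr0, hr, he⟩ := he
    obtain ⟨c, hc⟩ := ih he
    refine ⟨30 * c + 100, fun d hd Y hY s hs => ?_⟩
    have hY2 : Y < 2 ^ Y := Nat.lt_two_pow_self
    have hterm : ∀ i < s.reg 0, e.eval (s.set r i) < 2 ^ (c * Y) := fun i hi =>
      (hc d hd Y hY (s.set r i) (hs.set hr0.ne' (by have := hs.zero; omega))).1
    have hpart : ∀ m ≤ s.reg 0, ∑ i ∈ Finset.range m, e.eval (s.set r i) < 2 ^ ((c + 1) * Y) := by
      intro m hm
      have h1 : ∑ i ∈ Finset.range m, e.eval (s.set r i) ≤ m * 2 ^ (c * Y) := by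
        have := Finset.sum_le_card_nsmul (Finset.range m) (fun i => e.eval (s.set r i))
          (2 ^ (c * Y)) (fun i hi => (hterm i (by simp at hi; omega)).le)
        simpa using this
      have h2 : m < 2 ^ Y := by have := hs.zero; omega
      have h3 : m * 2 ^ (c * Y) < 2 ^ Y * 2 ^ (c * Y) :=
        Nat.mul_lt_mul_of_pos_right h2 (by positivity)
      rw [add_one_mul, pow_add, mul_comm (2 ^ (c * Y))]
      omega
    -- the loop
    have hloop : ∀ m i : ℕ, m + i = s.reg 0 → ∀ s₁, (∀ r' < d + 1, r' ≠ r → s₁.reg r' =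
        (s.set d (s.reg r)).reg r') → s₁.mem = s.mem → s₁.reg r = i → s₁.reg (d + 1) =
        ∑ i ∈ Finset.range i, e.eval (s.set r i) → ∃ s' t,
        Exec (.loop (.sub (.reg 0) (.reg r)) (.seq (e.compile (d + 2))
          (.seq (.assign (d + 1) (.add (.reg (d + 1)) (.reg (d + 2))))
            (.assign r (.add (.reg r) (.const 1)))))) s₁ s' t ∧
          t ≤ m * (c * Y ^ c + 20 * (c + 1) * Y + 20) + (4 * Y + 4) ∧ s'.mem = s.mem ∧
          (∀ r' < d + 1, r' ≠ r → s'.reg r' = (s.set d (s.reg r)).reg r') ∧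
          s'.reg (d + 1) = ∑ i ∈ Finset.range (s.reg 0), e.eval (s.set r i) := by
      intro m
      induction m with
      | zero =>
        intro i hi s₁ h1 h2 h3 h4
        have h0 : s₁.reg 0 = s.reg 0 := by
          rw [h1 0 (by omega) hr0.ne, State.set_reg, if_neg (by omega)]
        refine ⟨s₁, _, .loop_false (by simp [Term.eval, h0, h3, ← hi]), ?_, h2, h1, ?_⟩
        · simp only [Term.cost, Term.eval, h0, h3]
          have h5 : len (s.reg 0) ≤ Y + 1 := len_le_of_lt (by have := hs.zero; omega)
          have h6 : len i ≤ Y + 1 := len_le_of_lt (by have := hs.zero; omega)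
          omega
        · rw [h4, ← hi, zero_add]
      | succ m ihm =>
        intro i hi s₁ h1 h2 h3 h4
        have h0 : s₁.reg 0 = s.reg 0 := by
          rw [h1 0 (by omega) hr0.ne, State.set_reg, if_neg (by omega)]
        have hag : Agree s₁ (s.set r i) := ⟨h2, fun r' hr' => by
          rw [State.set_reg]
          split_ifs with h
          · rw [h, h3]
          · rw [h1 r' (by omega) h, State.set_reg, if_neg (by omega)]⟩
        have hb : Bounded Y (s.set r i) := hs.set hr0.ne' (by have := hs.zero; omega)
        obtain ⟨-, s₂, t₂, h5, h6, h7, h8, h9⟩ := hc (d + 2) (by omega) Y hY s₁ (hb.agree hag.symm)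
        rw [Expr.eval_congr he hag] at h9
        obtain ⟨s', t, h10, h11, h12⟩ := ihm (i + 1) (by omega)
          ((s₂.set (d + 1) (s₂.reg (d + 1) + s₂.reg (d + 2))).set r (i + 1))
          (fun r' hr' hne => by
            rw [State.set_reg, if_neg hne, State.set_reg, if_neg (by omega), h8 r' (by omega),
              h1 r' hr' hne])
          (by simp [h7, h2]) (by simp [State.set_reg])
          (by
            rw [State.set_reg, if_neg (by omega), State.set_reg, if_pos rfl, h8 _ (by omega), h4,
              h9, Finset.sum_range_succ])
        have h13 : (s₂.set (d + 1)
            ((Term.add (.reg (d + 1)) (.reg (d + 2))).eval s₂)).reg r = i := by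
          rw [State.set_reg, if_neg (by omega), h8 _ (by omega), h3]
        have h14 : (Term.add (.reg r) (.const 1)).eval
            (s₂.set (d + 1) ((Term.add (.reg (d + 1)) (.reg (d + 2))).eval s₂)) = i + 1 := by
          simp only [Term.eval] at h13 ⊢; rw [h13]
        have h10' := h10
        rw [← h14] at h10'
        refine ⟨s', _, .loop_true (by simp only [Term.eval, h0, h3]; omega)
          (.seq h5 (.seq (exec_assign _ (d + 1) (.add (.reg (d + 1)) (.reg (d + 2))))
            (exec_assign _ r (.add (.reg r) (.const 1))))) h10', ?_, h12⟩
        · clear h10 h10'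
          have hz := hs.zero
          have l1 : len (s.reg 0) ≤ Y + 1 := len_le_of_lt (by omega)
          have l2 : len i ≤ Y + 1 := len_le_of_lt (by omega)
          have l3 : len (i + 1) ≤ Y + 1 := len_le_of_lt (by omega)
          have l4 := len_le_of_lt (hpart i (by omega))
          have l5 := len_le_of_lt (hterm i (by omega))
          have l6 := len_le_of_lt (hpart (i + 1) (by omega))
          have l7 : len 1 ≤ 2 := len_le_of_lt (by norm_num)
          have h15 : s₂.reg (d + 1) + s₂.reg (d + 2) =
              ∑ i ∈ Finset.range (i + 1), e.eval (s.set r i) := by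
            rw [h8 _ (by omega), h4, h9, Finset.sum_range_succ]
          have h16 : ∀ x, (s₂.set (d + 1) x).reg r = i := fun x => by
            rw [State.set_reg, if_neg (by omega), h8 _ (by omega), h3]
          simp only [Term.cost, Term.eval, h0, h3, h16, h15]
          rw [h8 (d + 1) (by omega), h4, h9]
          have e1 : (m + 1) * (c * Y ^ c + 20 * (c + 1) * Y + 20) =
            m * (c * Y ^ c + 20 * (c + 1) * Y + 20) + (c * Y ^ c + 20 * ((c + 1) * Y) + 20) := by
            ring
          have e2 : c * Y + Y = (c + 1) * Y := by ring
          rw [e1]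
          omega
    let s₃ := ((s.set d (s.reg r)).set (d + 1) 0).set r 0
    obtain ⟨s', t, h1, h2, h3, h4, h5⟩ := hloop (s.reg 0) 0 rfl s₃ (fun r' hr' hne => by
      simp only [s₃]
      rw [State.set_reg, if_neg hne, State.set_reg, if_neg (by omega)]) rfl
      (by simp [s₃, State.set_reg])
      (by simp only [s₃]; rw [State.set_reg, if_neg (by omega), State.set_reg, if_pos rfl]; simp)
    have h6 : s'.reg d = s.reg r := by
      rw [h4 d (by omega) (by omega), State.set_reg, if_pos rfl]
    refine ⟨?_, _, _, .seq (exec_assign s d (.reg r)) (.seq (exec_assign _ (d + 1) (.const 0))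
      (.seq (exec_assign _ r (.const 0)) (.seq h1 (.seq (exec_assign s' r (.reg d))
        (exec_assign _ d (.reg (d + 1))))))), ?_, h3, ?_, ?_⟩
    · exact (hpart _ le_rfl).trans_le (Nat.pow_le_pow_right (by norm_num) (by nlinarith))
    · simp only [Term.cost, Term.eval, h6]
      rw [State.set_reg, if_neg (by omega), h5]
      have l1 := len_le_of_lt (hpart _ le_rfl)
      have l2 := len_le_of_lt (hs.reg r hr)
      have l3 : len 0 ≤ 2 := len_le_of_lt (by norm_num)
      have hz := hs.zero
      have e1 : Y ^ 1 ≤ Y ^ (30 * c + 100) := Nat.pow_le_pow_right hY (by omega)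
      have e2 : Y ^ (c + 1) ≤ Y ^ (30 * c + 100) := Nat.pow_le_pow_right hY (by omega)
      have e3 : Y ^ 2 ≤ Y ^ (30 * c + 100) := Nat.pow_le_pow_right hY (by omega)
      have e4 : s.reg 0 * (c * Y ^ c + 20 * (c + 1) * Y + 20) ≤
        Y * (c * Y ^ c + 20 * (c + 1) * Y + 20) := Nat.mul_le_mul_right _ hz
      have e5 : Y * (c * Y ^ c + 20 * (c + 1) * Y + 20) =
        c * Y ^ (c + 1) + 20 * (c + 1) * Y ^ 2 + 20 * Y ^ 1 := by ring
      have e6 := Nat.mul_le_mul_left c e2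
      have e7 := Nat.mul_le_mul_left (20 * (c + 1)) e3
      have e8 := Nat.mul_le_mul_left c e1
      rw [pow_one] at e1 e8 e5
      rw [add_one_mul] at l1
      generalize Y ^ (30 * c + 100) = P at *
      have e9 : (30 * c + 100) * P = 30 * (c * P) + 100 * P := by ring
      have e10 : 20 * (c + 1) * P = 20 * (c * P) + 20 * P := by ring
      omega
    · intro r' hr'
      rw [State.set_reg, if_neg hr'.ne, State.set_reg]
      split_ifs with h
      · simp only [Term.eval, h6, h]
      · rw [h4 r' (by omega) h, State.set_reg, if_neg hr'.ne]
    · rw [State.set_reg, if_pos rfl]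
      simp only [Term.eval, eval]
      rw [State.set_reg, if_neg (by omega), h5]

end RAM


/-! ### Structured statements and a Hoare logic that counts steps -/

namespace RAM

/-- Programs with expressions and bounded loops: `loop r l p` runs `p` where the register `r`
runs through the numbers below the content of register `l`. -/
inductive Stmt where
  | assign (r : ℕ) (e : Expr)
  | store (a e : Expr)
  | cond (e : Expr) (p : Stmt)
  | loop (r l : ℕ) (p : Stmt)
  | seq (p q : Stmt)

namespace Stmt

/-- All registers that occur are variables, and register `0` is not written. -/
def WF : Stmt → Prop
  | assign r e => 0 < r ∧ r < numVars ∧ e.WF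
  | store a e => a.WF ∧ e.WF
  | cond e p => e.WF ∧ p.WF
  | loop r l p => 0 < r ∧ r < numVars ∧ l < numVars ∧ p.WF
  | seq p q => p.WF ∧ q.WF

/-- Translation into a program of the machine. -/
def compile : Stmt → Program
  | assign r e => .seq (e.compile numVars) (.assign r (.reg numVars))
  | store a e => .seq (a.compile numVars) (.seq (e.compile (numVars + 1))
      (.store (.reg numVars) (.reg (numVars + 1))))
  | cond e p => .seq (e.compile numVars) (.cond (.reg numVars) p.compile .skip)
  | loop r l p => .seq (.assign r (.const 0)) (.loop (.sub (.reg l) (.reg r))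
      (.seq p.compile (.assign r (.add (.reg r) (.const 1)))))
  | seq p q => .seq p.compile q.compile

/-- The constant `c` bounds the values and the time of all expressions. -/
def Costs (c : ℕ) : Stmt → Prop
  | assign _ e => e.Costs c
  | store a e => a.Costs c ∧ e.Costs c
  | cond e p => e.Costs c ∧ p.Costs c
  | loop _ _ p => p.Costs c
  | seq p q => p.Costs c ∧ q.Costs c

theorem Costs.mono {c c' : ℕ} (hc : c ≤ c') {p : Stmt} (h : p.Costs c) : p.Costs c' := by
  induction p with
  | assign r e => exact Expr.Costs.mono h hc
  | store a e => exact ⟨h.1.mono hc, h.2.mono hc⟩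
  | cond e p ih => exact ⟨h.1.mono hc, ih h.2⟩
  | loop r l p ih => exact ih h
  | seq p q ihp ihq => exact ⟨ihp h.1, ihq h.2⟩

theorem exists_costs {p : Stmt} (hp : p.WF) : ∃ c, p.Costs c := by
  induction p with
  | assign r e => exact Expr.exists_costs hp.2.2
  | store a e =>
    obtain ⟨c, hc⟩ := Expr.exists_costs hp.1
    obtain ⟨c', hc'⟩ := Expr.exists_costs hp.2
    exact ⟨max c c', hc.mono (le_max_left _ _), hc'.mono (le_max_right _ _)⟩
  | cond e p ih =>
    obtain ⟨c, hc⟩ := Expr.exists_costs hp.1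
    obtain ⟨c', hc'⟩ := ih hp.2
    exact ⟨max c c', hc.mono (le_max_left _ _), hc'.mono (le_max_right _ _)⟩
  | loop r l p ih => exact ih hp.2.2.2
  | seq p q ihp ihq =>
    obtain ⟨c, hc⟩ := ihp hp.1
    obtain ⟨c', hc'⟩ := ihq hp.2
    exact ⟨max c c', hc.mono (le_max_left _ _), hc'.mono (le_max_right _ _)⟩

end Stmt

/-- The time allowed for one step. -/
def tick (c Y : ℕ) : ℕ := 20 * (c + 1) * Y ^ (c + 1)

/-- Started in `v`, the program takes at most `t` steps and reaches a state with `Q`. -/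
def Tri (Y : ℕ) (p : Stmt) (v : State) (t : ℕ) (Q : State → Prop) : Prop :=
  p.WF → 1 ≤ Y → ∀ c, p.Costs c → Bounded Y v → ∀ s, Agree s v → ∃ s' τ v',
    Exec p.compile s s' τ ∧ τ ≤ tick c Y * t ∧ Agree s' v' ∧ Bounded Y v' ∧ Q v'

namespace Tri

variable {Y : ℕ} {v : State} {t t' : ℕ} {Q Q' : State → Prop}

theorem mono {p : Stmt} (h : Tri Y p v t Q) (ht : t ≤ t') (hQ : ∀ v, Q v → Q' v) :
    Tri Y p v t' Q' := by
  intro hp hY c hc hv s hs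
  obtain ⟨s', τ, v', h1, h2, h3, h4, h5⟩ := h hp hY c hc hv s hs
  exact ⟨s', τ, v', h1, h2.trans (Nat.mul_le_mul_left _ ht), h3, h4, hQ _ h5⟩

/-- A triple is only about bounded initial states, so the bounds may be used to discharge side
conditions such as those of assignments that copy or halve a register. -/
theorem of_bounded {p : Stmt} (h : Bounded Y v → Tri Y p v t Q) : Tri Y p v t Q :=
  fun hp hY c hc hv => h hv hp hY c hc hv

theorem tick_bounds {c Y : ℕ} (hY : 1 ≤ Y) :
    20 * (c * Y ^ c) ≤ tick c Y ∧ 20 * (c * Y) ≤ tick c Y ∧ 20 * Y ≤ tick c Y ∧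
      20 ≤ tick c Y ∧ 20 * (c * Y ^ c) + 20 * Y ≤ tick c Y ∧
      20 * (c * Y) + 20 * Y ≤ tick c Y := by
  have h1 : Y ^ c ≤ Y ^ (c + 1) := Nat.pow_le_pow_right hY (by omega)
  have h2 : Y ^ 1 ≤ Y ^ (c + 1) := Nat.pow_le_pow_right hY (by omega)
  rw [pow_one] at h2
  have h3 := Nat.mul_le_mul_left c h1
  have h4 := Nat.mul_le_mul_left c h2
  have h5 : tick c Y = 20 * (c * Y ^ (c + 1)) + 20 * Y ^ (c + 1) := by rw [tick]; ring
  omega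

theorem assign {r : ℕ} {e : Expr} (he : e.eval v < 2 ^ Y) (hQ : Q (v.set r (e.eval v))) :
    Tri Y (.assign r e) v 1 Q := by
  intro hp hY c hc hv s hs
  obtain ⟨-, s', τ, h1, h2, h3, h4, h5⟩ := hc numVars le_rfl Y hY s (hv.agree hs.symm)
  rw [Expr.eval_congr hp.2.2 hs] at h5
  have hag : Agree s' v := ⟨h3.trans hs.1, fun r hr => (h4 r hr).trans (hs.2 r hr)⟩
  refine ⟨_, _, v.set r (e.eval v), .seq h1 (exec_assign s' r (.reg numVars)), ?_, ?_,
    hv.set hp.1.ne' he, hQ⟩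
  · simp only [Term.cost, Term.eval, h5]
    have := len_le_of_lt he
    have := tick_bounds (c := c) hY
    omega
  · simp only [Term.eval, h5]
    exact hag.set _ _

theorem store {a e : Expr} (he : e.eval v < 2 ^ Y) (hQ : Q (v.put (a.eval v) (e.eval v))) :
    Tri Y (.store a e) v 1 Q := by
  intro hp hY c hc hv s hs
  obtain ⟨h0, s', τ, h1, h2, h3, h4, h5⟩ := hc.1 numVars le_rfl Y hY s (hv.agree hs.symm)
  have hag : Agree s' v := ⟨h3.trans hs.1, fun r hr => (h4 r hr).trans (hs.2 r hr)⟩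
  obtain ⟨-, s'', τ', h1', h2', h3', h4', h5'⟩ := hc.2 (numVars + 1) (by omega) Y hY s'
    (hv.agree hag.symm)
  rw [Expr.eval_congr hp.1 hs] at h5 h0
  rw [Expr.eval_congr hp.2 hag] at h5'
  have hag' : Agree s'' v :=
    ⟨h3'.trans hag.1, fun r hr => (h4' r (by omega)).trans (hag.2 r hr)⟩
  have h6 := h4' numVars (by omega)
  refine ⟨_, _, v.put (a.eval v) (e.eval v),
    .seq h1 (.seq h1' (.store (.reg numVars) (.reg (numVars + 1)) s'')), ?_, ?_, hv.put he, hQ⟩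
  · simp only [Term.cost, Term.eval, h5, h5', h6]
    have := len_le_of_lt he
    have := len_le_of_lt h0
    have := tick_bounds (c := c) hY
    omega
  · simp only [Term.eval, h5, h5', h6]
    exact hag'.put _ _

theorem cond {e : Expr} {p : Stmt} (h : e.eval v ≠ 0 → Tri Y p v t Q)
    (h' : e.eval v = 0 → Q v) : Tri Y (.cond e p) v (t + 1) Q := by
  intro hp hY c hc hv s hs
  obtain ⟨h0, s', τ, h1, h2, h3, h4, h5⟩ := hc.1 numVars le_rfl Y hY s (hv.agree hs.symm)
  have hag : Agree s' v := ⟨h3.trans hs.1, fun r hr => (h4 r hr).trans (hs.2 r hr)⟩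
  rw [Expr.eval_congr hp.1 hs] at h5 h0
  have hl := len_le_of_lt h0
  have ht := tick_bounds (c := c) hY
  by_cases hz : e.eval v = 0
  · refine ⟨_, _, v, .seq h1 (.cond_false (by simpa [Term.eval, h5] using hz) (.skip s')), ?_, hag,
      hv, h' hz⟩
    simp only [Term.cost, h5]
    rw [mul_add]
    omega
  · obtain ⟨s'', τ', v', h6, h7, h8⟩ := h hz hp.2 hY c hc.2 hv s' hag
    refine ⟨s'', _, v', .seq h1 (.cond_true (by simpa [Term.eval, h5] using hz) h6), ?_, h8⟩
    simp only [Term.cost, h5]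
    rw [mul_add]
    omega

theorem seq {p q : Stmt} (h : Tri Y p v t fun v' => Tri Y q v' t' Q) :
    Tri Y (.seq p q) v (t + t') Q := by
  intro hp hY c hc hv s hs
  obtain ⟨s', τ, v', h1, h2, h3, h4, h5⟩ := h hp.1 hY c hc.1 hv s hs
  obtain ⟨s'', τ', v'', h6, h7, h8⟩ := h5 hp.2 hY c hc.2 h4 s' h3
  exact ⟨s'', _, v'', .seq h1 h6, by rw [mul_add]; omega, h8⟩

/-- Each round pays one extra step for test and increment, and one more step covers the
initialization and the last test. The machine reads the limit from register `l` at every test, hence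
each round has to leave it intact. The invariant is stated for the state with the counter already
set. -/
theorem loop {r l : ℕ} {p : Stmt} (L : ℕ) (Inv : ℕ → State → Prop) (hL : (v.set r 0).reg l = L)
    (h0 : Inv 0 (v.set r 0))
    (hstep : ∀ i < L, ∀ v, v.reg r = i → v.reg l = L → Inv i v → Tri Y p v t fun v' =>
      v'.reg r = i ∧ (v'.set r (i + 1)).reg l = L ∧ Inv (i + 1) (v'.set r (i + 1)))
    (hQ : ∀ v, Inv L v → Q v) : Tri Y (.loop r l p) v (L * (t + 1) + 1) Q := by
  intro hp hY c hc hv s hs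
  have hv0 : Bounded Y (v.set r 0) := hv.set hp.1.ne' (by positivity)
  have hLY : L < 2 ^ Y := hL ▸ hv0.reg l hp.2.2.1
  have ht := tick_bounds (c := c) hY
  have hmain : ∀ m i, m + i = L → ∀ v, Bounded Y v → v.reg r = i → v.reg l = L → Inv i v →
      ∀ s, Agree s v → ∃ s' τ v', Exec (.loop (.sub (.reg l) (.reg r))
      (.seq p.compile (.assign r (.add (.reg r) (.const 1))))) s s' τ ∧
        τ ≤ tick c Y * (m * (t + 1)) + (4 * Y + 4) ∧ Agree s' v' ∧ Bounded Y v' ∧ Q v' := by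
    intro m
    induction m with
    | zero =>
      intro i hi v hv h1 h2 h3 s hs
      have hr := hs.2 r hp.2.1
      have hl := hs.2 l hp.2.2.1
      refine ⟨s, _, v, .loop_false (by simp only [Term.eval]; omega), ?_, hs, hv, hQ v ?_⟩
      · simp only [Term.cost, Term.eval, hr, hl, h1, h2]
        have := len_le_of_lt hLY
        have := len_le_of_lt (show i < 2 ^ Y by omega)
        omega
      · rw [← hi, zero_add]; exact h3
    | succ m ih =>
      intro i hi v hv h1 h2 h3 s hs
      have hr := hs.2 r hp.2.1
      have hl := hs.2 l hp.2.2.1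
      obtain ⟨s', τ, v', h4, h5, h6, h7, h8, h9, h10⟩ :=
        hstep i (by omega) v h1 h2 h3 hp.2.2.2 hY c hc hv s hs
      have hr' := h6.2 r hp.2.1
      have e1 : (Term.add (.reg r) (.const 1)).eval s' = i + 1 := by
        simp only [Term.eval, hr', h8]
      obtain ⟨s'', τ', v'', h11, h12, h13⟩ := ih (i + 1) (by omega) (v'.set r (i + 1))
        (h7.set hp.1.ne' (by omega)) (by simp [State.set_reg]) h9 h10 (s'.set r (i + 1))
        (h6.set r (i + 1))
      rw [← e1] at h11
      refine ⟨s'', _, v'', .loop_true (by simp only [Term.eval]; omega)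
        (.seq h4 (exec_assign s' r (.add (.reg r) (.const 1)))) h11, ?_, h13⟩
      rw [e1]
      simp only [Term.cost, Term.eval, hr, hl, hr', h1, h2, h8]
      have := len_le_of_lt hLY
      have := len_le_of_lt (show i < 2 ^ Y by omega)
      have := len_le_of_lt (show i + 1 < 2 ^ Y by omega)
      have : len 1 ≤ 2 := len_le_of_lt (by norm_num)
      have e2 : tick c Y * ((m + 1) * (t + 1)) =
        tick c Y * (m * (t + 1)) + tick c Y * t + tick c Y := by ring
      omega
  obtain ⟨s', τ, v', h1, h2, h3⟩ := hmain L 0 rfl (v.set r 0) hv0 (by simp [State.set_reg]) hL h0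
    (s.set r 0) (hs.set r 0)
  refine ⟨s', _, v', .seq (exec_assign s r (.const 0)) h1, ?_, h3⟩
  simp only [Term.cost, Term.eval]
  have : len 0 ≤ 2 := len_le_of_lt (by norm_num)
  rw [mul_add, mul_one]
  omega

end Tri

end RAM


/-! ## Codes in base four -/

section Codes

variable {n k : ℕ}

/-- The weights `4 ^ 0, …, 4 ^ (k - 1)` are distributed over the elements of `C`. -/
def IsWeight (W : Fin n → ℕ) (C : Finset (Fin n)) (k : ℕ) : Prop :=
  ∃ f : Fin k → Fin n, Function.Injective f ∧ (∀ j, W (f j) = 4 ^ (j : ℕ)) ∧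
    (∀ y, y ∉ Set.range f → W y = 0) ∧ ∀ y, y ∈ C ↔ y ∈ Set.range f

/-- The digit of `q` at `y`. -/
def digit (W : Fin n → ℕ) (q : ℕ) (y : Fin n) : ℕ := q / W y % 4

/-- The set of the `y` where `q` has the digit `i`. -/
def digitSet (W : Fin n → ℕ) (q i : ℕ) : Finset (Fin n) := {y | digit W q y = i}

/-- The number with digit `1` on `L`, `2` on `L'`, `3` on `A`. -/
def code (W : Fin n → ℕ) (L L' A : Finset (Fin n)) : ℕ :=
  ∑ y ∈ L, W y + 2 * ∑ y ∈ L', W y + 3 * ∑ y ∈ A, W y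

variable {W : Fin n → ℕ} {C : Finset (Fin n)}

theorem mem_digitSet {q i : ℕ} {y : Fin n} : y ∈ digitSet W q i ↔ digit W q y = i := by
  simp [digitSet]

theorem digit_lt (q : ℕ) (y : Fin n) : digit W q y < 4 := Nat.mod_lt _ (by norm_num)

namespace IsWeight

theorem weight_pos_iff (h : IsWeight W C k) (y : Fin n) : 0 < W y ↔ y ∈ C := by
  obtain ⟨f, -, h1, h2, h3⟩ := h
  rw [h3]
  constructor
  · intro h; by_contra h'; rw [h2 y h'] at h; omega
  · rintro ⟨j, rfl⟩; rw [h1]; positivity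

theorem digitSet_subset (h : IsWeight W C k) {q i : ℕ} (hi : i ≠ 0) : digitSet W q i ⊆ C := by
  intro y hy
  rw [mem_digitSet] at hy
  rw [← h.weight_pos_iff]
  by_contra h'
  -- Outside of `C` the weight is `0`, and division by `0` makes the digit `0`.
  rw [digit, show W y = 0 by omega] at hy
  simp at hy
  omega

/-- This is the base four expansion, in the form of `finFunctionFinEquiv`, carried over to `C`;
vertices outside of `C` have weight `0` and do not contribute. -/
theorem sum_mul_lt (h : IsWeight W C k) (g : Fin n → ℕ) (hg : ∀ y, g y < 4) :
    ∑ y, g y * W y < 4 ^ k ∧ ∀ y ∈ C, digit W (∑ y, g y * W y) y = g y := by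
  obtain ⟨f, hf, h1, h2, h3⟩ := h
  have h4 : ∑ y, g y * W y =
      (finFunctionFinEquiv (fun j : Fin k => (⟨g (f j), hg _⟩ : Fin 4)) : ℕ) := by
    rw [finFunctionFinEquiv_apply]
    refine (Fintype.sum_of_injective f hf _ _ (fun y hy => by rw [h2 y hy, mul_zero])
      fun j => ?_).symm
    rw [h1]
  rw [h4]
  refine ⟨Fin.isLt _, fun y hy => ?_⟩
  obtain ⟨j, rfl⟩ := (h3 y).1 hy
  have h5 := congrArg (fun F : Fin k → Fin 4 => (F j : ℕ)) (finFunctionFinEquiv.symm_apply_apply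
    (fun j : Fin k => (⟨g (f j), hg _⟩ : Fin 4)))
  simp only [finFunctionFinEquiv_symm_apply_val] at h5
  rw [digit, h1]
  exact h5

theorem sum_digit (h : IsWeight W C k) {q : ℕ} (hq : q < 4 ^ k) :
    ∑ y, digit W q y * W y = q := by
  obtain ⟨f, hf, h1, h2, h3⟩ := h
  have h5 := congrArg Fin.val (finFunctionFinEquiv.apply_symm_apply (⟨q, hq⟩ : Fin (4 ^ k)))
  rw [finFunctionFinEquiv_apply] at h5
  conv_rhs => rw [← show ((⟨q, hq⟩ : Fin (4 ^ k)) : ℕ) = q from rfl, ← h5]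
  refine (Fintype.sum_of_injective f hf _ _ (fun y hy => by rw [h2 y hy, mul_zero])
      fun j => ?_).symm
  rw [h1, digit, h1, finFunctionFinEquiv_symm_apply_val]

theorem code_eq {L L' A : Finset (Fin n)} (h1 : Disjoint L L') (h2 : Disjoint L A)
    (h3 : Disjoint L' A) : code W L L' A =
    ∑ y, (if y ∈ L then 1 else if y ∈ L' then 2 else if y ∈ A then 3 else 0) * W y := by
  have h : ∀ S : Finset (Fin n), ∑ y ∈ S, W y = ∑ y, (if y ∈ S then 1 else 0) * W y := fun S => by
    simp [Finset.sum_ite_mem]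
  rw [code, h, h, h, Finset.mul_sum, Finset.mul_sum, ← Finset.sum_add_distrib,
    ← Finset.sum_add_distrib]
  refine Finset.sum_congr rfl fun y _ => ?_
  have := fun h' : y ∈ L => Finset.disjoint_left.1 h1 h'
  have := fun h' : y ∈ L => Finset.disjoint_left.1 h2 h'
  have := fun h' : y ∈ L' => Finset.disjoint_left.1 h3 h'
  split_ifs <;> simp_all

theorem code_lt (h : IsWeight W C k) {L L' A : Finset (Fin n)} (h1 : Disjoint L L')
    (h2 : Disjoint L A) (h3 : Disjoint L' A) : code W L L' A < 4 ^ k := by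
  rw [code_eq h1 h2 h3]
  exact (h.sum_mul_lt _ fun y => by split_ifs <;> norm_num).1

theorem digit_code (h : IsWeight W C k) {L L' A : Finset (Fin n)} (h1 : Disjoint L L')
    (h2 : Disjoint L A) (h3 : Disjoint L' A) (hL : L ⊆ C) (hL' : L' ⊆ C) (hA : A ⊆ C)
    (y : Fin n) : digit W (code W L L' A) y =
      if y ∈ L then 1 else if y ∈ L' then 2 else if y ∈ A then 3 else 0 := by
  by_cases hy : y ∈ C
  · rw [code_eq h1 h2 h3]
    exact (h.sum_mul_lt _ fun y => by split_ifs <;> norm_num).2 y hy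
  · rw [if_neg fun h => hy (hL h), if_neg fun h => hy (hL' h), if_neg fun h => hy (hA h)]
    rw [← h.weight_pos_iff] at hy
    rw [digit, show W y = 0 by omega]
    simp

theorem digitSet_code (h : IsWeight W C k) {L L' A : Finset (Fin n)} (h1 : Disjoint L L')
    (h2 : Disjoint L A) (h3 : Disjoint L' A) (hL : L ⊆ C) (hL' : L' ⊆ C) (hA : A ⊆ C) :
    digitSet W (code W L L' A) 1 = L ∧ digitSet W (code W L L' A) 2 = L' ∧
      digitSet W (code W L L' A) 3 = A := by
  refine ⟨?_, ?_, ?_⟩ <;> ext y <;> rw [mem_digitSet, h.digit_code h1 h2 h3 hL hL' hA] <;>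
    have := fun h' : y ∈ L => Finset.disjoint_left.1 h1 h' <;>
    have := fun h' : y ∈ L => Finset.disjoint_left.1 h2 h' <;>
    have := fun h' : y ∈ L' => Finset.disjoint_left.1 h3 h' <;>
    split_ifs <;> simp_all

theorem disjoint_digitSet (q : ℕ) {i j : ℕ} (hij : i ≠ j) :
    Disjoint (digitSet W q i) (digitSet W q j) :=
  Finset.disjoint_left.2 fun y hy hy' => hij (by rw [mem_digitSet] at hy hy'; omega)

theorem code_digitSet (h : IsWeight W C k) {q : ℕ} (hq : q < 4 ^ k) :
    code W (digitSet W q 1) (digitSet W q 2) (digitSet W q 3) = q := by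
  conv_rhs => rw [← h.sum_digit hq]
  rw [code_eq (disjoint_digitSet q (by norm_num)) (disjoint_digitSet q (by norm_num))
    (disjoint_digitSet q (by norm_num))]
  refine Finset.sum_congr rfl fun y _ => ?_
  have := digit_lt (W := W) q y
  simp only [mem_digitSet]
  congr 1
  split_ifs <;> omega

end IsWeight

end Codes


/-! ## Expressions on the memory layout of the program -/

namespace RAM

namespace Expr

/-- Logical negation. -/
def neg (a : Expr) : Expr := bin .sub (const 1) a

/-- Test for equality. -/
def eq (a b : Expr) : Expr := neg (bin .add (bin .sub a b) (bin .sub b a))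

/-- Test for `a ≤ b`. -/
def le (a b : Expr) : Expr := neg (bin .sub a b)

/-- Conjunction. -/
def and (a b : Expr) : Expr := bin .mul a b

@[simp] theorem eval_const (c : ℕ) (v : State) : (const c).eval v = c := rfl
@[simp] theorem eval_var (r : ℕ) (v : State) : (var r).eval v = v.reg r := rfl
@[simp] theorem eval_cell (e : Expr) (v : State) : (cell e).eval v = v.mem (e.eval v) := rfl
@[simp] theorem eval_add (a b : Expr) (v : State) :
    (bin .add a b).eval v = a.eval v + b.eval v := rfl
@[simp] theorem eval_sub (a b : Expr) (v : State) :
    (bin .sub a b).eval v = a.eval v - b.eval v := rfl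
@[simp] theorem eval_mul (a b : Expr) (v : State) :
    (bin .mul a b).eval v = a.eval v * b.eval v := rfl
@[simp] theorem eval_div (a b : Expr) (v : State) :
    (bin .div a b).eval v = a.eval v / b.eval v := rfl

theorem eval_neg (a : Expr) (v : State) :
    (neg a).eval v = if a.eval v = 0 then 1 else 0 := by
  simp only [neg, eval_sub, eval_const]
  split_ifs <;> omega

theorem eval_eq (a b : Expr) (v : State) :
    (eq a b).eval v = if a.eval v = b.eval v then 1 else 0 := by
  simp only [eq, eval_neg, eval_add, eval_sub]
  exact if_congr (by omega) rfl rfl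

theorem eval_le (a b : Expr) (v : State) :
    (le a b).eval v = if a.eval v ≤ b.eval v then 1 else 0 := by
  simp only [le, eval_neg, eval_sub]
  exact if_congr (by omega) rfl rfl

@[simp] theorem neg_ne_zero {a : Expr} {v : State} : (neg a).eval v ≠ 0 ↔ ¬ a.eval v ≠ 0 := by
  simp [eval_neg]

@[simp] theorem eq_ne_zero {a b : Expr} {v : State} :
    (eq a b).eval v ≠ 0 ↔ a.eval v = b.eval v := by simp [eval_eq]

@[simp] theorem le_ne_zero {a b : Expr} {v : State} :
    (le a b).eval v ≠ 0 ↔ a.eval v ≤ b.eval v := by simp [eval_le]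

@[simp] theorem and_ne_zero {a b : Expr} {v : State} :
    (and a b).eval v ≠ 0 ↔ a.eval v ≠ 0 ∧ b.eval v ≠ 0 := by simp [and]

/-- An entry of the adjacency matrix. -/
def adj (x y : Expr) : Expr := cell (bin .add (bin .mul x (var 0)) y)

/-- The weight of a vertex. -/
def weight (x : Expr) : Expr := cell (bin .add (var 1) x)

/-- The address of an entry of the table. -/
def entry (q : Expr) : Expr := bin .add (bin .add (var 1) (var 0)) q

/-- An entry of the table. -/
def flag (q : Expr) : Expr := cell (entry q)

/-- The digit of the number in register `13` at the vertex `x`. -/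
def digit (x : Expr) : Expr :=
  bin .sub (bin .div (var 13) (weight x))
    (bin .mul (const 4) (bin .div (bin .div (var 13) (weight x)) (const 4)))

end Expr

/-- The memory contains the adjacency matrix of `G` followed by the weights `W`; register `0`
contains `n`, register `1` contains `n * n`. -/
structure Layout {n : ℕ} (G : SimpleGraph (Fin n)) (W : Fin n → ℕ) (v : State) : Prop where
  zero : v.reg 0 = n
  one : v.reg 1 = n * n
  adj : ∀ x y : Fin n, v.mem (x * n + y) ≠ 0 ↔ G.Adj x y
  adj_le : ∀ x y : Fin n, v.mem (x * n + y) ≤ 1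
  weight : ∀ x : Fin n, v.mem (n * n + x) = W x

namespace Layout

variable {n : ℕ} {G : SimpleGraph (Fin n)} {W : Fin n → ℕ} {v : State}

theorem set (h : Layout G W v) {r : ℕ} (hr : 2 ≤ r) (x : ℕ) : Layout G W (v.set r x) :=
  ⟨by rw [State.set_reg, if_neg (by omega), h.zero],
    by rw [State.set_reg, if_neg (by omega), h.one], h.adj, h.adj_le, h.weight⟩

theorem put (h : Layout G W v) {a : ℕ} (ha : n * n + n ≤ a) (x : ℕ) : Layout G W (v.put a x) := by
  have h1 : ∀ x y : Fin n, (x : ℕ) * n + y < n * n := fun x y => by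
    have h2 := Nat.mul_le_mul_right n (show (x : ℕ) + 1 ≤ n from x.2)
    have := y.2
    rw [add_one_mul] at h2
    omega
  refine ⟨h.zero, h.one, fun x y => ?_, fun x y => ?_, fun x => ?_⟩
  · have := h1 x y
    rw [State.put_mem, if_neg (by omega)]; exact h.adj x y
  · have := h1 x y
    rw [State.put_mem, if_neg (by omega)]; exact h.adj_le x y
  · rw [State.put_mem, if_neg (by omega)]; exact h.weight x

theorem eval_sum (h : Layout G W v) (r : ℕ) (e : Expr) :
    (Expr.sum r e).eval v = ∑ x : Fin n, e.eval (v.set r x) := by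
  rw [Expr.eval, h.zero, Finset.sum_range]

theorem sum_ne_zero (h : Layout G W v) (r : ℕ) (e : Expr) :
    (Expr.sum r e).eval v ≠ 0 ↔ ∃ x : Fin n, e.eval (v.set r x) ≠ 0 := by
  simp [h.eval_sum]

theorem adj_ne_zero (h : Layout G W v) {r r' : ℕ} {x y : Fin n} (hx : v.reg r = x)
    (hy : v.reg r' = y) : (Expr.adj (.var r) (.var r')).eval v ≠ 0 ↔ G.Adj x y := by
  simp only [Expr.adj, Expr.eval_cell, Expr.eval_add, Expr.eval_mul, Expr.eval_var, hx, hy, h.zero]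
  exact h.adj x y

theorem eval_adj (h : Layout G W v) {r r' : ℕ} {x y : Fin n} (hx : v.reg r = x)
    (hy : v.reg r' = y) [Decidable (G.Adj x y)] :
    (Expr.adj (.var r) (.var r')).eval v = if G.Adj x y then 1 else 0 := by
  have h1 := h.adj_ne_zero hx hy
  have h2 : (Expr.adj (.var r) (.var r')).eval v ≤ 1 := by
    simp only [Expr.adj, Expr.eval_cell, Expr.eval_add, Expr.eval_mul, Expr.eval_var, hx, hy,
      h.zero]
    exact h.adj_le x y
  split_ifs with h3
  · have := h1.2 h3; omega
  · by_contra h4; exact h3 (h1.1 h4)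

theorem eval_weight (h : Layout G W v) {r : ℕ} {x : Fin n} (hx : v.reg r = x) :
    (Expr.weight (.var r)).eval v = W x := by
  simp only [Expr.weight, Expr.eval_cell, Expr.eval_add, Expr.eval_var, hx, h.one]
  exact h.weight x

theorem eval_digit (h : Layout G W v) {r q : ℕ} {x : Fin n} (hx : v.reg r = x)
    (hq : v.reg 13 = q) : (Expr.digit (.var r)).eval v = _root_.digit W q x := by
  simp only [Expr.digit, Expr.eval_sub, Expr.eval_div, Expr.eval_mul, Expr.eval_const,
    Expr.eval_var, h.eval_weight hx, hq, _root_.digit]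
  omega

theorem eval_entry (h : Layout G W v) (e : Expr) :
    (Expr.entry e).eval v = n * n + n + e.eval v := by
  simp only [Expr.entry, Expr.eval_add, Expr.eval_var, h.zero, h.one]

theorem eval_flag (h : Layout G W v) (e : Expr) :
    (Expr.flag e).eval v = v.mem (n * n + n + e.eval v) := by
  rw [Expr.flag, Expr.eval_cell, h.eval_entry]

end Layout

namespace Expr

/-- Is the vertex in register `20` outside of the vertex cover, with two neighbors with different
digits other than `3`? -/
def isCrossing : Expr :=
  and (neg (weight (var 20))) (neg (neg (sum 21 (sum 22 (and (adj (var 20) (var 21))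
    (and (adj (var 20) (var 22)) (and (neg (eq (digit (var 21)) (digit (var 22))))
      (and (neg (eq (digit (var 21)) (const 3))) (neg (eq (digit (var 22)) (const 3)))))))))))

/-- The size of the bag for the digits of the number in register `13`. -/
def bagSize : Expr := bin .add (sum 20 (eq (digit (var 20)) (const 3))) (sum 20 isCrossing)

/-- The degree of the vertex in register `20`. -/
def degree : Expr := sum 21 (adj (var 20) (var 21))

/-- Can the vertex in register `14` be introduced? -/
def canIntro : Expr :=
  and (flag (var 13)) (and (weight (var 14)) (and (eq (digit (var 14)) (const 0))
    (le bagSize (var 11))))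

/-- Has the vertex in register `14` a neighbor in the vertex cover with digit `0`? -/
def hasOpen : Expr :=
  sum 21 (and (adj (var 14) (var 21)) (and (weight (var 21)) (eq (digit (var 21)) (const 0))))

/-- Is there a neighbor outside of the vertex cover of the vertex in register `14`, of large
degree, with all other neighbors of digit `3`? -/
def hasLarge : Expr :=
  sum 20 (and (adj (var 20) (var 14)) (and (neg (weight (var 20))) (and (neg (le degree (var 11)))
    (neg (sum 21 (and (adj (var 20) (var 21)) (and (neg (eq (var 21) (var 14)))
      (neg (eq (digit (var 21)) (const 3))))))))))

/-- Can the vertex in register `14` be forgotten? -/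
def canForget : Expr :=
  and (flag (bin .add (var 13) (bin .mul (const 2) (weight (var 14)))))
    (and (eq (digit (var 14)) (const 1)) (and (le bagSize (var 11))
      (and (neg hasOpen) (neg hasLarge))))

/-- The number in register `13` with the digits `2` replaced by `0`. -/
def left : Expr := bin .sub (var 13)
  (sum 21 (and (eq (digit (var 21)) (const 2)) (bin .mul (const 2) (weight (var 21)))))

/-- The number in register `13` with the digits `1` replaced by `0` and the digits `2` by `1`. -/
def right : Expr := bin .sub (var 13)
  (sum 21 (and (bin .add (eq (digit (var 21)) (const 1)) (eq (digit (var 21)) (const 2)))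
    (weight (var 21))))

/-- The number in register `13` with the digits `2` replaced by `1`. -/
def union : Expr := bin .sub (var 13)
  (sum 21 (and (eq (digit (var 21)) (const 2)) (weight (var 21))))

/-- Can the partial solutions for `left` and `right` be joined? -/
def canJoin : Expr :=
  and (flag left) (and (flag right) (le bagSize (bin .add (var 11) (const 1))))

end Expr

namespace Layout

variable {n k q w : ℕ} {G : SimpleGraph (Fin n)} {W : Fin n → ℕ} {v : State} {C : Finset (Fin n)}

theorem weight_ne_zero (h : Layout G W v) (hW : IsWeight W C k) {r : ℕ} {x : Fin n}
    (hx : v.reg r = x) : (Expr.weight (.var r)).eval v ≠ 0 ↔ x ∈ C := by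
  rw [h.eval_weight hx, ← hW.weight_pos_iff]
  omega

/-- Of two different digits other than `3`, one is `1` or `2`. The neighbor with this digit is in
`L` or `L'`, and the other neighbor is outside of this set and of `A`. Thus one test serves for
joins and, when the digit `2` does not occur, for the rules with a single `L`. -/
theorem isCrossing_ne_zero (h : Layout G W v) (hW : IsWeight W C k) (hq : v.reg 13 = q)
    {x : Fin n} (hx : v.reg 20 = x) : Expr.isCrossing.eval v ≠ 0 ↔
      x ∈ crossing G C (digitSet W q 1) (digitSet W q 3) ∪
        crossing G C (digitSet W q 2) (digitSet W q 3) := by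
  have key : Expr.isCrossing.eval v ≠ 0 ↔ x ∉ C ∧ ∃ y z : Fin n, G.Adj x y ∧ G.Adj x z ∧
      digit W q y ≠ digit W q z ∧ digit W q y ≠ 3 ∧ digit W q z ≠ 3 := by
    rw [Expr.isCrossing, Expr.and_ne_zero, Expr.neg_ne_zero, h.weight_ne_zero hW hx,
      Expr.neg_ne_zero, Expr.neg_ne_zero, not_not, h.sum_ne_zero]
    refine and_congr_right fun _ => exists_congr fun y => ?_
    rw [(h.set (by norm_num) y).sum_ne_zero]
    refine exists_congr fun z => ?_
    have h1 := (h.set (r := 21) (by norm_num) y).set (r := 22) (by norm_num) z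
    have h20 : ((v.set 21 y).set 22 z).reg 20 = x := by simp [State.set_reg, hx]
    have h21 : ((v.set 21 y).set 22 z).reg 21 = y := by simp [State.set_reg]
    have h22 : ((v.set 21 y).set 22 z).reg 22 = z := by simp [State.set_reg]
    have h13 : ((v.set 21 y).set 22 z).reg 13 = q := by simp [State.set_reg, hq]
    simp only [Expr.and_ne_zero, Expr.neg_ne_zero, Expr.eq_ne_zero, h1.adj_ne_zero h20 h21,
      h1.adj_ne_zero h20 h22, h1.eval_digit h21 h13, h1.eval_digit h22 h13, Expr.eval_const]
  rw [key, Finset.mem_union, CoverDec.mem_crossing, CoverDec.mem_crossing]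
  simp only [Finset.mem_union, mem_digitSet]
  constructor
  · rintro ⟨hxC, y, z, hy, hz, h1, h2, h3⟩
    have := digit_lt (W := W) q y
    have := digit_lt (W := W) q z
    have h4 : digit W q y = 1 ∨ digit W q y = 2 ∨ digit W q z = 1 ∨ digit W q z = 2 := by omega
    rcases h4 with h4 | h4 | h4 | h4
    · exact .inl ⟨hxC, ⟨y, h4, hy⟩, z, hz, by omega⟩
    · exact .inr ⟨hxC, ⟨y, h4, hy⟩, z, hz, by omega⟩
    · exact .inl ⟨hxC, ⟨z, h4, hz⟩, y, hy, by omega⟩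
    · exact .inr ⟨hxC, ⟨z, h4, hz⟩, y, hy, by omega⟩
  · rintro (⟨hxC, ⟨y, h4, hy⟩, z, hz, h5⟩ | ⟨hxC, ⟨y, h4, hy⟩, z, hz, h5⟩) <;>
      exact ⟨hxC, y, z, hy, hz, by omega, by omega, by omega⟩

theorem eval_bagSize (h : Layout G W v) (hW : IsWeight W C k) (hq : v.reg 13 = q) :
    Expr.bagSize.eval v = (digitSet W q 3).card +
      (crossing G C (digitSet W q 1) (digitSet W q 3) ∪
        crossing G C (digitSet W q 2) (digitSet W q 3)).card := by
  rw [Expr.bagSize, Expr.eval_add, h.eval_sum, h.eval_sum]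
  congr 1
  · rw [digitSet, Finset.card_filter]
    refine Finset.sum_congr rfl fun x _ => ?_
    rw [Expr.eval_eq, (h.set (by norm_num) x).eval_digit (x := x) (q := q) (by simp [State.set_reg])
      (by simp [State.set_reg, hq])]
    rfl
  · rw [← Finset.filter_univ_mem (_ ∪ _), Finset.card_filter]
    refine Finset.sum_congr rfl fun x _ => ?_
    have h1 := (h.set (r := 20) (by norm_num) x).isCrossing_ne_zero hW (x := x) (q := q)
      (by simp [State.set_reg, hq]) (by simp [State.set_reg])
    have h2 : Expr.isCrossing.eval (v.set 20 x) ≤ 1 := by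
      simp only [Expr.isCrossing, Expr.and, Expr.eval_mul, Expr.eval_neg]
      split_ifs <;> simp
    split_ifs with h3
    · have := h1.2 h3; omega
    · by_contra h4; exact h3 (h1.1 h4)

theorem canIntro_ne_zero (h : Layout G W v) (hW : IsWeight W C k) (hq : v.reg 13 = q)
    (hw : v.reg 11 = w) {x : Fin n} (hx : v.reg 14 = x) : Expr.canIntro.eval v ≠ 0 ↔
      v.mem (n * n + n + q) ≠ 0 ∧ x ∈ C ∧ digit W q x = 0 ∧ (digitSet W q 3).card +
      (crossing G C (digitSet W q 1) (digitSet W q 3) ∪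
        crossing G C (digitSet W q 2) (digitSet W q 3)).card ≤ w := by
  simp only [Expr.canIntro, Expr.and_ne_zero, h.eval_flag, Expr.eval_var, hq, hw,
    h.weight_ne_zero hW hx, Expr.eq_ne_zero, Expr.le_ne_zero, h.eval_digit hx hq,
    h.eval_bagSize hW hq, Expr.eval_const]

theorem hasOpen_ne_zero (h : Layout G W v) (hW : IsWeight W C k) (hq : v.reg 13 = q)
    {x : Fin n} (hx : v.reg 14 = x) : Expr.hasOpen.eval v ≠ 0 ↔
      ∃ y ∈ C, G.Adj x y ∧ digit W q y = 0 := by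
  rw [Expr.hasOpen, h.sum_ne_zero]
  refine exists_congr fun y => ?_
  have h1 := h.set (r := 21) (by norm_num) y
  have h14 : (v.set 21 y).reg 14 = x := by simp [State.set_reg, hx]
  have h21 : (v.set 21 y).reg 21 = y := by simp [State.set_reg]
  have h13 : (v.set 21 y).reg 13 = q := by simp [State.set_reg, hq]
  simp only [Expr.and_ne_zero, Expr.eq_ne_zero, h1.adj_ne_zero h14 h21, h1.weight_ne_zero hW h21,
    h1.eval_digit h21 h13, Expr.eval_const]
  tauto

theorem hasLarge_ne_zero [DecidableRel G.Adj] (h : Layout G W v) (hW : IsWeight W C k)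
    (hq : v.reg 13 = q) (hw : v.reg 11 = w) {x : Fin n} (hx : v.reg 14 = x) :
    Expr.hasLarge.eval v ≠ 0 ↔ ∃ z, G.Adj z x ∧ z ∉ C ∧ w < G.degree z ∧
      ∀ y, G.Adj z y → y = x ∨ digit W q y = 3 := by
  rw [Expr.hasLarge, h.sum_ne_zero]
  refine exists_congr fun z => ?_
  have h1 := h.set (r := 20) (by norm_num) z
  have h14 : (v.set 20 z).reg 14 = x := by simp [State.set_reg, hx]
  have h20 : (v.set 20 z).reg 20 = z := by simp [State.set_reg]
  have h11 : (v.set 20 z).reg 11 = w := by simp [State.set_reg, hw]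
  have h2 : Expr.degree.eval (v.set 20 z) = G.degree z := by
    rw [Expr.degree, h1.eval_sum, ← G.card_neighborFinset_eq_degree,
      SimpleGraph.neighborFinset_eq_filter, Finset.card_filter]
    refine Finset.sum_congr rfl fun y _ => ?_
    exact (h1.set (r := 21) (by norm_num) y).eval_adj (by simp [State.set_reg])
      (by simp [State.set_reg])
  have h3 : ∀ y : Fin n, Layout G W ((v.set 20 z).set 21 y) := fun y => h1.set (by norm_num) y
  simp only [Expr.and_ne_zero, Expr.neg_ne_zero, Expr.le_ne_zero, h1.adj_ne_zero h20 h14,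
    h1.weight_ne_zero hW h20, h2, Expr.eval_var, h11, h1.sum_ne_zero, Expr.eq_ne_zero, not_le]
  refine and_congr_right fun _ => and_congr_right fun _ => and_congr_right fun _ => ?_
  rw [not_exists]
  refine forall_congr' fun y => ?_
  have h20' : ((v.set 20 z).set 21 y).reg 20 = z := by simp [State.set_reg]
  have h21 : ((v.set 20 z).set 21 y).reg 21 = y := by simp [State.set_reg]
  have h13 : ((v.set 20 z).set 21 y).reg 13 = q := by simp [State.set_reg, hq]
  have h14' : ((v.set 20 z).set 21 y).reg 14 = x := by simp [State.set_reg, hx]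
  rw [(h3 y).adj_ne_zero h20' h21, (h3 y).eval_digit h21 h13, h21, h14', Expr.eval_const,
    Fin.val_inj]
  tauto

theorem canForget_ne_zero [DecidableRel G.Adj] (h : Layout G W v) (hW : IsWeight W C k)
    (hq : v.reg 13 = q) (hw : v.reg 11 = w) {x : Fin n} (hx : v.reg 14 = x) :
    Expr.canForget.eval v ≠ 0 ↔
      v.mem (n * n + n + (q + 2 * W x)) ≠ 0 ∧ digit W q x = 1 ∧ (digitSet W q 3).card +
      (crossing G C (digitSet W q 1) (digitSet W q 3) ∪
        crossing G C (digitSet W q 2) (digitSet W q 3)).card ≤ w ∧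
      (∀ y ∈ C, G.Adj x y → digit W q y ≠ 0) ∧ (∀ z ∉ C, G.Adj z x →
        (∀ y, G.Adj z y → y = x ∨ digit W q y = 3) → G.degree z ≤ w) := by
  simp only [Expr.canForget, Expr.and_ne_zero, h.eval_flag, Expr.eval_add, Expr.eval_mul,
    Expr.eval_var, hq, hw, h.eval_weight hx, Expr.eq_ne_zero, Expr.le_ne_zero, h.eval_digit hx hq,
    h.eval_bagSize hW hq, Expr.eval_const, Expr.neg_ne_zero, h.hasOpen_ne_zero hW hq hx,
    h.hasLarge_ne_zero hW hq hw hx]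
  refine and_congr_right fun _ => and_congr_right fun _ => and_congr_right fun _ => ?_
  push Not
  refine and_congr_right fun _ => forall_congr' fun z => ?_
  constructor
  · intro h h1 h2 h3
    by_contra h4
    obtain ⟨y, hy1, hy2⟩ := h h2 h1 (by omega)
    have := h3 y hy1
    tauto
  · intro h h1 h2 h3
    by_contra h4
    push Not at h4
    have := h h2 h1 fun y hy => by
      have := h4 y hy
      tauto
    omega

theorem eval_left (h : Layout G W v) (hq : v.reg 13 = q) :
    Expr.left.eval v = q - 2 * ∑ y ∈ digitSet W q 2, W y := by
  rw [Expr.left, Expr.eval_sub, Expr.eval_var, hq, h.eval_sum, digitSet, Finset.mul_sum,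
    Finset.sum_filter]
  congr 1
  refine Finset.sum_congr rfl fun y _ => ?_
  have h1 := h.set (r := 21) (by norm_num) y
  have h21 : (v.set 21 y).reg 21 = y := by simp [State.set_reg]
  have h13 : (v.set 21 y).reg 13 = q := by simp [State.set_reg, hq]
  rw [Expr.and, Expr.eval_mul, Expr.eval_eq, h1.eval_digit h21 h13, Expr.eval_mul,
    h1.eval_weight h21, Expr.eval_const, ite_mul, one_mul, zero_mul]

theorem eval_union (h : Layout G W v) (hq : v.reg 13 = q) :
    Expr.union.eval v = q - ∑ y ∈ digitSet W q 2, W y := by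
  rw [Expr.union, Expr.eval_sub, Expr.eval_var, hq, h.eval_sum, digitSet, Finset.sum_filter]
  congr 1
  refine Finset.sum_congr rfl fun y _ => ?_
  have h1 := h.set (r := 21) (by norm_num) y
  have h21 : (v.set 21 y).reg 21 = y := by simp [State.set_reg]
  have h13 : (v.set 21 y).reg 13 = q := by simp [State.set_reg, hq]
  rw [Expr.and, Expr.eval_mul, Expr.eval_eq, h1.eval_digit h21 h13, h1.eval_weight h21,
    Expr.eval_const, ite_mul, one_mul, zero_mul]

theorem eval_right (h : Layout G W v) (hq : v.reg 13 = q) :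
    Expr.right.eval v = q - (∑ y ∈ digitSet W q 1, W y + ∑ y ∈ digitSet W q 2, W y) := by
  rw [Expr.right, Expr.eval_sub, Expr.eval_var, hq, h.eval_sum, digitSet, digitSet,
    Finset.sum_filter, Finset.sum_filter, ← Finset.sum_add_distrib]
  congr 1
  refine Finset.sum_congr rfl fun y _ => ?_
  have h1 := h.set (r := 21) (by norm_num) y
  have h21 : (v.set 21 y).reg 21 = y := by simp [State.set_reg]
  have h13 : (v.set 21 y).reg 13 = q := by simp [State.set_reg, hq]
  rw [Expr.and, Expr.eval_mul, Expr.eval_add, Expr.eval_eq, Expr.eval_eq, h1.eval_digit h21 h13,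
    h1.eval_weight h21, Expr.eval_const, Expr.eval_const, add_mul, ite_mul, ite_mul, one_mul,
    zero_mul]

theorem canJoin_ne_zero (h : Layout G W v) (hW : IsWeight W C k) (hq : v.reg 13 = q)
    (hw : v.reg 11 = w) : Expr.canJoin.eval v ≠ 0 ↔
      v.mem (n * n + n + (q - 2 * ∑ y ∈ digitSet W q 2, W y)) ≠ 0 ∧
      v.mem (n * n + n + (q - (∑ y ∈ digitSet W q 1, W y + ∑ y ∈ digitSet W q 2, W y))) ≠ 0 ∧
      (digitSet W q 3).card +
      (crossing G C (digitSet W q 1) (digitSet W q 3) ∪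
        crossing G C (digitSet W q 2) (digitSet W q 3)).card ≤ w + 1 := by
  simp only [Expr.canJoin, Expr.and_ne_zero, h.eval_flag, h.eval_left hq, h.eval_right hq,
    Expr.le_ne_zero, h.eval_bagSize hW hq, Expr.eval_add, Expr.eval_var, hw, Expr.eval_const]

end Layout

end RAM


/-! ## Filling the table -/

section Table

variable {n k w : ℕ}

/-- The set `L` of forgotten vertices and the trace `A` of the root bag are obtained by the
program when it treats the number `q` and the vertex `x`, from traces of rank at most `r`. -/
def Produced (G : SimpleGraph (Fin n)) (W : Fin n → ℕ) (C : Finset (Fin n)) (w r q : ℕ)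
    (x : Fin n) (L A : Finset (Fin n)) : Prop :=
  (∃ A', CoverDec G w C L A' ∧ 2 * L.card + A'.card ≤ r ∧ q = code W L ∅ A' ∧ A = insert x A' ∧
    x ∈ C ∧ x ∉ L ∧ x ∉ A' ∧ A'.card + (crossing G C L A').card ≤ w) ∨
  -- For forgetting, `q` is the code of the result and not of the source, so that the conditions,
  -- which speak of the new crossing set, can be tested on its digits.
  (∃ L', CoverDec G w C L' (insert x A) ∧ 2 * L'.card + (insert x A).card ≤ r ∧
    q = code W L ∅ A ∧ L = insert x L' ∧ x ∈ C ∧ x ∉ L' ∧ x ∉ A ∧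
    A.card + (crossing G C L A).card ≤ w ∧ (∀ u ∈ C, G.Adj x u → u ∈ L ∪ A) ∧
    (∀ z ∉ C, G.Adj z x → (∀ y, G.Adj z y → y ∈ insert x A) → {y | G.Adj z y}.ncard ≤ w)) ∨
  ∃ L₁ L₂, CoverDec G w C L₁ A ∧ CoverDec G w C L₂ A ∧ 2 * L₁.card + A.card ≤ r ∧
    2 * L₂.card + A.card ≤ r ∧ q = code W L₁ L₂ A ∧ L = L₁ ∪ L₂ ∧ Disjoint L₁ L₂ ∧
    A.card + (crossing G C L₁ A ∪ crossing G C L₂ A).card ≤ w + 1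

/-- `Produced` expresses the degree by `Set.ncard`, which does not depend on a `Fintype` instance
for the neighbors. -/
theorem ncard_adj_eq_degree (G : SimpleGraph (Fin n)) (z : Fin n) [Fintype (G.neighborSet z)] :
    {y | G.Adj z y}.ncard = G.degree z := by
  rw [← G.card_neighborSet_eq_degree, ← Nat.card_eq_fintype_card, Nat.card_coe_set_eq]
  rfl

/-- Introducing and forgetting raise the rank `2 * L.card + A.card` by exactly one. A join of two
nonempty sets has larger rank than both parts, while a join with an empty set only repeats the other
part. So every trace but the empty one comes from traces of smaller rank. -/
theorem CoverDec.produced {G : SimpleGraph (Fin n)} {W : Fin n → ℕ} {C : Finset (Fin n)}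
    (hn : 1 ≤ n) (hW : IsWeight W C k) {L A : Finset (Fin n)} (h : CoverDec G w C L A) {r : ℕ}
    (hr : 2 * L.card + A.card ≤ r + 1) :
    (L = ∅ ∧ A = ∅) ∨ ∃ q < 4 ^ k, ∃ x, Produced G W C w r q x L A := by
  induction h with
  | empty => exact .inl ⟨rfl, rfl⟩
  | @intro L A v h hC hL hA hc ih =>
    rw [Finset.card_insert_of_notMem hA] at hr
    exact .inr ⟨_, hW.code_lt (by simp) h.subset.2.2 (by simp), v,
      .inl ⟨A, h, by omega, rfl, rfl, hC, hL, hA, hc⟩⟩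
  | @forget L A v h hC hL hA hc hN hI ih =>
    have hd := h.subset.2.2
    rw [Finset.card_insert_of_notMem hL] at hr
    refine .inr ⟨_, hW.code_lt (by simp) (by simp_all) (by simp), v,
      .inr (.inl ⟨L, h, ?_, rfl, rfl, hC, hL, hA, hc, hN, fun z h1 h2 h3 => ?_⟩)⟩
    · rw [Finset.card_insert_of_notMem hA]; omega
    · classical
      rw [ncard_adj_eq_degree]
      convert hI z h1 h2 h3
  | @join L L' A h h' hd hc ih ih' =>
    rw [Finset.card_union_of_disjoint hd] at hr
    rcases L.eq_empty_or_nonempty with rfl | hne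
    · simpa using ih' (by simpa using hr)
    · rcases L'.eq_empty_or_nonempty with rfl | hne'
      · simpa using ih (by simpa using hr)
      · have := hne.card_pos
        have := hne'.card_pos
        -- A join involves no vertex; any value of `x` will do.
        exact .inr ⟨_, hW.code_lt hd h.subset.2.2 h'.subset.2.2, ⟨0, hn⟩,
          .inr (.inr ⟨L, L', h, h', by omega, by omega, rfl, rfl, hd, hc⟩)⟩

/-- All entries of the table that are set are codes of traces. -/
def Sound (G : SimpleGraph (Fin n)) (W : Fin n → ℕ) (C : Finset (Fin n)) (w k : ℕ)
    (m : ℕ → ℕ) : Prop :=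
  ∀ q < 4 ^ k, m (n * n + n + q) ≠ 0 → m (n * n + n + q) = 1 ∧
    ∃ L A, CoverDec G w C L A ∧ q = code W L ∅ A

/-- All entries of the table for traces of rank at most `r` are set. -/
def Full (G : SimpleGraph (Fin n)) (W : Fin n → ℕ) (C : Finset (Fin n)) (w r : ℕ)
    (m : ℕ → ℕ) : Prop :=
  ∀ L A, CoverDec G w C L A → 2 * L.card + A.card ≤ r → m (n * n + n + code W L ∅ A) ≠ 0

/-- The table for `m'` contains that for `m`. -/
def Extends (n k : ℕ) (m m' : ℕ → ℕ) : Prop :=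
  ∀ q < 4 ^ k, m (n * n + n + q) ≠ 0 → m' (n * n + n + q) ≠ 0

theorem Extends.refl (m : ℕ → ℕ) : Extends n k m m := fun _ _ h => h

theorem Extends.trans {m m' m'' : ℕ → ℕ} (h : Extends n k m m') (h' : Extends n k m' m'') :
    Extends n k m m'' := fun q hq hm => h' q hq (h q hq hm)

variable {G : SimpleGraph (Fin n)} {W : Fin n → ℕ} {C : Finset (Fin n)}

theorem CoverDec.code_lt {L A : Finset (Fin n)} (h : CoverDec G w C L A) (hW : IsWeight W C k) :
    code W L ∅ A < 4 ^ k := hW.code_lt (by simp) h.subset.2.2 (by simp)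

theorem CoverDec.digitSet_code {L A : Finset (Fin n)} (h : CoverDec G w C L A)
    (hW : IsWeight W C k) : digitSet W (code W L ∅ A) 1 = L ∧ digitSet W (code W L ∅ A) 2 = ∅ ∧
      digitSet W (code W L ∅ A) 3 = A :=
  hW.digitSet_code (by simp) h.subset.2.2 (by simp) h.subset.1 (by simp) h.subset.2.1

theorem Full.mono {m m' : ℕ → ℕ} {r : ℕ} (h : Full G W C w r m) (hW : IsWeight W C k)
    (hm : Extends n k m m') : Full G W C w r m' := fun L A hLA hr =>
  hm _ (hLA.code_lt hW) (h L A hLA hr)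

/-- Disjoint subsets of `C` can be read off from their code, so the trace that soundness provides
for this entry is the given one. -/
theorem Sound.coverDec {m : ℕ → ℕ} (h : Sound G W C w k m) (hW : IsWeight W C k)
    {L A : Finset (Fin n)} (hLA : Disjoint L A) (hL : L ⊆ C) (hA : A ⊆ C)
    (hm : m (n * n + n + code W L ∅ A) ≠ 0) : CoverDec G w C L A := by
  obtain ⟨-, L', A', h', hc⟩ := h _ (hW.code_lt (by simp) hLA (by simp)) hm
  obtain ⟨h1, -, h3⟩ := hW.digitSet_code (L' := ∅) (by simp) hLA (by simp) hL (by simp) hA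
  obtain ⟨h1', -, h3'⟩ := h'.digitSet_code hW
  rw [hc] at h1 h3
  rw [← h1, ← h3, h1', h3']
  exact h'

end Table

/-! ### Correctness of one application of the rules -/

namespace RAM

variable {n k w : ℕ} {G : SimpleGraph (Fin n)} {W : Fin n → ℕ} {C : Finset (Fin n)}

/-- Set an entry of the table if a condition holds. -/
def setIf (e t : Expr) : Stmt := .cond e (.store (.entry t) (.const 1))

theorem tri_setIf {Y : ℕ} (hY : 1 ≤ Y) {e t : Expr} {v : State} (hv : Layout G W v)
    (hs : Sound G W C w k v.mem)
    (ht : e.eval v ≠ 0 → ∃ L A, CoverDec G w C L A ∧ t.eval v = code W L ∅ A) :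
    Tri Y (setIf e t) v 2 fun v' => v'.reg = v.reg ∧ Layout G W v' ∧ Sound G W C w k v'.mem ∧
      Extends n k v.mem v'.mem ∧ (e.eval v ≠ 0 → v'.mem (n * n + n + t.eval v) ≠ 0) := by
  refine Tri.cond (t := 1) (fun he => Tri.store ?_ ?_) fun he => ?_
  · simpa using Nat.one_lt_two_pow (by omega)
  · rw [hv.eval_entry]
    refine ⟨rfl, hv.put (by omega) _, fun q hq hm => ?_, fun q hq hm => ?_, fun _ => ?_⟩
    · rw [State.put_mem] at hm ⊢
      split_ifs at hm ⊢ with h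
      · obtain ⟨L, A, h1, h2⟩ := ht he
        exact ⟨by simp, L, A, h1, by omega⟩
      · exact hs q hq hm
    · rw [State.put_mem]
      split_ifs
      · simp
      · exact hm
    · rw [State.put_mem, if_pos rfl]; simp
  · exact ⟨rfl, hv, hs, Extends.refl _, fun h => (h he).elim⟩

/-- The loop body that applies all rules. -/
def applyRules : Stmt :=
  .seq (setIf .canIntro (.bin .add (.var 13) (.bin .mul (.const 3) (.weight (.var 14)))))
    (.seq (setIf .canForget (.var 13)) (setIf .canJoin .union))

/-- The number `q` is read as a triple `L`, `L'`, `A` given by the digits `1`, `2`, `3`. Each rule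
sets an entry only when its conditions hold, which keeps the table sound, and entries are never
cleared, so updating in place does no harm to later rules. -/
theorem tri_applyRules [DecidableRel G.Adj] {Y : ℕ} (hY : 1 ≤ Y) {v : State} (hv : Layout G W v)
    (hW : IsWeight W C k) (hs : Sound G W C w k v.mem) {q : ℕ} (hq : v.reg 13 = q)
    (hqk : q < 4 ^ k) (hw : v.reg 11 = w) {x : Fin n} (hx : v.reg 14 = x) :
    Tri Y applyRules v 6 fun v' => v'.reg = v.reg ∧ Layout G W v' ∧ Sound G W C w k v'.mem ∧
      Extends n k v.mem v'.mem ∧ ∀ r, Full G W C w r v.mem → ∀ L A, Produced G W C w r q x L A →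
        v'.mem (n * n + n + code W L ∅ A) ≠ 0 := by
  have hcode := hW.code_digitSet hqk
  have hd12 := IsWeight.disjoint_digitSet (W := W) q (i := 1) (j := 2) (by norm_num)
  have hd13 := IsWeight.disjoint_digitSet (W := W) q (i := 1) (j := 3) (by norm_num)
  have hd23 := IsWeight.disjoint_digitSet (W := W) q (i := 2) (j := 3) (by norm_num)
  have hs1 := hW.digitSet_subset (q := q) (i := 1) (by norm_num)
  have hs2 := hW.digitSet_subset (q := q) (i := 2) (by norm_num)
  have hs3 := hW.digitSet_subset (q := q) (i := 3) (by norm_num)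
  have hcross : ∀ A, crossing G C ∅ A = ∅ := by intro A; ext; simp [CoverDec.mem_crossing]
  unfold applyRules
  refine Tri.seq (t := 2) (t' := 4) ?_
  refine (tri_setIf hY hv hs fun he => ?_).mono le_rfl ?_
  · rw [hv.canIntro_ne_zero hW hq hw hx] at he
    obtain ⟨h1, h2, h3, h4⟩ := he
    obtain ⟨-, L, A, h5, h6⟩ := hs q hqk h1
    obtain ⟨h7, h8, h9⟩ := h5.digitSet_code hW
    rw [← h6] at h7 h8 h9
    rw [h7, h8, h9, hcross, Finset.union_empty] at h4
    have hxL : x ∉ L := by rw [← h7, mem_digitSet]; omega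
    have hxA : x ∉ A := by rw [← h9, mem_digitSet]; omega
    refine ⟨L, _, h5.intro h2 hxL hxA h4, ?_⟩
    simp only [Expr.eval_add, Expr.eval_mul, Expr.eval_var, Expr.eval_const, hv.eval_weight hx, hq]
    rw [h6, code, code, Finset.sum_insert hxA]
    ring
  rintro v₁ ⟨hr1, hv1, hs1', hm1, hp1⟩
  have hq1 : v₁.reg 13 = q := by rw [hr1, hq]
  have hw1 : v₁.reg 11 = w := by rw [hr1, hw]
  have hx1 : v₁.reg 14 = x := by rw [hr1, hx]
  refine Tri.seq (t := 2) (t' := 2) ?_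
  refine (tri_setIf hY hv1 hs1' fun he => ?_).mono le_rfl ?_
  · rw [hv1.canForget_ne_zero hW hq1 hw1 hx1] at he
    obtain ⟨h1, h2, h3, h4, h5⟩ := he
    have hx1' : x ∈ digitSet W q 1 := mem_digitSet.2 h2
    have hx2' : x ∉ digitSet W q 2 := by rw [mem_digitSet]; omega
    have hx3' : x ∉ digitSet W q 3 := by rw [mem_digitSet]; omega
    have hxC := hs1 hx1'
    have hpos := (hW.weight_pos_iff x).2 hxC
    -- Adding twice the weight changes the digit of `x` from `1` (forgotten) to `3` (in the bag):
    -- this is the code of the trace before `x` is forgotten.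
    have he : q + 2 * W x = code W ((digitSet W q 1).erase x) (digitSet W q 2)
        (insert x (digitSet W q 3)) := by
      rw [code, Finset.sum_insert hx3']
      rw [code] at hcode
      have := Finset.add_sum_erase _ W hx1'
      omega
    have hd12' := hd12.mono_left (Finset.erase_subset x _)
    have hd13' : Disjoint ((digitSet W q 1).erase x) (insert x (digitSet W q 3)) := by
      rw [Finset.disjoint_insert_right]
      exact ⟨by simp, hd13.mono_left (Finset.erase_subset x _)⟩
    have hd23' : Disjoint (digitSet W q 2) (insert x (digitSet W q 3)) := by
      rw [Finset.disjoint_insert_right]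
      exact ⟨hx2', hd23⟩
    have hlt := hW.code_lt hd12' hd13' hd23'
    obtain ⟨-, L, A, h6, h7⟩ := hs1' (q + 2 * W x) (by rw [he]; exact hlt) h1
    obtain ⟨h8, h9, h10⟩ := h6.digitSet_code hW
    obtain ⟨h8', h9', h10'⟩ := hW.digitSet_code hd12' hd13' hd23'
      ((Finset.erase_subset _ _).trans hs1) hs2 (Finset.insert_subset hxC hs3)
    rw [← h7, he] at h8 h9 h10
    rw [h8'] at h8
    rw [h9'] at h9
    rw [h10'] at h10
    rw [← h8, ← h10] at h6
    -- The source entry is set, so it codes a pair, and therefore the digit `2` does not occur in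
    -- `q`.
    rw [h9, hcross, Finset.union_empty] at h3
    have h11 := CoverDec.forget h6 hxC (by simp) hx3'
      (by rwa [Finset.insert_erase hx1']) (by
        rw [Finset.insert_erase hx1']
        intro u hu hxu
        have h12 := h4 u hu hxu
        have h13 := digit_lt (W := W) q u
        have h14 : u ∉ digitSet W q 2 := by rw [h9]; simp
        rw [mem_digitSet] at h14
        rw [Finset.mem_union, mem_digitSet, mem_digitSet]
        omega) (by
        intro z hz hzx hall
        have := h5 z hz hzx fun y hy => by
          have := hall y hy
          rwa [Finset.mem_insert, mem_digitSet] at this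
        convert this)
    rw [Finset.insert_erase hx1'] at h11
    exact ⟨_, _, h11, by rw [Expr.eval_var, hq1, ← h9, hcode]⟩
  rintro v₂ ⟨hr2, hv2, hs2', hm2, hp2⟩
  have hq2 : v₂.reg 13 = q := by rw [hr2, hq1]
  have hw2 : v₂.reg 11 = w := by rw [hr2, hw1]
  have hleft : q - 2 * ∑ y ∈ digitSet W q 2, W y = code W (digitSet W q 1) ∅ (digitSet W q 3) := by
    rw [code] at hcode ⊢
    simp only [Finset.sum_empty]
    omega
  have hright : q - (∑ y ∈ digitSet W q 1, W y + ∑ y ∈ digitSet W q 2, W y) =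
      code W (digitSet W q 2) ∅ (digitSet W q 3) := by
    rw [code] at hcode ⊢
    simp only [Finset.sum_empty]
    omega
  have hunion : Expr.union.eval v₂ =
      code W (digitSet W q 1 ∪ digitSet W q 2) ∅ (digitSet W q 3) := by
    rw [hv2.eval_union hq2]
    rw [code] at hcode ⊢
    simp only [Finset.sum_empty, Finset.sum_union hd12]
    omega
  refine (tri_setIf hY hv2 hs2' fun he => ?_).mono le_rfl ?_
  · rw [hv2.canJoin_ne_zero hW hq2 hw2, hleft, hright] at he
    obtain ⟨h1, h2, h3⟩ := he
    exact ⟨_, _, .join (hs2'.coverDec hW hd13 hs1 hs3 h1) (hs2'.coverDec hW hd23 hs2 hs3 h2) hd12 h3,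
      hunion⟩
  rintro v₃ ⟨hr3, hv3, hs3', hm3, hp3⟩
  refine ⟨by rw [hr3, hr2, hr1], hv3, hs3', (hm1.trans hm2).trans hm3, ?_⟩
  rintro r hfull L A (⟨A', h1, h2, rfl, rfl, h4, h5, h6, h7⟩ |
    ⟨L', h1, h2, rfl, rfl, h4, h5, h6, h7, h8, h9⟩ | ⟨L₁, L₂, h1, h2, h3, h4, rfl, rfl, h6, h7⟩)
  · obtain ⟨h8, h9, h10⟩ := h1.digitSet_code hW
    have h11 := h1.intro h4 h5 h6 h7
    refine hm3 _ (h11.code_lt hW) (hm2 _ (h11.code_lt hW) ?_)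
    have h12 := hp1 ((hv.canIntro_ne_zero hW hq hw hx).2 ⟨hfull _ _ h1 h2, h4, ?_, ?_⟩)
    · convert h12 using 3
      simp only [Expr.eval_add, Expr.eval_mul, Expr.eval_var, Expr.eval_const, hv.eval_weight hx, hq]
      rw [code, code, Finset.sum_insert h6]
      ring
    · have h13 : x ∉ digitSet W (code W L ∅ A') 1 := by rwa [h8]
      have h14 : x ∉ digitSet W (code W L ∅ A') 2 := by rw [h9]; simp
      have h15 : x ∉ digitSet W (code W L ∅ A') 3 := by rwa [h10]
      have := digit_lt (W := W) (code W L ∅ A') x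
      rw [mem_digitSet] at h13 h14 h15
      omega
    · rwa [h8, h9, h10, hcross, Finset.union_empty]
  · have h11 := h1.forget h4 h5 h6 h7 h8 fun z hz1 hz2 hz3 => by
      have := h9 z hz1 hz2 hz3
      classical
      rw [ncard_adj_eq_degree] at this
      convert this
    obtain ⟨h12, h13, h14⟩ := h11.digitSet_code hW
    refine hm3 _ (h11.code_lt hW) ?_
    have h15 := hp2 ((hv1.canForget_ne_zero hW hq1 hw1 hx1).2 ⟨?_, ?_, ?_, ?_, ?_⟩)
    · simpa only [Expr.eval_var, hq1] using h15
    · have h16 := hm1 _ (h1.code_lt hW) (hfull _ _ h1 h2)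
      convert h16 using 3
      rw [code, code, Finset.sum_insert h6, Finset.sum_insert h5]
      ring
    · rw [← mem_digitSet, h12]; simp
    · rwa [h12, h13, h14, hcross, Finset.union_empty]
    · intro y hy hxy h16
      rcases Finset.mem_union.1 (h8 y hy hxy) with h | h
      · rw [← h12, mem_digitSet] at h
        omega
      · have h17 : y ∈ digitSet W (code W (insert x L') ∅ A) 3 := by rwa [h14]
        rw [mem_digitSet] at h17
        omega
    · intro z hz1 hz2 hz3
      rw [← ncard_adj_eq_degree]
      refine h9 z hz1 hz2 fun y hy => ?_
      have := hz3 y hy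
      rw [← mem_digitSet, h14] at this
      exact Finset.mem_insert.2 this
  · obtain ⟨h8, h9, h10⟩ := hW.digitSet_code h6 h1.subset.2.2 h2.subset.2.2 h1.subset.1 h2.subset.1
      h1.subset.2.1
    have h15 := hp3 ((hv2.canJoin_ne_zero hW hq2 hw2).2 ⟨?_, ?_, ?_⟩)
    · rw [hunion, h8, h9, h10] at h15
      exact h15
    · rw [hleft, h8, h10]
      exact hm2 _ (h1.code_lt hW) (hm1 _ (h1.code_lt hW) (hfull _ _ h1 h3))
    · rw [hright, h9, h10]
      exact hm2 _ (h2.code_lt hW) (hm1 _ (h2.code_lt hW) (hfull _ _ h2 h4))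
    · rwa [h8, h9, h10]

end RAM


/-! ### The loops that fill the table -/

namespace RAM

variable {n k w Y : ℕ} {G : SimpleGraph (Fin n)} {W : Fin n → ℕ} {C : Finset (Fin n)}

/-- The states have the same registers, with the exception of those in `l`. -/
def SameRegs (l : List ℕ) (v v' : State) : Prop := ∀ r, r ∉ l → v'.reg r = v.reg r

theorem SameRegs.set {l : List ℕ} {v v' : State} (h : SameRegs l v v') {r : ℕ} (hr : r ∈ l)
    (x : ℕ) : SameRegs l v (v'.set r x) := fun r' hr' => by
  rw [State.set_reg, if_neg (by rintro rfl; exact hr' hr), h r' hr']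

theorem SameRegs.trans {l l' : List ℕ} {v v' v'' : State} (h : SameRegs l v v')
    (h' : SameRegs l' v' v'') (hl : l' ⊆ l) : SameRegs l v v'' := fun r hr => by
  rw [h' r fun hr' => hr (hl hr'), h r hr]

theorem SameRegs.refl (l : List ℕ) (v : State) : SameRegs l v v := fun _ _ => rfl

theorem SameRegs.of_eq {l : List ℕ} {v v' : State} (h : v'.reg = v.reg) : SameRegs l v v' :=
  fun r _ => by rw [h]

/-- Apply the rules for one number and all vertices. -/
def vertexLoop : Stmt := .loop 14 0 applyRules

theorem tri_vertexLoop [DecidableRel G.Adj] (hY : 1 ≤ Y) {v : State} (hv : Layout G W v)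
    (hW : IsWeight W C k) (hs : Sound G W C w k v.mem) {q : ℕ} (hq : v.reg 13 = q)
    (hqk : q < 4 ^ k) (hw : v.reg 11 = w) :
    Tri Y vertexLoop v (n * 7 + 1) fun v' => SameRegs [14] v v' ∧ Layout G W v' ∧
      Sound G W C w k v'.mem ∧ Extends n k v.mem v'.mem ∧ ∀ r, Full G W C w r v.mem →
        ∀ x L A, Produced G W C w r q x L A → CoverDec G w C L A →
          v'.mem (n * n + n + code W L ∅ A) ≠ 0 := by
  refine Tri.loop n (fun i v' => SameRegs [14] v v' ∧ Layout G W v' ∧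
      Sound G W C w k v'.mem ∧ Extends n k v.mem v'.mem ∧ ∀ r, Full G W C w r v.mem →
        ∀ x : Fin n, (x : ℕ) < i → ∀ L A, Produced G W C w r q x L A →
          CoverDec G w C L A → v'.mem (n * n + n + code W L ∅ A) ≠ 0) ?_ ?_ ?_ ?_
  · simp [State.set_reg, hv.zero]
  · exact ⟨(SameRegs.refl _ _).set (by simp) _, hv.set (by norm_num) _, hs, Extends.refl _,
      fun _ _ _ h => absurd h (by omega)⟩
  · rintro i hi u hu14 hu0 ⟨h1, h2, h3, h4, h5⟩
    refine (tri_applyRules hY h2 hW h3 (q := q) (x := ⟨i, hi⟩) ?_ hqk ?_ hu14).mono le_rfl ?_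
    · rw [h1 13 (by simp), hq]
    · rw [h1 11 (by simp), hw]
    rintro u' ⟨h6, h7, h8, h9, h10⟩
    refine ⟨by rw [h6, hu14], ?_, (h1.trans (.of_eq h6) (List.Subset.refl _)).set (by simp) _,
      h7.set (by norm_num) _, h8, h4.trans h9, ?_⟩
    · simp [State.set_reg, h6, hu0]
    · intro r hr x hx L A hp hLA
      rcases Nat.lt_succ_iff_lt_or_eq.1 hx with hx | hx
      · exact h9 _ (hLA.code_lt hW) (h5 r hr x hx L A hp hLA)
      · have : x = ⟨i, hi⟩ := Fin.ext hx
        subst this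
        exact h10 r (hr.mono hW h4) L A hp
  · rintro u ⟨h1, h2, h3, h4, h5⟩
    exact ⟨h1, h2, h3, h4, fun r hr x L A hp hLA => h5 r hr x x.2 L A hp hLA⟩

/-- Apply the rules for all numbers and all vertices. -/
def numberLoop : Stmt := .loop 13 2 vertexLoop

/-- One pass over all numbers and vertices completes one more rank, because each trace of rank `r +
1` is produced from traces of rank at most `r` (`CoverDec.produced`). The empty trace is produced by
no rule, hence the separate hypothesis on the entry for the code `0`. -/
theorem tri_numberLoop [DecidableRel G.Adj] (hY : 1 ≤ Y) (hn : 1 ≤ n) {v : State}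
    (hv : Layout G W v) (hW : IsWeight W C k) (hs : Sound G W C w k v.mem) (hp : v.reg 2 = 4 ^ k)
    (hw : v.reg 11 = w) {r : ℕ} (hr : Full G W C w r v.mem)
    (h0 : v.mem (n * n + n) ≠ 0) :
    Tri Y numberLoop v (4 ^ k * (n * 7 + 2) + 1) fun v' => SameRegs [13, 14] v v' ∧
      Layout G W v' ∧ Sound G W C w k v'.mem ∧ Full G W C w (r + 1) v'.mem ∧
      v'.mem (n * n + n) ≠ 0 := by
  refine Tri.loop (4 ^ k) (fun i v' => SameRegs [13, 14] v v' ∧ Layout G W v' ∧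
      Sound G W C w k v'.mem ∧ Extends n k v.mem v'.mem ∧ ∀ q < i, ∀ x L A,
        Produced G W C w r q x L A → CoverDec G w C L A →
          v'.mem (n * n + n + code W L ∅ A) ≠ 0) ?_ ?_ ?_ ?_
  · simp [State.set_reg, hp]
  · exact ⟨(SameRegs.refl _ _).set (by simp) _, hv.set (by norm_num) _, hs, Extends.refl _,
      fun _ h => absurd h (by omega)⟩
  · rintro i hi u hu13 hu2 ⟨h1, h2, h3, h4, h5⟩
    refine (tri_vertexLoop hY h2 hW h3 hu13 hi ?_).mono le_rfl ?_
    · rw [h1 11 (by simp), hw]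
    rintro u' ⟨h6, h7, h8, h9, h10⟩
    refine ⟨by rw [h6 13 (by simp), hu13], ?_, (h1.trans h6 (by simp)).set (by simp) _,
      h7.set (by norm_num) _, h8, h4.trans h9, ?_⟩
    · simp [State.set_reg, h6 2 (by simp), hu2]
    · intro q hq x L A hp hLA
      rcases Nat.lt_succ_iff_lt_or_eq.1 hq with hq | rfl
      · exact h9 _ (hLA.code_lt hW) (h5 q hq x L A hp hLA)
      · exact h10 r (hr.mono hW h4) x L A hp hLA
  · rintro u ⟨h1, h2, h3, h4, h5⟩
    have h0' : u.mem (n * n + n) ≠ 0 := h4 0 (by positivity) h0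
    refine ⟨h1, h2, h3, fun L A hLA hr => ?_, h0'⟩
    rcases hLA.produced hn hW hr with ⟨rfl, rfl⟩ | ⟨q, hq, x, hp⟩
    · simpa [code] using h0'
    · exact h5 q hq x L A hp hLA

/-- Compute the table for the width in register `11`. -/
def fillTable : Stmt :=
  .seq (.loop 13 2 (.store (.entry (.var 13)) (.const 0)))
    (.seq (.store (.entry (.const 0)) (.const 1)) (.loop 15 16 numberLoop))

/-- The start is the table with only the empty trace, the one trace of rank `0`. The complete trace
has rank `2 * C.card`, which is at most `2 * n`, so it is reached after `2 * n` passes. -/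
theorem tri_fillTable [DecidableRel G.Adj] (hY : 1 ≤ Y) (hn : 1 ≤ n) {v : State}
    (hv : Layout G W v) (hW : IsWeight W C k) (hp : v.reg 2 = 4 ^ k) (hw : v.reg 11 = w)
    (hl : v.reg 16 = 2 * n) :
    Tri Y fillTable v ((4 ^ k * 2 + 1) + (1 + (2 * n * (4 ^ k * (n * 7 + 2) + 2) + 1)))
      fun v' => SameRegs [13, 14, 15] v v' ∧ Layout G W v' ∧
        (v'.mem (n * n + n + code W C ∅ ∅) = 1 ∧ CoverDec G w C C ∅ ∨
          v'.mem (n * n + n + code W C ∅ ∅) = 0 ∧ ¬ CoverDec G w C C ∅) := by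
  refine Tri.seq ?_
  refine Tri.mono (t := 4 ^ k * 2 + 1) (Q := fun v' => SameRegs [13] v v' ∧ Layout G W v' ∧
    ∀ q < 4 ^ k, v'.mem (n * n + n + q) = 0) (Tri.loop (4 ^ k) (fun i v' => SameRegs [13] v v' ∧
      Layout G W v' ∧ ∀ q < i, v'.mem (n * n + n + q) = 0) ?_ ?_ ?_ (fun _ h => h)) le_rfl ?_
  · simp [State.set_reg, hp]
  · exact ⟨(SameRegs.refl _ _).set (by simp) _, hv.set (by norm_num) _,
      fun _ h => absurd h (by omega)⟩
  · rintro i hi u hu13 hu2 ⟨h1, h2, h3⟩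
    refine Tri.store (by simp) ?_
    rw [h2.eval_entry, Expr.eval_var, hu13]
    refine ⟨hu13, by simp [State.set_reg, hu2], ?_, (h2.put (by omega) _).set (by norm_num) _, ?_⟩
    · exact SameRegs.set (by exact h1) (by simp) _
    · intro q hq
      rw [State.set_mem, State.put_mem]
      split_ifs with h
      · rfl
      · exact h3 q (by omega)
  rintro v₁ ⟨h1, h2, h3⟩
  refine Tri.seq (t := 1) (Tri.store (by simpa using Nat.one_lt_two_pow (by omega)) ?_)
  rw [h2.eval_entry, Expr.eval_const, Expr.eval_const]
  set v₂ := v₁.put (n * n + n + 0) 1 with hv₂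
  have hreg : v₂.reg = v₁.reg := rfl
  have hmem : ∀ q < 4 ^ k, v₂.mem (n * n + n + q) = if q = 0 then 1 else 0 := by
    intro q hq
    rw [hv₂, State.put_mem]
    split_ifs with h h' h'
    · rfl
    · omega
    · omega
    · exact h3 q hq
  have h0 : v₂.mem (n * n + n) ≠ 0 := by
    have := hmem 0 (by positivity)
    simp at this
    omega
  refine Tri.loop (2 * n) (fun i v' => SameRegs [13, 14, 15] v v' ∧ Layout G W v' ∧
      Sound G W C w k v'.mem ∧ Full G W C w i v'.mem ∧ v'.mem (n * n + n) ≠ 0) ?_ ?_ ?_ ?_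
  · simp [State.set_reg, hreg, h1 16, hl]
  · refine ⟨SameRegs.set (fun r hr => ?_) (by simp) _,
      (h2.put (by omega) _).set (by norm_num) _, ?_, ?_, h0⟩
    · rw [hreg]; exact h1 r (by simp at hr ⊢; tauto)
    · intro q hq hm
      rw [State.set_mem, hmem q hq] at hm ⊢
      split_ifs at hm ⊢ with h
      · exact ⟨rfl, ∅, ∅, .empty, by simp [code, h]⟩
      · exact (hm rfl).elim
    · intro L A hLA hr
      have hL : L = ∅ := Finset.card_eq_zero.1 (by omega)
      have hA : A = ∅ := Finset.card_eq_zero.1 (by omega)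
      subst hL hA
      simpa [code] using h0
  · rintro i hi u hu15 hu16 ⟨h4, h5, h6, h7, h8⟩
    refine (tri_numberLoop hY hn h5 hW h6 (by rw [h4 2 (by simp), hp])
      (by rw [h4 11 (by simp), hw]) h7 h8).mono le_rfl ?_
    rintro u' ⟨h9, h10, h11, h12, h13⟩
    refine ⟨by rw [h9 15 (by simp), hu15], ?_, (h4.trans h9 (by simp)).set (by simp) _,
      h10.set (by norm_num) _, h11, h12, h13⟩
    simp [State.set_reg, h9 16 (by simp), hu16]
  · rintro u ⟨h4, h5, h6, h7, h8⟩
    refine ⟨h4, h5, ?_⟩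
    have hlt : code W C ∅ ∅ < 4 ^ k := hW.code_lt (by simp) (by simp) (by simp)
    by_cases hm : u.mem (n * n + n + code W C ∅ ∅) = 0
    · refine .inr ⟨hm, fun hC => h7 C ∅ hC ?_ hm⟩
      have := Finset.card_le_univ C
      simp at this ⊢
      omega
    · exact .inl ⟨(h6 _ hlt hm).1, h6.coverDec hW (by simp) (Finset.Subset.refl _) (by simp) hm⟩

end RAM


/-! ## Finding a vertex cover -/

section Pick

variable {n : ℕ}

/-- The weights for a list of vertices. -/
def listWeight (l : List (Fin n)) (y : Fin n) : ℕ := if y ∈ l then 4 ^ l.idxOf y else 0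

theorem listWeight_append {l : List (Fin n)} {u : Fin n} (hu : u ∉ l) :
    listWeight (l ++ [u]) = Function.update (listWeight l) u (4 ^ l.length) := by
  ext y
  rw [Function.update_apply]
  rcases eq_or_ne y u with rfl | hne
  · simp [listWeight, List.idxOf_append, hu]
  · by_cases hy : y ∈ l <;> simp [listWeight, List.idxOf_append, hy, hne]

theorem isWeight_listWeight {l : List (Fin n)} (hl : l.Nodup) :
    IsWeight (listWeight l) l.toFinset l.length := by
  refine ⟨l.get, List.nodup_iff_injective_get.1 hl, fun j => ?_, fun y hy => ?_, fun y => ?_⟩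
  · rw [listWeight, if_pos (List.get_mem l j)]
    congr 1
    exact hl.idxOf_getElem j j.2
  · rw [listWeight, if_neg]
    rwa [Set.range_list_get] at hy
  · rw [Set.range_list_get]; simp

theorem pair_lt (x y : Fin n) : (x : ℕ) * n + y < n * n := by
  have h2 := Nat.mul_le_mul_right n (show (x : ℕ) + 1 ≤ n from x.2)
  have := y.2
  rw [add_one_mul] at h2
  omega

variable [NeZero n] (G : SimpleGraph (Fin n))

open Classical in
/-- Run through the first pairs of vertices. For each edge that is not yet covered, put one of its
ends on the list, according to the lowest bit of the number `b`, and drop this bit. -/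
noncomputable def pick (b : ℕ) : ℕ → List (Fin n) × ℕ
  | 0 => ([], b)
  | e + 1 =>
    let s := pick b e
    if G.Adj (Fin.ofNat n (e / n)) (Fin.ofNat n e) ∧ Fin.ofNat n (e / n) ∉ s.1 ∧
        Fin.ofNat n e ∉ s.1 then
      (s.1 ++ [if s.2 % 2 = 1 then Fin.ofNat n (e / n) else Fin.ofNat n e], s.2 / 2)
    else s

theorem pick_succ_of_uncovered {b c e : ℕ} {l : List (Fin n)} (hp : pick G b e = (l, c))
    (h : G.Adj (Fin.ofNat n (e / n)) (Fin.ofNat n e) ∧ Fin.ofNat n (e / n) ∉ l ∧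
      Fin.ofNat n e ∉ l) : pick G b (e + 1) =
        (l ++ [if c % 2 = 1 then Fin.ofNat n (e / n) else Fin.ofNat n e], c / 2) := by
  simp only [pick, hp]
  exact if_pos (by rw [hp]; exact h)

theorem pick_succ_of_covered {b c e : ℕ} {l : List (Fin n)} (hp : pick G b e = (l, c))
    (h : ¬ (G.Adj (Fin.ofNat n (e / n)) (Fin.ofNat n e) ∧ Fin.ofNat n (e / n) ∉ l ∧
      Fin.ofNat n e ∉ l)) : pick G b (e + 1) = (l, c) := by
  simp only [pick, hp]
  exact if_neg (by rw [hp]; exact h)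

theorem pick_nodup (b e : ℕ) : (pick G b e).1.Nodup := by
  induction e with
  | zero => simp [pick]
  | succ e ih =>
    simp only [pick]
    split_ifs with h h'
    · refine List.nodup_append.2 ⟨ih, List.nodup_singleton _, fun a ha b hb => ?_⟩
      rw [List.mem_singleton] at hb
      rintro rfl
      exact h.2.1 (hb ▸ ha)
    · refine List.nodup_append.2 ⟨ih, List.nodup_singleton _, fun a ha b hb => ?_⟩
      rw [List.mem_singleton] at hb
      rintro rfl
      exact h.2.2 (hb ▸ ha)
    · exact ih

theorem pick_length_le (b e : ℕ) : (pick G b e).1.length ≤ n := by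
  simpa using (pick_nodup G b e).length_le_card

theorem pick_covers (b e : ℕ) {e' : ℕ} (he : e' < e)
    (ha : G.Adj (Fin.ofNat n (e' / n)) (Fin.ofNat n e')) :
    Fin.ofNat n (e' / n) ∈ (pick G b e).1 ∨ Fin.ofNat n e' ∈ (pick G b e).1 := by
  induction e with
  | zero => omega
  | succ e ih =>
    rcases Nat.lt_succ_iff_lt_or_eq.1 he with he | rfl
    · have := ih he
      simp only [pick]
      split_ifs <;> simp <;> tauto
    · simp only [pick]
      split_ifs with h
      · simp
      · simp
      · tauto

theorem ofNat_pair (x y : Fin n) : Fin.ofNat n ((x * n + y) / n) = x ∧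
    Fin.ofNat n (x * n + y) = y := by
  have hn : 0 < n := x.pos
  constructor
  · ext
    rw [Fin.val_ofNat, mul_comm, Nat.mul_add_div hn, Nat.div_eq_of_lt y.2, add_zero,
      Nat.mod_eq_of_lt x.2]
  · ext
    rw [Fin.val_ofNat, mul_comm, Nat.mul_add_mod, Nat.mod_eq_of_lt y.2]

theorem pick_isCover (b : ℕ) {x y : Fin n} (ha : G.Adj x y) :
    x ∈ (pick G b (n * n)).1 ∨ y ∈ (pick G b (n * n)).1 := by
  obtain ⟨h1, h2⟩ := ofNat_pair x y
  have := pick_covers G b (n * n) (pair_lt x y) (by rwa [h1, h2])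
  rwa [h1, h2] at this

/-- The bits can be chosen such that only vertices from a given cover are taken. -/
theorem exists_pick {C : Finset (Fin n)} (hC : ∀ u v, G.Adj u v → u ∈ C ∨ v ∈ C) (e : ℕ) :
    ∃ l b, b < 2 ^ l.length ∧ (∀ x ∈ l, x ∈ C) ∧
      ∀ c, pick G (b + c * 2 ^ l.length) e = (l, c) := by
  induction e with
  | zero => exact ⟨[], 0, by simp, by simp, by simp [pick]⟩
  | succ e ih =>
    obtain ⟨l, b, hb, hl, hp⟩ := ih
    by_cases h : G.Adj (Fin.ofNat n (e / n)) (Fin.ofNat n e) ∧ Fin.ofNat n (e / n) ∉ l ∧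
        Fin.ofNat n e ∉ l
    · obtain ⟨d, hd, hdC⟩ : ∃ d < 2,
          (if d % 2 = 1 then Fin.ofNat n (e / n) else Fin.ofNat n e) ∈ C := by
        rcases hC _ _ h.1 with h' | h'
        · exact ⟨1, by norm_num, by simpa using h'⟩
        · exact ⟨0, by norm_num, by simpa using h'⟩
      -- The lowest bits are consumed first, so the new choice `d` becomes the top bit of `b`. The
      -- unused higher bits `c` are arbitrary; the induction needs this in order to insert `d`.
      refine ⟨l ++ [if d % 2 = 1 then Fin.ofNat n (e / n) else Fin.ofNat n e],
        b + d * 2 ^ l.length, ?_, ?_, fun c => ?_⟩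
      · simp only [List.length_append, List.length_singleton, pow_succ]
        have : d * 2 ^ l.length ≤ 1 * 2 ^ l.length := Nat.mul_le_mul_right _ (by omega)
        omega
      · simp only [List.mem_append, List.mem_singleton]
        rintro x (hx | rfl)
        · exact hl x hx
        · exact hdC
      · have h1 : b + d * 2 ^ l.length + c * 2 ^ (l.length + 1) =
            b + (d + 2 * c) * 2 ^ l.length := by ring
        have h2 : (d + 2 * c) % 2 = d % 2 := by omega
        have h3 : (d + 2 * c) / 2 = c := by omega
        rw [List.length_append, List.length_singleton, h1, pick_succ_of_uncovered G (hp _) h, h2,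
          h3]
    · exact ⟨l, b, hb, hl, fun c => pick_succ_of_covered G (hp c) h⟩

end Pick


/-! ### Constructing a vertex cover from a number -/

namespace RAM

variable {n Y : ℕ} {G : SimpleGraph (Fin n)} {W : Fin n → ℕ} {v : State}

theorem Layout.put_weight (h : Layout G W v) (x : Fin n) (a : ℕ) :
    Layout G (Function.update W x a) (v.put (n * n + x) a) := by
  refine ⟨h.zero, h.one, fun y z => ?_, fun y z => ?_, fun y => ?_⟩
  · have := pair_lt y z
    rw [State.put_mem, if_neg (by omega)]; exact h.adj y z
  · have := pair_lt y z
    rw [State.put_mem, if_neg (by omega)]; exact h.adj_le y z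
  · rw [State.put_mem, Function.update_apply, h.weight]
    exact if_congr (by rw [Nat.add_left_cancel_iff, Fin.val_inj]) rfl rfl

/-- Set all weights to `0`. -/
def clearWeights : Stmt := .loop 8 0 (.store (.bin .add (.var 1) (.var 8)) (.const 0))

theorem tri_clearWeights (hv : Layout G W v) :
    Tri Y clearWeights v (n * 2 + 1) fun v' => SameRegs [8] v v' ∧ Layout G (listWeight []) v' := by
  refine Tri.loop n (fun i v' => SameRegs [8] v v' ∧
    Layout G (fun y => if (y : ℕ) < i then 0 else W y) v') ?_ ?_ ?_ ?_
  · simp [State.set_reg, hv.zero]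
  · exact ⟨(SameRegs.refl _ _).set (by simp) _, by simpa using hv.set (by norm_num) 0⟩
  · rintro i hi u hu8 hu0 ⟨h1, h2⟩
    refine Tri.store (by simp) ?_
    simp only [Expr.eval_add, Expr.eval_var, Expr.eval_const, hu8, h2.one]
    refine ⟨hu8, by simp [State.set_reg, hu0], SameRegs.set (by exact h1) (by simp) _, ?_⟩
    have h3 := (h2.put_weight ⟨i, hi⟩ 0).set (r := 8) (by norm_num) (i + 1)
    convert h3 using 1
    ext y
    rw [Function.update_apply]
    by_cases h : y = ⟨i, hi⟩
    · simp [h]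
    · have : (y : ℕ) ≠ i := fun h' => h (Fin.ext h')
      rw [if_neg h]
      exact if_congr (by omega) rfl rfl
  · rintro u ⟨h1, h2⟩
    refine ⟨h1, ?_⟩
    convert h2 using 1
    ext y
    simp [listWeight]

/-- The first vertex of the pair with the number in register `10`. -/
def Expr.fstEnd : Expr := bin .div (var 10) (var 0)

/-- The second vertex of the pair with the number in register `10`. -/
def Expr.sndEnd : Expr := bin .sub (var 10) (bin .mul (var 0) fstEnd)

/-- Is the pair with the number in register `10` an edge between vertices of weight `0`? -/
def Expr.isUncovered : Expr :=
  and (cell (var 10)) (and (neg (weight fstEnd)) (neg (weight sndEnd)))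

/-- The lowest bit of the number in register `9`. -/
def Expr.lowBit : Expr := bin .sub (var 9) (bin .mul (const 2) (bin .div (var 9) (const 2)))

/-- The end of the pair with the number in register `10` that `Expr.lowBit` tells to take. -/
def Expr.chosenEnd : Expr := bin .add (bin .mul lowBit fstEnd) (bin .mul (neg lowBit) sndEnd)

/-- Give the weight in register `2` to the chosen end of the current pair. -/
def addVertex : Stmt :=
  .seq (.store (.bin .add (.var 1) .chosenEnd) (.var 2))
    (.seq (.assign 2 (.bin .mul (.const 4) (.var 2))) (.assign 9 (.bin .div (.var 9) (.const 2))))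

section

variable [NeZero n]

theorem eval_fstEnd (hv : Layout G W v) (he : v.reg 10 < n * n) :
    Expr.fstEnd.eval v = Fin.ofNat n (v.reg 10 / n) := by
  rw [Expr.fstEnd, Expr.eval_div, Expr.eval_var, Expr.eval_var, hv.zero, Fin.val_ofNat,
    Nat.mod_eq_of_lt (Nat.div_lt_of_lt_mul he)]

theorem eval_sndEnd (hv : Layout G W v) :
    Expr.sndEnd.eval v = Fin.ofNat n (v.reg 10) := by
  have := Nat.div_add_mod (v.reg 10) n
  simp only [Expr.sndEnd, Expr.fstEnd, Expr.eval_sub, Expr.eval_mul, Expr.eval_div, Expr.eval_var,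
    hv.zero, Fin.val_ofNat]
  omega

theorem isUncovered_ne_zero {l : List (Fin n)} (hv : Layout G (listWeight l) v)
    (he : v.reg 10 < n * n) : Expr.isUncovered.eval v ≠ 0 ↔
      G.Adj (Fin.ofNat n (v.reg 10 / n)) (Fin.ofNat n (v.reg 10)) ∧
        Fin.ofNat n (v.reg 10 / n) ∉ l ∧ Fin.ofNat n (v.reg 10) ∉ l := by
  have h1 : v.reg 10 =
      (Fin.ofNat n (v.reg 10 / n) : Fin n) * n + (Fin.ofNat n (v.reg 10) : Fin n) := by
    rw [Fin.val_ofNat, Fin.val_ofNat, Nat.mod_eq_of_lt (Nat.div_lt_of_lt_mul he),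
      Nat.div_add_mod']
  have h2 : ∀ y, listWeight l y = 0 ↔ y ∉ l := by
    intro y
    simp [listWeight]
  have h3 := hv.adj (Fin.ofNat n (v.reg 10 / n)) (Fin.ofNat n (v.reg 10))
  rw [← h1] at h3
  simp only [Expr.isUncovered, Expr.and_ne_zero, Expr.neg_ne_zero, not_not, Expr.weight,
    Expr.eval_cell, Expr.eval_add, Expr.eval_var, eval_fstEnd hv he, eval_sndEnd hv, hv.one,
    hv.weight, h2, h3]

theorem eval_chosenEnd (hv : Layout G W v) (he : v.reg 10 < n * n) :
    Expr.chosenEnd.eval v = (if v.reg 9 % 2 = 1 then Fin.ofNat n (v.reg 10 / n)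
      else Fin.ofNat n (v.reg 10) : Fin n) := by
  have h1 : Expr.lowBit.eval v = v.reg 9 % 2 := by
    simp only [Expr.lowBit, Expr.eval_sub, Expr.eval_mul, Expr.eval_div, Expr.eval_var,
      Expr.eval_const]
    omega
  rw [Expr.chosenEnd, Expr.eval_add, Expr.eval_mul, Expr.eval_mul, Expr.eval_neg, h1,
    eval_fstEnd hv he, eval_sndEnd hv]
  rcases Nat.mod_two_eq_zero_or_one (v.reg 9) with h | h <;> simp [h]

/-- Run through all pairs of vertices and make the choices that the number in register `7`
prescribes. -/
def chooseCover : Stmt :=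
  .seq clearWeights (.seq (.assign 2 (.const 1)) (.seq (.assign 9 (.var 7))
    (.loop 10 1 (.cond .isUncovered addVertex))))

/-- The program follows `pick`: the list is stored through its weights, register `2` holds the next
free weight and register `9` the remaining bits. -/
theorem tri_chooseCover (hY : 2 * n + 2 ≤ Y) (hv : Layout G W v) :
    Tri Y chooseCover v (n * 2 + 1 + (1 + (1 + (n * n * 5 + 1)))) fun v' =>
      SameRegs [2, 8, 9, 10] v v' ∧ Layout G (listWeight (pick G (v.reg 7) (n * n)).1) v' ∧
        v'.reg 2 = 4 ^ (pick G (v.reg 7) (n * n)).1.length := by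
  refine Tri.seq ((tri_clearWeights hv).mono le_rfl ?_)
  rintro v₁ ⟨h1, h2⟩
  refine Tri.seq (Tri.assign (by simpa using Nat.one_lt_two_pow (by omega)) ?_)
  refine Tri.seq (Tri.of_bounded fun hb => Tri.assign (hb.reg 7 (by decide)) ?_)
  rw [Expr.eval_const, Expr.eval_var]
  refine Tri.loop (n * n) (fun i v' => SameRegs [2, 8, 9, 10] v v' ∧
    Layout G (listWeight (pick G (v.reg 7) i).1) v' ∧
      v'.reg 2 = 4 ^ (pick G (v.reg 7) i).1.length ∧ v'.reg 9 = (pick G (v.reg 7) i).2)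
      ?_ ?_ ?_ ?_
  · simp [State.set_reg, h2.one]
  · refine ⟨(SameRegs.set (SameRegs.set (fun r hr => h1 r ?_) (by simp) _) (by simp) _).set
      (by simp) _, ((h2.set (by norm_num) _).set (by norm_num) _).set (by norm_num) _,
      by simp [State.set_reg, pick], ?_⟩
    · simp at hr ⊢; tauto
    · simp [State.set_reg, pick, h1 7 (by simp)]
  · rintro e he u hu10 hu1 ⟨h3, h4, h5, h6⟩
    obtain ⟨⟨l, c⟩, hp⟩ : ∃ s, pick G (v.reg 7) e = s := ⟨_, rfl⟩
    rw [hp] at h4 h5 h6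
    have hu := isUncovered_ne_zero h4 (by rw [hu10]; exact he)
    have hz := eval_chosenEnd h4 (by rw [hu10]; exact he)
    rw [hu10] at hu hz
    rw [h6] at hz
    refine Tri.cond (t := 1 + (1 + 1)) (fun h => ?_) fun h => ?_
    · rw [hu] at h
      have hs := pick_succ_of_uncovered G hp h
      set x := (if c % 2 = 1 then Fin.ofNat n (e / n) else Fin.ofNat n e) with hx
      have hxl : x ∉ l := by
        rw [hx]; split_ifs
        exacts [h.2.1, h.2.2]
      have hlen := pick_length_le G (v.reg 7) (e + 1)
      rw [hs, List.length_append, List.length_singleton] at hlen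
      -- The extended list has at most `n` elements, so the next weight is at most `2 ^ (2 * n)`.
      have h4l : 4 * 4 ^ l.length < 2 ^ Y := by
        rw [← pow_succ', show 4 = 2 ^ 2 from rfl, ← pow_mul]
        exact Nat.pow_lt_pow_right (by norm_num) (by omega)
      refine Tri.seq (Tri.store (by rw [Expr.eval_var, h5]; dsimp only; omega) ?_)
      rw [Expr.eval_add, Expr.eval_var, h4.one, hz, Expr.eval_var, h5]
      refine Tri.seq (Tri.assign ?_ ?_)
      · simpa [h5] using h4l
      refine Tri.of_bounded fun hb => Tri.assign ((Nat.div_le_self _ _).trans_lt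
        (hb.reg 9 (by decide))) ?_
      simp only [Expr.eval_div, Expr.eval_mul, Expr.eval_var, Expr.eval_const, State.set_reg,
        State.put_reg, h5, h6]
      refine ⟨by simp [hu10], by simp [hu1], ?_, ?_, ?_, ?_⟩
      · exact SameRegs.set (SameRegs.set (SameRegs.set (by exact h3) (by simp) _) (by simp) _)
          (by simp) _
      · rw [hs, listWeight_append hxl]
        exact (((h4.put_weight x _).set (by norm_num) _).set (by norm_num) _).set (by norm_num) _
      · simp [hs, pow_succ']
      · simp [hs]
    · have hs := pick_succ_of_covered G hp fun h' => (hu.2 h') h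
      refine ⟨hu10, by simp [State.set_reg, hu1], h3.set (by simp) _, ?_, ?_, ?_⟩
      · rw [hs]
        exact h4.set (by norm_num) _
      · simp [State.set_reg, hs, h5]
      · simp [State.set_reg, hs, h6]
  · rintro u ⟨h3, h4, h5, -⟩
    exact ⟨h3, h4, h5⟩

end

end RAM


/-! ### Searching a small vertex cover -/

namespace RAM

variable {n k Y : ℕ} {G : SimpleGraph (Fin n)} {v : State}

/-- The memory contains the weights for a vertex cover of at most `k` vertices, register `2`
contains the corresponding power of `4`, and register `3` contains `1`. -/
def Found (G : SimpleGraph (Fin n)) (k : ℕ) (v : State) : Prop :=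
  v.reg 3 = 1 ∧ ∃ C j W, Layout G W v ∧ IsWeight W C j ∧ (∀ x y, G.Adj x y → x ∈ C ∨ y ∈ C) ∧
    j ≤ k ∧ v.reg 2 = 4 ^ j

/-- No vertex cover has been found so far. -/
def Searching (G : SimpleGraph (Fin n)) (v : State) : Prop := v.reg 3 = 0 ∧ ∃ W, Layout G W v

theorem Found.set (h : Found G k v) {r : ℕ} (hr : 4 ≤ r) (x : ℕ) : Found G k (v.set r x) := by
  obtain ⟨h1, C, j, W, h2, h3, h4, h5, h6⟩ := h
  refine ⟨by rw [State.set_reg, if_neg (by omega), h1], C, j, W, h2.set (by omega) _, h3, h4, h5,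
    by rw [State.set_reg, if_neg (by omega), h6]⟩

theorem Searching.set (h : Searching G v) {r : ℕ} (hr : 4 ≤ r) (x : ℕ) :
    Searching G (v.set r x) := by
  obtain ⟨h1, W, h2⟩ := h
  exact ⟨by rw [State.set_reg, if_neg (by omega), h1], W, h2.set (by omega) _⟩

/-- Check whether the choices for the number in register `7` give a small cover. -/
def tryNumber : Stmt :=
  .cond (.neg (.var 3)) (.seq chooseCover
    (.cond (.le (.var 2) (.bin .mul (.var 4) (.var 4))) (.assign 3 (.const 1))))

/-- Check this for all numbers below the content of register `6`. -/
def tryNumbers : Stmt := .loop 7 6 tryNumber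

/-- Search a vertex cover of minimum size. -/
def findCover : Stmt :=
  .seq (.assign 4 (.const 1)) (.seq (.assign 17 (.bin .add (.var 0) (.const 1)))
    (.loop 5 17 (.seq (.assign 6 (.bin .mul (.neg (.var 3)) (.var 4)))
      (.seq tryNumbers (.assign 4 (.bin .mul (.const 2) (.var 4)))))))

variable [NeZero n]

/-- The size of the candidate is compared with `m` through powers: register `2` is `4` to the size,
register `4` is `2 ^ m`. The bound `m ≤ k` is only available while searching, since the rounds go on
after a cover has been found. -/
theorem tri_tryNumber (hY : 2 * n + 2 ≤ Y) {m : ℕ} (hm : Searching G v → m ≤ k)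
    (h4 : v.reg 4 = 2 ^ m)
    (hv : Found G k v ∨ Searching G v) :
    Tri Y tryNumber v (n * 2 + 1 + (1 + (1 + (n * n * 5 + 1))) + 2 + 1) fun v' =>
      SameRegs [2, 3, 8, 9, 10] v v' ∧ (Found G k v' ∨
        Searching G v ∧ Searching G v' ∧ m < (pick G (v.reg 7) (n * n)).1.length) := by
  refine Tri.cond (fun h => ?_) fun h => ?_
  · rw [Expr.neg_ne_zero, Expr.eval_var, not_not] at h
    have hs := hv.resolve_left fun h' => by have := h'.1; omega
    obtain ⟨W, hW⟩ := hs.2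
    refine Tri.seq ((tri_chooseCover hY hW).mono le_rfl ?_)
    rintro v₁ ⟨h1, h2, h3⟩
    have h4' : v₁.reg 4 = 2 ^ m := by rw [h1 4 (by simp), h4]
    have h5 : (Expr.bin .mul (.var 4) (.var 4)).eval v₁ = 4 ^ m := by
      rw [Expr.eval_mul, Expr.eval_var, h4', ← mul_pow]
      norm_num
    have h6 : (Expr.le (.var 2) (.bin .mul (.var 4) (.var 4))).eval v₁ ≠ 0 ↔
        (pick G (v.reg 7) (n * n)).1.length ≤ m := by
      rw [Expr.le_ne_zero, h5, Expr.eval_var, h3, Nat.pow_le_pow_iff_right (by norm_num)]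
    refine Tri.cond (t := 1) (fun h7 => ?_) fun h7 => ?_
    · rw [h6] at h7
      refine Tri.assign (by simpa using Nat.one_lt_two_pow (by omega)) ?_
      refine ⟨SameRegs.set (fun r hr => h1 r (by simp at hr ⊢; tauto)) (by simp) _, .inl
        ⟨by simp [State.set_reg], _, _, _, h2.set (by norm_num) _,
          isWeight_listWeight (pick_nodup G _ _), fun x y hxy => ?_, h7.trans (hm hs), ?_⟩⟩
      · simpa using pick_isCover G _ hxy
      · simp [State.set_reg, h3]
    · refine ⟨fun r hr => h1 r (by simp at hr ⊢; tauto), .inr ⟨hs, ⟨?_, _, h2⟩, ?_⟩⟩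
      · rw [h1 3 (by simp), h]
      · by_contra h8
        exact h6.2 (by omega) h7
  · refine ⟨SameRegs.refl _ _, .inl (hv.resolve_right fun h' => ?_)⟩
    rw [Expr.eval_neg, Expr.eval_var, h'.1] at h
    simp at h

theorem tri_tryNumbers (hY : 2 * n + 2 ≤ Y) {m L : ℕ} (hm : Searching G v → m ≤ k)
    (h4 : v.reg 4 = 2 ^ m)
    (h6 : v.reg 6 = L) (hv : Found G k v ∨ Searching G v) :
    Tri Y tryNumbers v (L * (n * 2 + 1 + (1 + (1 + (n * n * 5 + 1))) + 2 + 1 + 1) + 1) fun v' =>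
      SameRegs [2, 3, 7, 8, 9, 10] v v' ∧ (Found G k v' ∨
        Searching G v ∧ Searching G v' ∧ ∀ b < L, m < (pick G b (n * n)).1.length) := by
  refine Tri.loop L (fun i v' => SameRegs [2, 3, 7, 8, 9, 10] v v' ∧ (Found G k v' ∨
    Searching G v ∧ Searching G v' ∧ ∀ b < i, m < (pick G b (n * n)).1.length)) ?_ ?_ ?_ ?_
  · simp [State.set_reg, h6]
  · exact ⟨(SameRegs.refl _ _).set (by simp) _, hv.imp (fun h => h.set (by norm_num) _)
      fun h => ⟨h, h.set (by norm_num) _, by simp⟩⟩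
  · rintro b hb u hu7 hu6 ⟨h1, h2⟩
    refine (tri_tryNumber hY (fun hs => hm (h2.resolve_left fun h' => by
      have := h'.1; have := hs.1; omega).1) (by rw [h1 4 (by simp), h4])
        (h2.imp_right fun h => h.2.1)).mono le_rfl ?_
    rintro u' ⟨h3, h5⟩
    refine ⟨by rw [h3 7 (by simp), hu7], by simp [State.set_reg, h3 6 (by simp), hu6],
      (h1.trans h3 (by simp)).set (by simp) _, ?_⟩
    rcases h5 with h5 | ⟨hs, h5, h7⟩
    · exact .inl (h5.set (by norm_num) _)
    · obtain ⟨h9, -, h8⟩ := h2.resolve_left fun h' => by have := h'.1; have := hs.1; omega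
      refine .inr ⟨h9, h5.set (by norm_num) _, fun b' hb' => ?_⟩
      rcases Nat.lt_succ_iff_lt_or_eq.1 hb' with hb' | rfl
      · exact h8 b' hb'
      · rwa [hu7] at h7
  · exact fun _ h => h

/-- Round `m` tries `2 ^ m` numbers. Some number makes all choices inside a minimum cover, which
gives a list of at most `k` vertices; so round `k` succeeds if no earlier one does, and `k ≤ n`
makes `n + 1` rounds enough. -/
theorem tri_findCover (hY : 2 * n + 2 ≤ Y) {W : Fin n → ℕ} (hv : Layout G W v)
    (h3 : v.reg 3 = 0) (hk : G.vertexCoverNum = k) :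
    Tri Y findCover v (1 + (1 + ((n + 1) * (1 + (2 ^ k * (n * 2 + 1 + (1 + (1 +
      (n * n * 5 + 1))) + 2 + 1 + 1) + 1 + 1) + 1) + 1))) (Found G k) := by
  obtain ⟨C, hC, hCk⟩ : ∃ C : Finset (Fin n), (∀ x y, G.Adj x y → x ∈ C ∨ y ∈ C) ∧
      C.card = k := by
    obtain ⟨c, hck, hc⟩ := G.vertexCoverNum_exists
    lift c to Finset (Fin n) using c.toFinite
    rw [hk, Set.encard_coe_eq_coe_finsetCard, Nat.cast_inj] at hck
    exact ⟨c, fun x y hxy => by simpa using hc hxy, hck⟩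
  have hkn : k ≤ n := by
    have := C.card_le_univ
    rwa [hCk, Fintype.card_fin] at this
  refine Tri.seq (Tri.assign (by simpa using Nat.one_lt_two_pow (by omega)) ?_)
  have hn : n + 1 < 2 ^ Y := lt_of_lt_of_le (by omega) (Nat.lt_two_pow_self (n := Y)).le
  refine Tri.seq (Tri.assign (by simp [State.set_reg, hv.zero, hn]) ?_)
  simp only [Expr.eval_const, Expr.eval_add, Expr.eval_var, State.set_reg, hv.zero]
  refine Tri.loop (n + 1) (fun i v' => v'.reg 4 = 2 ^ i ∧ (Found G k v' ∨
    Searching G v' ∧ i ≤ k)) ?_ ?_ ?_ ?_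
  · simp [State.set_reg]
  · exact ⟨by simp [State.set_reg], .inr ⟨⟨by simp [State.set_reg, h3], W,
      ((hv.set (by norm_num) _).set (by norm_num) _).set (by norm_num) _⟩, k.zero_le⟩⟩
  · rintro m hm u hu5 hu17 ⟨h4, h5⟩
    have hmY : 2 * 2 ^ m < 2 ^ Y := by
      rw [← pow_succ']
      exact Nat.pow_lt_pow_right (by norm_num) (by omega)
    -- After success the factor from register `3` makes the number of trials `0`. Hence no round has
    -- more than `2 ^ k` trials, although `m` may exceed `k`.
    obtain ⟨L, hL, hLk, hLm⟩ : ∃ L, (Expr.bin .mul (.neg (.var 3)) (.var 4)).eval u = L ∧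
        L ≤ 2 ^ k ∧ (Searching G u → L = 2 ^ m ∧ m ≤ k) := by
      refine ⟨_, rfl, ?_⟩
      rw [Expr.eval_mul, Expr.eval_neg, Expr.eval_var, Expr.eval_var, h4]
      rcases h5 with h5 | ⟨h5, hmk⟩
      · simp [h5.1, Searching]
      · rw [h5.1, if_pos rfl, one_mul]
        exact ⟨Nat.pow_le_pow_right (by norm_num) hmk, fun _ => ⟨rfl, hmk⟩⟩
    have hLY : L < 2 ^ Y := hLk.trans_lt (Nat.pow_lt_pow_right (by norm_num) (by omega))
    refine Tri.mono (Tri.seq (t := 1) (Tri.assign (by rwa [hL]) ?_)) (le_of_eq_of_le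
      (b := 1 + (L * (n * 2 + 1 + (1 + (1 + (n * n * 5 + 1))) + 2 + 1 + 1) + 1 + 1)) rfl ?_)
      fun _ h => h
    · rw [hL]
      have hLm' : Searching G (u.set 6 L) → L = 2 ^ m ∧ m ≤ k := fun h => hLm <|
        (h5.resolve_left fun h' => by
          have := (h'.set (r := 6) (by norm_num) L).1; have := h.1; omega).1
      refine Tri.seq ((tri_tryNumbers (k := k) (m := m) hY
        (fun h => (hLm' h).2) (by simp [State.set_reg, h4])
        (by simp [State.set_reg]) (h5.imp (fun h => h.set (by norm_num) _)
          fun h => h.1.set (by norm_num) _)).mono le_rfl ?_)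
      rintro u' ⟨h6, h7⟩
      have h4' : u'.reg 4 = 2 ^ m := by rw [h6 4 (by simp)]; simp [State.set_reg, h4]
      refine Tri.assign (by simpa [h4'] using hmY) ?_
      refine ⟨?_, ?_, ?_, ?_⟩
      · simp [State.set_reg, h6 5 (by simp), hu5]
      · simp [State.set_reg, h6 17 (by simp), hu17]
      · simp [State.set_reg, h4', pow_succ']
      refine h7.imp (fun h => (h.set (by norm_num) _).set (by norm_num) _) ?_
      rintro ⟨h8, h9, h10⟩
      refine ⟨(h9.set (by norm_num) _).set (by norm_num) _, ?_⟩
      obtain ⟨rfl, hmk⟩ := hLm' h8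
      -- If `m` were equal to `k`, this good number `b` would have been among those tried, with a
      -- list of length at most `m`.
      obtain ⟨l, b, hb, hlC, hp⟩ := exists_pick G hC (n * n)
      have hp := hp 0
      rw [zero_mul, add_zero] at hp
      have hl := pick_nodup G b (n * n)
      rw [hp] at hl
      have hlk : l.length ≤ k := by
        rw [← hCk, ← List.toFinset_card_of_nodup hl]
        exact Finset.card_le_card fun x hx => hlC x (by simpa using hx)
      by_contra hmk'
      have := h10 b (hb.trans_le (Nat.pow_le_pow_right (by norm_num) (by omega)))
      rw [hp] at this
      dsimp only at this
      omega
    · gcongr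
  · rintro u ⟨-, h⟩
    exact h.resolve_right fun h => by omega

end RAM


/-! ### Computing the treewidth and adding up the time -/

namespace RAM

variable {n k w Y : ℕ} {G : SimpleGraph (Fin n)} {W : Fin n → ℕ} {v : State}

/-- The entry of the table that tells whether the treewidth is at most the number in
register `11`. -/
def Expr.success : Expr := flag (sum 20 (weight (var 20)))

theorem eval_success (hv : Layout G W v) {C : Finset (Fin n)} (hW : IsWeight W C k) :
    Expr.success.eval v = v.mem (n * n + n + code W C ∅ ∅) := by
  rw [Expr.success, hv.eval_flag, hv.eval_sum]
  congr 2
  have h1 : ∀ x : Fin n, (Expr.weight (.var 20)).eval (v.set 20 x) = W x := fun x =>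
    (hv.set (by norm_num) x).eval_weight (by simp [State.set_reg])
  simp only [h1, code, Finset.sum_empty, mul_zero, add_zero]
  refine (Finset.sum_subset (Finset.subset_univ C) fun x _ hx => ?_).symm
  rw [← hW.weight_pos_iff] at hx
  omega

/-- Count the numbers below `n` that are less than the treewidth. -/
def countWidths : Stmt :=
  .seq (.assign 12 (.const 0)) (.seq (.assign 16 (.bin .mul (.const 2) (.var 0)))
    (.loop 11 0 (.seq fillTable (.assign 12 (.bin .add (.var 12) (.neg .success))))))

/-- Compute the treewidth. -/
def computeTreewidth : Stmt :=
  .seq (.assign 1 (.bin .mul (.var 0) (.var 0))) (.seq findCover countWidths)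

theorem treewidth_le_card : treewidth G ≤ n :=
  RootedDec.treewidth_le_iff.2 (RootedDec.univ_of_card_le (by simp))

/-- After the widths below `i` have been tested, the counter is `min (treewidth G) i`. As the
treewidth is at most `n`, the counter ends with the treewidth. The cover may have any size `j ≤ k`;
the time is monotone in `j`. -/
theorem tri_countWidths [DecidableRel G.Adj] (hY : 2 * n + 2 ≤ Y) (hn : 1 ≤ n)
    (hv : Found G k v) :
    Tri Y countWidths v (1 + (1 + (n * ((4 ^ k * 2 + 1) + (1 + (2 * n * (4 ^ k * (n * 7 + 2) + 2)
      + 1)) + 1 + 1) + 1))) fun v' => v'.reg 12 = treewidth G := by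
  obtain ⟨-, C, j, W, hv, hW, hC, hj, h2⟩ := hv
  have hjk : 4 ^ j ≤ 4 ^ k := Nat.pow_le_pow_right (by norm_num) hj
  have hn2 : 2 * n + 2 < 2 ^ Y := hY.trans_lt Nat.lt_two_pow_self
  refine Tri.seq (Tri.assign (by simp) ?_)
  refine Tri.seq (Tri.assign ?_ ?_)
  · simp only [Expr.eval_const, Expr.eval_mul, Expr.eval_var, State.set_reg, hv.zero]
    simp only [OfNat.zero_ne_ofNat, if_false]
    omega
  simp only [Expr.eval_const, Expr.eval_mul, Expr.eval_var, State.set_reg, hv.zero]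
  refine Tri.mono (t := n * ((4 ^ j * 2 + 1) + (1 + (2 * n * (4 ^ j * (n * 7 + 2) + 2)
      + 1)) + 1 + 1) + 1) (Tri.loop n (fun i v' => Layout G W v' ∧ v'.reg 2 = 4 ^ j ∧
    v'.reg 16 = 2 * n ∧ v'.reg 12 = min (treewidth G) i) ?_ ?_ ?_ ?_) (by gcongr) fun _ h => h
  · simp [State.set_reg, hv.zero]
  · exact ⟨((hv.set (by norm_num) _).set (by norm_num) _).set (by norm_num) _,
      by simp [State.set_reg, h2], by simp [State.set_reg], by simp [State.set_reg]⟩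
  · rintro w hw u hu11 hu0 ⟨h3, h4, h5, h6⟩
    refine Tri.seq ((tri_fillTable (by omega) hn h3 hW h4 hu11 h5).mono le_rfl ?_)
    rintro u' ⟨h7, h8, h9⟩
    rw [← CoverDec.treewidth_le_iff hC] at h9
    have h10 : (Expr.bin .add (.var 12) (.neg .success)).eval u' =
        min (treewidth G) (w + 1) := by
      rw [Expr.eval_add, Expr.eval_neg, eval_success h8 hW, Expr.eval_var, h7 12 (by simp), h6]
      rcases h9 with ⟨h9, h10⟩ | ⟨h9, h10⟩
      · rw [if_neg (by omega)]; omega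
      · rw [if_pos h9]; omega
    refine Tri.assign (by rw [h10]; omega) ?_
    rw [h10]
    refine ⟨by simp [State.set_reg, h7 11 (by simp), hu11],
      by simp [State.set_reg, h7 0 (by simp), hu0],
      (h8.set (by norm_num) _).set (by norm_num) _, ?_, ?_, ?_⟩
    · simp [State.set_reg, h7 2 (by simp), h4]
    · simp [State.set_reg, h7 16 (by simp), h5]
    · simp [State.set_reg]
  · rintro u ⟨-, -, -, h⟩
    rw [h, min_eq_left treewidth_le_card]

theorem tri_computeTreewidth [DecidableRel G.Adj] (hY : 2 * n + 2 ≤ Y) (hn : 1 ≤ n)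
    (hk : G.vertexCoverNum = k) : Tri Y computeTreewidth (graphInput G) (160 * 4 ^ k * n ^ 3)
      fun v' => v'.reg 12 = treewidth G := by
  have : NeZero n := ⟨by omega⟩
  have hnn : n * n < 2 ^ Y := by
    calc n * n < 2 ^ n * 2 ^ n := Nat.mul_lt_mul'' Nat.lt_two_pow_self Nat.lt_two_pow_self
      _ = 2 ^ (n + n) := (pow_add _ _ _).symm
      _ ≤ 2 ^ Y := Nat.pow_le_pow_right (by norm_num) (by omega)
  -- The weights may initially be whatever the memory contains, as they are cleared before use.
  have hv : Layout G (fun x => (graphInput G).mem (n * n + x))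
      ((graphInput G).set 1 (n * n)) := by
    refine ⟨by simp [State.set_reg, graphInput], by simp [State.set_reg], fun x y => ?_,
      fun x y => ?_, fun x => rfl⟩
    · rw [State.set_mem]
      simp only [graphInput, ne_eq, ite_eq_right_iff, one_ne_zero, imp_false, not_not]
      constructor
      · rintro ⟨x', y', h, hxy⟩
        have h1 := ofNat_pair x y
        have h2 := ofNat_pair x' y'
        rw [h] at h1
        rwa [← h1.1, ← h1.2, h2.1, h2.2]
      · exact fun h => ⟨x, y, rfl, h⟩
    · rw [State.set_mem]
      simp only [graphInput]
      split_ifs <;> simp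
  have key := Tri.seq (t := 1) (p := .assign 1 (.bin .mul (.var 0) (.var 0)))
    (v := graphInput G) (Tri.assign (Y := Y) (by simpa [graphInput] using hnn)
    (by
      have : (Expr.bin .mul (.var 0) (.var 0)).eval (graphInput G) = n * n := rfl
      rw [this]
      exact Tri.seq ((tri_findCover hY hv (by simp [State.set_reg, graphInput]) hk).mono le_rfl
        fun u hu => tri_countWidths hY hn hu)))
  refine key.mono ?_ fun _ h => h
  have h1 : 2 ^ k ≤ 4 ^ k := Nat.pow_le_pow_left (by norm_num) k
  have h2 : 1 ≤ 4 ^ k := Nat.one_le_pow _ _ (by norm_num)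
  have h3 : ∀ i ≤ 3, n ^ i ≤ n ^ 3 := fun i hi => Nat.pow_le_pow_right hn hi
  generalize 2 ^ k = p at *
  generalize 4 ^ k = q at *
  have h4 : ∀ i ≤ 3, n ^ i ≤ q * n ^ 3 := fun i hi => (h3 i hi).trans (Nat.le_mul_of_pos_left _ h2)
  have h5 : ∀ i ≤ 3, p * n ^ i ≤ q * n ^ 3 := fun i hi => Nat.mul_le_mul h1 (h3 i hi)
  have h6 : ∀ i ≤ 3, q * n ^ i ≤ q * n ^ 3 := fun i hi => Nat.mul_le_mul_left q (h3 i hi)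
  -- Every monomial of the time bound is at most `q * n ^ 3`, and `160` exceeds the sum of the
  -- coefficients.
  linarith [h4 0 (by simp), h4 1 (by simp), h4 2 (by simp), h5 0 (by simp), h5 1 (by simp),
    h5 2 (by simp), h5 3 (by simp), h6 0 (by simp), h6 1 (by simp), h6 2 (by simp)]

theorem wf_computeTreewidth : computeTreewidth.WF := by
  simp [numVars, computeTreewidth, findCover, tryNumbers, tryNumber, chooseCover, clearWeights,
    addVertex, countWidths, fillTable, numberLoop, vertexLoop, applyRules, setIf, Stmt.WF, Expr.WF,
    Expr.success, Expr.isUncovered, Expr.chosenEnd, Expr.lowBit, Expr.sndEnd, Expr.fstEnd,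
    Expr.canIntro, Expr.canForget, Expr.canJoin, Expr.left, Expr.right, Expr.union, Expr.hasOpen,
    Expr.hasLarge, Expr.degree, Expr.bagSize, Expr.isCrossing, Expr.digit, Expr.flag, Expr.entry,
    Expr.weight, Expr.adj, Expr.and, Expr.le, Expr.eq, Expr.neg]

theorem bounded_graphInput [DecidableRel G.Adj] (hn : n ≤ Y) (hY : 1 ≤ Y) :
    Bounded Y (graphInput G) := by
  have h1 : n < 2 ^ Y := hn.trans_lt Nat.lt_two_pow_self
  refine ⟨fun r _ => ?_, fun a => ?_, hn⟩
  · simp only [graphInput]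
    split_ifs
    · exact h1
    · positivity
  · simp only [graphInput]
    split_ifs
    · exact Nat.one_lt_two_pow (by omega)
    · positivity

end RAM

/-- With `Y = 4 * n`, which is at least `2 * n + 2`, a step costs a constant times `n ^ (c + 1)`,
and `160 * 4 ^ k * n ^ 3` steps give the exponent `c + 4`. Statements never write register `0`, so
the result is copied there by a separate machine instruction; this costs at most `10 * n`. -/
theorem mainTheorem5 :
    ∃ (p : RAM.Program) (c d : ℕ),
      ∀ (n : ℕ), 1 ≤ n → ∀ (G : SimpleGraph (Fin n)) [DecidableRel G.Adj] (k : ℕ),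
        G.vertexCoverNum = (k : ℕ∞) →
          ∃ (s : RAM.State) (t : ℕ),
            RAM.Exec p (RAM.graphInput G) s t ∧
            s.reg 0 = treewidth G ∧
            t ≤ c * 4 ^ k * n ^ d := by
  obtain ⟨c, hc⟩ := RAM.Stmt.exists_costs RAM.wf_computeTreewidth
  refine ⟨.seq RAM.computeTreewidth.compile (.assign 0 (.reg 12)),
    20 * (c + 1) * 4 ^ (c + 1) * 160 + 10, c + 4, fun n hn G _ k hk => ?_⟩
  obtain ⟨s, t, v, h1, h2, h3, h4, h5⟩ := RAM.tri_computeTreewidth (Y := 4 * n) (by omega) hn hk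
    RAM.wf_computeTreewidth (by omega) c hc (RAM.bounded_graphInput (by omega) (by omega)) _
    (RAM.Agree.refl _)
  have h6 : s.reg 12 = v.reg 12 := h3.2 12 (by decide)
  refine ⟨_, _, .seq h1 (RAM.exec_assign s 0 (.reg 12)), ?_, ?_⟩
  · simp only [RAM.State.set_reg, if_true, RAM.Term.eval, h6, h5]
  · simp only [RAM.Term.cost, RAM.Term.eval, h6]
    have h7 := RAM.len_le_of_lt (h4.reg 12 (by decide))
    have h8 : 1 ≤ 4 ^ k := Nat.one_le_pow _ _ (by norm_num)
    have h9 : n ≤ n ^ (c + 4) := Nat.le_self_pow (by omega) n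
    have h10 : n ≤ 4 ^ k * n ^ (c + 4) := h9.trans (Nat.le_mul_of_pos_left _ h8)
    have h11 : (20 * (c + 1) * 4 ^ (c + 1) * 160 + 10) * 4 ^ k * n ^ (c + 4) =
        RAM.tick c (4 * n) * (160 * 4 ^ k * n ^ 3) + 10 * (4 ^ k * n ^ (c + 4)) := by
      rw [RAM.tick]; ring
    omega
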